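/- **Setting.** Let $\eta_1,\eta_2,\dots$ be i.i.d. measurable, square integrable processes on $[0,1]$ with mean $m(x)=\mathrm E\,\eta_i(x)$ and stationary covariance $\mathrm{Cov}\{\eta_i(x),\eta_i(x')\}=C(|x-x'|)$, and put $Z_i=\eta_i-m$. Let $\lambda_1\ge\lambda_2\ge\dots\ge0$, $\sum_k\lambda_k<\infty$, be eigenvalues and $\psi_1,\psi_2,\dots$ orthonormal eigenfunctions of the covariance, so that $\int_0^1 C(|x-x'|)\psi_k(x')\,dx'=\lambda_k\psi_k(x)$ and $C(|x-x'|)=\sum_{k}\lambda_k\psi_k(x)\psi_k(x')$ for all $x,x'\in[0,1]$. Put $\phi_k=\sqrt{\lambda_k}\,\psi_k$, and let $\xi_{ik}$ be the scores: $\int_0^1 Z_i\phi_k=\lambda_k\xi_{ik}$, $\mathrm E\,\xi_{ik}=0$, $\mathrm E\,\xi_{ik}\xi_{ik'}=\delta_{kk'}$, and the sequences $(\xi_{ik})_{k\ge1}$, $i\ge1$, are i.i.d. For $1\le i\le n$, $1\le j\le N$ one observes $$Y_{ij}=\eta_i(j/N)+\sigma(j/N)\,\varepsilon_{ij},$$ where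 $\sigma\ge 0$ and the $\varepsilon_{ij}$ are i.i.d. with mean $0$ and variance $1$ and the array $(\varepsilon_{ij})$ is independent of $(\eta_i)_i$. Fix $h_0\in(0,1)$. For an integer $p\ge1$ and $J_s=J_s(N)$ equally spaced interior knots $\ell/(J_s+1)$, let $\mathcal S$ be the space of splines of order $p$: the $p-2$ times continuously differentiable functions on $[0,1]$ that are polynomials of degree at most $p-1$ on each of the $J_s+1$ subintervals. Let $$\widehat\eta_i\in\operatorname*{argmin}_{g\in\mathcal S}\sum_{j=1}^N\{Y_{ij}-g(j/N)\}^2,\qquad \widehat m=\frac1n\sum_{i=1}^n\widehat\eta_i,\qquad \widehat Z_i=\widehat\eta_i-\widehat m,$$ and for $h\in[0,h_0]$ $$\widehat C(h)=\frac1{1-h}\int_0^{1-h}\frac1n\sum_{i=1}^n\widehat Z_i(x)\widehat Z_i(x+h)\,dx,\qquad \widetilde C(h)=\frac1{1-h}\int_0^{1-h}\frac1n\sum_{i=1}^n Z_i(x)Z_i(x+h)\,dx,\qquad \Delta(h)=\widetilde C(h)-C(h).$$ **Assumptions.** For an integer $q\ge0$ and $\mu\in(0,1]$, $\mathcal H^{(q,\mu)}[0,1]$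 is the set of $q$ times continuously differentiable $f$ on $[0,1]$ with $\|f\|_{q,\mu}=\sup_{x\ne y}|f^{(q)}(x)-f^{(q)}(y)|/|x-y|^{\mu}<\infty$; $a_N\asymp b_N$ means that the two sequences have the same order. * (A1) $m\in\mathcal H^{(q,\mu)}[0,1]$ for an integer $q>0$ and some $\mu\in(0,1]$; put $p^*=q+\mu$. * (A2) $\sigma\in\mathcal H^{(0,\nu)}[0,1]$ for some $\nu\in(0,1]$; $\sigma$ is bounded on $[0,1]$ and $C$ is bounded on $[0,h_0]$. * (A3) As $N\to\infty$, $n=n(N)\to\infty$ and $n=O(N^{\theta})$ for some $\theta>0$. * (A4) $\phi_k\in\mathcal H^{(q,\mu)}[0,1]$, $\sum_k\|\phi_k\|_{q,\mu}<\infty$, $\sum_k\|\phi_k\|_\infty<\infty$, and for some nondecreasing positive integers $k_n$ and some $\omega>0$, $\sum_{k>k_n}\|\phi_k\|_\infty=o(n^{-1/2})$ and $k_n=O(n^{\omega})$ as $n\to\infty$. * (A5) There are $c_1,c_2>0$, $\gamma_1,\gamma_2>1$, $\beta_1,\beta_2\in(0,1/2)$ with $$\min\Big\{\frac{2(1-\beta_2)p^*}{3+(1+\beta_1)p^*},\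 \frac{2(\nu-\beta_2)}{1+\beta_1}\Big\}>\theta,$$ and, for each large $N$, i.i.d. $N(0,1)$ variables $(U_{ik,\xi})_{i\le n,\,k\le k_n}$ and i.i.d. $N(0,1)$ variables $(U_{ij,\varepsilon})_{i\le n,\,j\le N}$ with $$\Pr\Big\{\max_{k\le k_n}\max_{t\le n}\Big|\sum_{i\le t}(\xi_{ik}-U_{ik,\xi})\Big|>n^{\beta_1}\Big\}<c_1n^{-\gamma_1},\qquad \Pr\Big\{\max_{i\le n}\max_{t\le N}\Big|\sum_{j\le t}(\varepsilon_{ij}-U_{ij,\varepsilon})\Big|>N^{\beta_2}\Big\}<c_2N^{-\gamma_2}.$$ * (A6) $p\ge p^*$; $J_s\asymp N^{\gamma}d_N$ with $d_N>0$ for large $N$ and $d_N+d_N^{-1}=O(\log^{\tau}N)$ for some $\tau>0$; and $$\max\Big\{\frac{5\theta}{4p^*},\ \frac{\theta+(\gamma_1+1+\omega)^{-1}8\theta\beta_1}{2p^*},\ 1-\nu\Big\}<\gamma<1-\frac\theta2-\beta_2-\frac\theta2\beta_1 .$$ **Theorem 2.** Under (A1)–(A6), as $N\to\infty$, $$\sup_{h\in[0,h_0]}\big|\widehat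 C(h)-C(h)-\Delta(h)\big|=o_p(n^{-1/2}).$$ -/

import Mathlib

open MeasureTheory ProbabilityTheory Filter Topology Asymptotics Set
open scoped ENNReal

noncomputable section

namespace SplineCov

/-! All lists that are usually numbered from `1` (subjects `i`, grid points `j`, eigenvalues `k`)
are numbered from `0` here. -/

/-! ### Function classes on `[0,1]` -/

/-- The sup norm on `[0,1]`, as an extended nonnegative number. -/
def supNorm (f : ℝ → ℝ) : ℝ≥0∞ :=
  ⨆ x ∈ Icc (0 : ℝ) 1, ENNReal.ofReal |f x|

/-- The seminorm `sup_{x ≠ y} |f^{(q)}(x) - f^{(q)}(y)| / |x - y|^mu` over `[0,1]`, as an extended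
nonnegative number. -/
def holderSeminorm (q : ℕ) (mu : ℝ) (f : ℝ → ℝ) : ℝ≥0∞ :=
  ⨆ x ∈ Icc (0 : ℝ) 1, ⨆ y ∈ Icc (0 : ℝ) 1, ⨆ _ : x ≠ y,
    ENNReal.ofReal
      (|iteratedDerivWithin q f (Icc 0 1) x - iteratedDerivWithin q f (Icc 0 1) y|
        / |x - y| ^ mu)

/-- Membership in the Hölder class `H^{(q,mu)}[0,1]`. -/
def MemHolder (q : ℕ) (mu : ℝ) (f : ℝ → ℝ) : Prop :=
  ContDiffOn ℝ q f (Icc 0 1) ∧ holderSeminorm q mu f ≠ ∞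

/-! ### Polynomial splines and the least squares fit -/

/-- The `l`-th of the `J + 1` subintervals cut out by the `J` equally spaced interior knots:
half-open, except that the last one is closed. -/
def knotInterval (J l : ℕ) : Set ℝ :=
  if l = J then Icc ((l : ℝ) / (J + 1)) 1
  else Ico ((l : ℝ) / (J + 1)) ((l + 1 : ℝ) / (J + 1))

/-- `g` restricted to `[0,1]` is a polynomial spline of order `p` with `J` equally spaced interior
knots: `p - 2` times continuously differentiable (no condition if `p = 1`), and a polynomial of
degree at most `p - 1` on each subinterval. -/
def IsSpline (p J : ℕ) (g : ℝ → ℝ) : Prop :=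
  (2 ≤ p → ContDiffOn ℝ ((p - 2 : ℕ) : ℕ∞) g (Icc 0 1)) ∧
  ∀ l ≤ J, ∃ Q : Polynomial ℝ, Q.degree < p ∧ ∀ x ∈ knotInterval J l, g x = Q.eval x

/-- The regular grid points `1/N, 2/N, …, N/N`. -/
def gridPt (N j : ℕ) : ℝ := ((j : ℝ) + 1) / N

/-- Residual sum of squares of `g` for the data `y` on the regular grid. -/
def rss (N : ℕ) (y : ℕ → ℝ) (g : ℝ → ℝ) : ℝ :=
  ∑ j ∈ Finset.range N, (y j - g (gridPt N j)) ^ 2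

/-- `g` is a least squares spline fit to the data `y`, that is, a member of
`argmin` of the residual sum of squares over the spline space. -/
def IsSplineFit (p J N : ℕ) (y : ℕ → ℝ) (g : ℝ → ℝ) : Prop :=
  IsSpline p J g ∧ ∀ f : ℝ → ℝ, IsSpline p J f → rss N y g ≤ rss N y f

/-! ### The functional data model -/

variable {Ω : Type*} [MeasurableSpace Ω]

/-- The rescaled eigenfunctions (functional principal components) `φ_k = √λ_k ψ_k`. -/
def fpc (lam : ℕ → ℝ) (psi : ℕ → ℝ → ℝ) (k : ℕ) (x : ℝ) : ℝ :=
  Real.sqrt (lam k) * psi k x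

/-- `η_0, η_1, …` are i.i.d. square integrable measurable processes on `[0,1]` with mean function
`m` and stationary covariance function `G(x,x') = C(|x-x'|)`. -/
structure IsStationarySample (P : Measure Ω) (η : ℕ → ℝ → Ω → ℝ) (m C : ℝ → ℝ) : Prop where
  measurable : ∀ i, Measurable (fun z : unitInterval × Ω => η i z.1 z.2)
  memLp : ∀ i, ∀ x ∈ Icc (0 : ℝ) 1, MemLp (η i x) 2 P
  lintegral_sq : ∀ i, ∫⁻ ω, (∫⁻ x in Icc (0 : ℝ) 1, ENNReal.ofReal (η i x ω ^ 2)) ∂P ≠ ∞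
  indep : iIndepFun (fun i ω (x : unitInterval) => η i x ω) P
  identDistrib : ∀ i, IdentDistrib (fun ω (x : unitInterval) => η i x ω)
    (fun ω (x : unitInterval) => η 0 x ω) P P
  mean : ∀ i, ∀ x ∈ Icc (0 : ℝ) 1, ∫ ω, η i x ω ∂P = m x
  cov : ∀ i, ∀ x ∈ Icc (0 : ℝ) 1, ∀ y ∈ Icc (0 : ℝ) 1,
    covariance (η i x) (η i y) P = C |x - y|

/-- Eigenvalues `λ_0 ≥ λ_1 ≥ … ≥ 0` and orthonormal eigenfunctions `ψ_k` of the covariance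
function `G(x,x') = C(|x-x'|)` on `[0,1]`, with its spectral expansion. -/
structure IsEigenSystem (C : ℝ → ℝ) (lam : ℕ → ℝ) (psi : ℕ → ℝ → ℝ) : Prop where
  antitone : Antitone lam
  nonneg : ∀ k, 0 ≤ lam k
  summable : Summable lam
  memLp : ∀ k, MemLp (psi k) 2 (volume.restrict (Icc (0 : ℝ) 1))
  orthonormal : ∀ k l, ∫ x in (0 : ℝ)..1, psi k x * psi l x = if k = l then 1 else 0
  eigen : ∀ k, ∀ x ∈ Icc (0 : ℝ) 1, ∫ y in (0 : ℝ)..1, C |x - y| * psi k y = lam k * psi k x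
  expansion : ∀ x ∈ Icc (0 : ℝ) 1, ∀ y ∈ Icc (0 : ℝ) 1,
    HasSum (fun k => lam k * psi k x * psi k y) (C |x - y|)

/-- `ξ i k` is the `k`-th functional principal component score of the `i`-th trajectory:
`∫ (η_i - m) φ_k = λ_k ξ_{ik}`; the scores of one trajectory are uncorrelated with mean `0` and
variance `1`, and the score sequences of the trajectories are i.i.d. -/
structure IsScores (P : Measure Ω) (η : ℕ → ℝ → Ω → ℝ) (m : ℝ → ℝ) (lam : ℕ → ℝ)
    (psi : ℕ → ℝ → ℝ) (ξ : ℕ → ℕ → Ω → ℝ) : Prop where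
  integral_eq : ∀ i k, ∀ᵐ ω ∂P,
    ∫ x in (0 : ℝ)..1, (η i x ω - m x) * fpc lam psi k x = lam k * ξ i k ω
  memLp : ∀ i k, MemLp (ξ i k) 2 P
  mean : ∀ i k, ∫ ω, ξ i k ω ∂P = 0
  cov : ∀ i k l, ∫ ω, ξ i k ω * ξ i l ω ∂P = if k = l then 1 else 0
  indep : iIndepFun (fun i ω (k : ℕ) => ξ i k ω) P
  identDistrib : ∀ i, IdentDistrib (fun ω (k : ℕ) => ξ i k ω) (fun ω (k : ℕ) => ξ 0 k ω) P P

/-- The measurement errors `ε_{ij}` are i.i.d. with mean `0` and variance `1`, and the whole array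
is independent of the trajectories. -/
structure IsNoise (P : Measure Ω) (η : ℕ → ℝ → Ω → ℝ) (ε : ℕ → ℕ → Ω → ℝ) : Prop where
  memLp : ∀ i j, MemLp (ε i j) 2 P
  mean : ∀ i j, ∫ ω, ε i j ω ∂P = 0
  sq : ∀ i j, ∫ ω, ε i j ω ^ 2 ∂P = 1
  indep : iIndepFun (fun (a : ℕ × ℕ) => ε a.1 a.2) P
  identDistrib : ∀ i j, IdentDistrib (ε i j) (ε 0 0) P P
  indep_traj : IndepFun (fun ω (a : ℕ × ℕ) => ε a.1 a.2 ω)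
    (fun ω (b : ℕ × unitInterval) => η b.1 b.2 ω) P

/-- The observations `Y_{ij} = η_i(j/N) + σ(j/N) ε_{ij}`. -/
def obs (η : ℕ → ℝ → Ω → ℝ) (σ : ℝ → ℝ) (ε : ℕ → ℕ → Ω → ℝ) (N i : ℕ) (ω : Ω) (j : ℕ) : ℝ :=
  η i (gridPt N j) ω + σ (gridPt N j) * ε i j ω

/-! ### The covariance estimators -/

/-- `(1-h)⁻¹ ∫_0^{1-h} n⁻¹ ∑_{i<n} z_i(x) z_i(x+h) dx`. -/
def lagCov (n : ℕ) (z : ℕ → ℝ → ℝ) (h : ℝ) : ℝ :=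
  (1 / (1 - h)) *
    ∫ x in (0 : ℝ)..(1 - h), (1 / (n : ℝ)) * ∑ i ∈ Finset.range n, z i x * z i (x + h)

/-- The average of `n` fitted trajectories. -/
def meanHat (n : ℕ) (g : ℕ → ℝ → ℝ) (x : ℝ) : ℝ :=
  (1 / (n : ℝ)) * ∑ i ∈ Finset.range n, g i x

/-- The spline covariance estimator `Ĉ`, from the fitted trajectories `g_i`. -/
def covHat (n : ℕ) (g : ℕ → ℝ → ℝ) (h : ℝ) : ℝ :=
  lagCov n (fun i x => g i x - meanHat n g x) h

/-- The infeasible covariance estimator `C̃`, from the trajectories themselves. -/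
def covTilde (n : ℕ) (η : ℕ → ℝ → Ω → ℝ) (m : ℝ → ℝ) (ω : Ω) (h : ℝ) : ℝ :=
  lagCov n (fun i x => η i x ω - m x) h

/-- `Δ = C̃ - C`. -/
def Delta (n : ℕ) (η : ℕ → ℝ → Ω → ℝ) (m C : ℝ → ℝ) (ω : Ω) (h : ℝ) : ℝ :=
  covTilde n η m ω h - C h

/-! ### Assumptions -/

/-- Smoothness of the mean function. -/
structure AssumptionA1 (q : ℕ) (mu : ℝ) (m : ℝ → ℝ) : Prop where
  q_pos : 0 < q
  mu_pos : 0 < mu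
  mu_le : mu ≤ 1
  mean_holder : MemHolder q mu m

/-- Regularity of the standard deviation function of the errors, and boundedness of `C`. -/
structure AssumptionA2 (ν h₀ : ℝ) (σ C : ℝ → ℝ) : Prop where
  ν_pos : 0 < ν
  ν_le : ν ≤ 1
  σ_nonneg : ∀ x ∈ Icc (0 : ℝ) 1, 0 ≤ σ x
  σ_holder : MemHolder 0 ν σ
  σ_bdd : ∃ Mσ > 0, ∀ x ∈ Icc (0 : ℝ) 1, σ x ≤ Mσ
  C_bdd : ∃ M₀ > 0, ∀ h ∈ Icc (0 : ℝ) h₀, |C h| ≤ M₀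

/-- Growth of the number of trajectories. -/
structure AssumptionA3 (θ : ℝ) (n : ℕ → ℕ) : Prop where
  θ_pos : 0 < θ
  tendsto : Tendsto n atTop atTop
  growth : (fun N => (n N : ℝ)) =O[atTop] fun N => (N : ℝ) ^ θ

/-- Smoothness and decay of the functional principal components `φ_k`. -/
structure AssumptionA4 (q : ℕ) (mu w : ℝ) (φ : ℕ → ℝ → ℝ) (kn : ℕ → ℕ) : Prop where
  holder : ∀ k, MemHolder q mu (φ k)
  sum_holder : ∑' k, holderSeminorm q mu (φ k) ≠ ∞
  sum_sup : ∑' k, supNorm (φ k) ≠ ∞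
  kn_pos : ∀ n, 0 < kn n
  kn_mono : Monotone kn
  tail : (fun n : ℕ => (∑' j, supNorm (φ (kn n + j))).toReal)
    =o[atTop] fun n => (n : ℝ) ^ (-(1 / 2) : ℝ)
  w_pos : 0 < w
  kn_growth : (fun n => (kn n : ℝ)) =O[atTop] fun n => (n : ℝ) ^ w

/-- Strong approximation of the scores and of the errors by i.i.d. standard normal variables, which
may be different ones for each `N`. Here `pstar = q + mu`. -/
structure AssumptionA5 (P : Measure Ω) (ξ ε : ℕ → ℕ → Ω → ℝ) (n kn : ℕ → ℕ)
    (pstar ν θ β₁ β₂ γ₁ : ℝ) : Prop where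
  β₁_pos : 0 < β₁
  β₁_lt : β₁ < 1 / 2
  β₂_pos : 0 < β₂
  β₂_lt : β₂ < 1 / 2
  γ₁_gt : 1 < γ₁
  θ_lt : θ < min (2 * (1 - β₂) * pstar / (3 + (1 + β₁) * pstar)) (2 * (ν - β₂) / (1 + β₁))
  approx_scores : ∃ c₁ > (0 : ℝ), ∃ U : ℕ → ℕ → ℕ → Ω → ℝ, ∀ᶠ N in atTop,
    iIndepFun (fun (a : Fin (n N) × Fin (kn (n N))) => U N a.1 a.2) P ∧
    (∀ i < n N, ∀ k < kn (n N), HasLaw (U N i k) (gaussianReal 0 1) P) ∧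
    P {ω | ∃ k < kn (n N), ∃ t ∈ Finset.Icc 1 (n N), (n N : ℝ) ^ β₁ <
      |∑ i ∈ Finset.range t, ξ i k ω - ∑ i ∈ Finset.range t, U N i k ω|}
      < ENNReal.ofReal (c₁ * (n N : ℝ) ^ (-γ₁))
  approx_errors : ∃ c₂ > (0 : ℝ), ∃ γ₂ > (1 : ℝ), ∃ U : ℕ → ℕ → ℕ → Ω → ℝ, ∀ᶠ N in atTop,
    iIndepFun (fun (a : Fin (n N) × Fin N) => U N a.1 a.2) P ∧
    (∀ i < n N, ∀ j < N, HasLaw (U N i j) (gaussianReal 0 1) P) ∧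
    P {ω | ∃ i < n N, ∃ t ∈ Finset.Icc 1 N, (N : ℝ) ^ β₂ <
      |∑ j ∈ Finset.range t, ε i j ω - ∑ j ∈ Finset.range t, U N i j ω|}
      < ENNReal.ofReal (c₂ * (N : ℝ) ^ (-γ₂))

/-- The spline order and the number of interior knots. Here `pstar = q + mu`. -/
structure AssumptionA6 (p : ℕ) (J : ℕ → ℕ) (pstar ν θ w β₁ β₂ γ₁ γ : ℝ) : Prop where
  order : pstar ≤ p
  knots : ∃ d : ℕ → ℝ, (∀ᶠ N in atTop, 0 < d N) ∧
    (∃ τ > (0 : ℝ), (fun N => d N + (d N)⁻¹) =O[atTop] fun N => Real.log N ^ τ) ∧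
    (fun N => (J N : ℝ)) =Θ[atTop] fun N => (N : ℝ) ^ γ * d N
  γ_gt : max (max (5 * θ / (4 * pstar)) ((θ + (γ₁ + 1 + w)⁻¹ * (8 * θ * β₁)) / (2 * pstar)))
    (1 - ν) < γ
  γ_lt : γ < 1 - θ / 2 - β₂ - θ / 2 * β₁

/-! ### Order in probability -/

/-- `X_N = o_p(a_N)` as `N → ∞`, for nonnegative extended-real-valued `X_N`. -/
def IsLittleOP (P : Measure Ω) (X : ℕ → Ω → ℝ≥0∞) (a : ℕ → ℝ) : Prop :=
  ∀ δ > (0 : ℝ), Tendsto (fun N => P {ω | ENNReal.ofReal (δ * a N) < X N ω}) atTop (𝓝 0)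

end SplineCov

end

noncomputable section

namespace SplineCov

/-! ### Approximation by splines with equally spaced knots -/

/-! Since `Δ + C = C̃`, the quantity to bound is `Ĉ - C̃`: the cost of replacing each `Z_i` by the
centered spline fit, on the scale `n^(-1/2)`. The argument runs on second moments and Markov's
inequality.

The pairs (data, spline) solving the normal equations form a linear space `normalFits`, so the fit
of `Y_i` may be compared termwise with a fit `G_i` of the noise alone. Centering removes the mean
function, and the fitted residual becomes `Z_i + r_i - avg Z + G_i - avg G` (`exists_fit_residual`).
Let `ρ` be a constant times the knot distance to the power `p*`, and `D = p (J + 1) / N`. The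
remainder `r_i` is of order `ρ` in mean square: splines approximate the components to that order
(`exists_isSpline_near`), projections contract, and the grid norm of a spline controls its integral
norm (`IsSpline.integral_sq_le`). The noise fit has mean square of order `D`, because it is a
projection onto a space of dimension at most `p (J + 1)` (`exists_fit_basis`).

When the product of two residuals is expanded, weighted AM-GM makes every term of order `ρ + D +
1/n`, except the average of `Z_i G_i`, for which it would give only `√D`. There `Z_i` is expanded in
the components `φ_k`. The coefficient `W_k = avg_i (ξ_ik G_i)` is again a spline fit, of the data
`avg_i (ξ_ik σ ε_ij)`, and the products `ξ_ik ε_ij` are orthonormal (`score_mul_noise_orthonormal`).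
Hence `W_k` has mean square of order `D / n`, and the cross term is of order `√(D / n)` after
summation over `k` against a summable bound for `φ_k`.

Uniformity in the lag is free: the integrand at lag `h` is dominated by `F x + F (x + h)` with one
`F` for all `h` (`ofReal_abs_integral_shift_le`). The Karhunen-Loève series is needed only on the
grids and at almost every `x` (`eq_scoreSeries_ae`), since elsewhere the trajectories appear only
under integrals. `measure_error_le` collects the expectations, and `tendsto_rates` gives `√n ρ → 0`
and `√n D → 0`. -/

/-- Polynomials have antiderivatives. -/
lemma exists_polynomial_antideriv (k : ℕ) (Q : Polynomial ℝ) (hQ : Q.natDegree ≤ k) :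
    ∃ R : Polynomial ℝ, R.natDegree ≤ k + 1 ∧ R.derivative = Q := by
  refine ⟨∑ i ∈ Finset.range (k + 1),
    Polynomial.C (Q.coeff i / (i + 1)) * Polynomial.X ^ (i + 1), ?_, ?_⟩
  · refine Polynomial.natDegree_sum_le_of_forall_le _ _ fun i hi => ?_
    refine (Polynomial.natDegree_C_mul_X_pow_le _ _).trans ?_
    have := Finset.mem_range.1 hi
    omega
  · rw [Polynomial.derivative_sum]
    conv_rhs => rw [Q.as_sum_range_C_mul_X_pow' (n := k + 1) (by omega)]
    refine Finset.sum_congr rfl fun i _ => ?_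
    rw [Polynomial.derivative_C_mul_X_pow]
    simp only [Nat.cast_add, Nat.cast_one, Nat.add_sub_cancel]
    rw [div_mul_cancel₀ _ (by positivity)]

/-- Splines on the whole line, of degree at most `k`, with the knots `l * h`, `l ∈ ℤ`. -/
structure IsCardSpline (k : ℕ) (h : ℝ) (u : ℝ → ℝ) : Prop where
  integrable : ∀ a b, IntervalIntegrable u volume a b
  -- This is smoothness of order `k - 1`, and no condition at all for the step functions `k = 0`;
  -- integrability is a separate field for their sake.
  smooth : ∀ j : ℕ, j + 1 ≤ k → ContDiff ℝ j u
  poly : ∀ l : ℤ, ∃ Q : Polynomial ℝ, Q.natDegree ≤ k ∧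
    ∀ x ∈ Ico (l * h) ((l + 1) * h), u x = Q.eval x

namespace IsCardSpline

variable {k : ℕ} {h : ℝ} {u v : ℝ → ℝ}

lemma add (hu : IsCardSpline k h u) (hv : IsCardSpline k h v) :
    IsCardSpline k h (fun x => u x + v x) where
  integrable a b := (hu.integrable a b).add (hv.integrable a b)
  smooth j hj := (hu.smooth j hj).add (hv.smooth j hj)
  poly l := by
    obtain ⟨Q, hQ, hQu⟩ := hu.poly l
    obtain ⟨R, hR, hRv⟩ := hv.poly l
    exact ⟨Q + R, (Polynomial.natDegree_add_le _ _).trans (max_le hQ hR), fun x hx => by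
      rw [hQu x hx, hRv x hx, Polynomial.eval_add]⟩

lemma const_mul (c : ℝ) (hu : IsCardSpline k h u) : IsCardSpline k h (fun x => c * u x) where
  integrable a b := (hu.integrable a b).const_mul c
  smooth j hj := contDiff_const.mul (hu.smooth j hj)
  poly l := by
    obtain ⟨Q, hQ, hQu⟩ := hu.poly l
    exact ⟨Polynomial.C c * Q, (Polynomial.natDegree_C_mul_le _ _).trans hQ, fun x hx => by
      rw [hQu x hx, Polynomial.eval_mul, Polynomial.eval_C]⟩

lemma shift (hu : IsCardSpline k h u) : IsCardSpline k h (fun x => u (x - h)) where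
  integrable a b := by
    simpa using (hu.integrable (a - h) (b - h)).comp_sub_right h
  smooth j hj := (hu.smooth j hj).comp (contDiff_id.sub contDiff_const)
  poly l := by
    obtain ⟨Q, hQ, hQu⟩ := hu.poly (l - 1)
    refine ⟨Q.comp (Polynomial.X - Polynomial.C h), ?_, fun x hx => ?_⟩
    · rw [Polynomial.natDegree_comp, Polynomial.natDegree_X_sub_C, mul_one]
      exact hQ
    · rw [hQu (x - h), Polynomial.eval_comp]
      · simp
      · push_cast
        constructor <;> nlinarith [hx.1, hx.2]

/-- Integration raises both the local degree and the smoothness by one. It is the engine of both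
approximation arguments: averaging is a difference of two antiderivatives, and higher order
approximation integrates a spline close to the derivative. -/
lemma antideriv (hu : IsCardSpline k h u) :
    IsCardSpline (k + 1) h (fun x => ∫ t in (0 : ℝ)..x, u t) := by
  have hcont : Continuous (fun x => ∫ t in (0 : ℝ)..x, u t) :=
    intervalIntegral.continuous_primitive hu.integrable 0
  refine ⟨fun a b => hcont.intervalIntegrable a b, fun j hj => ?_, fun l => ?_⟩
  -- Continuity of the primitive is treated apart: for `k = 0` the integrand may jump, and
  -- differentiating the primitive is not possible everywhere.
  · rcases Nat.eq_zero_or_pos j with rfl | hj0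
    · exact contDiff_zero.2 hcont
    · obtain ⟨i, rfl⟩ : ∃ i, j = i + 1 := ⟨j - 1, by omega⟩
      have hui := hu.smooth i (by omega)
      have hd : ∀ x, HasDerivAt (fun x => ∫ t in (0 : ℝ)..x, u t) (u x) x := fun x =>
        intervalIntegral.integral_hasDerivAt_right (hu.integrable 0 x)
          (hui.continuous.stronglyMeasurableAtFilter _ _) hui.continuous.continuousAt
      have hde : deriv (fun x => ∫ t in (0 : ℝ)..x, u t) = u := funext fun x => (hd x).deriv
      push_cast
      refine contDiff_succ_iff_deriv.2 ⟨fun x => (hd x).differentiableAt, by simp, ?_⟩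
      rw [hde]
      exact hui
  · obtain ⟨Q, hQ, hQu⟩ := hu.poly l
    obtain ⟨R, hR, hRQ⟩ := exists_polynomial_antideriv k Q hQ
    refine ⟨Polynomial.C ((∫ t in (0 : ℝ)..(l * h), u t) - R.eval (l * h)) + R, ?_, fun x hx => ?_⟩
    · exact (Polynomial.natDegree_C_add).trans_le hR
    · rw [← intervalIntegral.integral_add_adjacent_intervals (hu.integrable 0 (l * h))
        (hu.integrable (l * h) x)]
      have h1 : ∫ t in (l * h)..x, u t = ∫ t in (l * h)..x, Q.eval t := by
        refine intervalIntegral.integral_congr_ae (ae_of_all _ fun t ht => ?_)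
        rw [uIoc_of_le hx.1] at ht
        exact hQu t ⟨ht.1.le, ht.2.trans_lt hx.2⟩
      have h2 : ∫ t in (l * h)..x, Q.eval t = R.eval x - R.eval (l * h) := by
        refine intervalIntegral.integral_eq_sub_of_hasDerivAt (f := fun t => R.eval t)
          (fun t _ => ?_) (Q.continuous.intervalIntegrable _ _)
        rw [← hRQ]
        exact R.hasDerivAt t
      rw [h1, h2]
      simp
      ring

/-- Averaging over a window of one knot distance raises the degree by one. -/
lemma average (hu : IsCardSpline k h u) :
    IsCardSpline (k + 1) h (fun x => h⁻¹ * ∫ t in (x - h)..x, u t) := by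
  have key : (fun x => h⁻¹ * ∫ t in (x - h)..x, u t) = fun x => h⁻¹ *
      ((∫ t in (0 : ℝ)..x, u t) + (-1) * ∫ t in (0 : ℝ)..(x - h), u t) := by
    funext x
    rw [← intervalIntegral.integral_interval_sub_left (hu.integrable 0 x) (hu.integrable 0 (x - h))]
    ring
  rw [key]
  exact (hu.antideriv.add (hu.antideriv.shift.const_mul (-1))).const_mul _

end IsCardSpline

/-- First order approximation by splines: the error is bounded by the modulus of continuity. -/
lemma exists_cardSpline_near {h M D : ℝ} (hh : 0 < h) {g : ℝ → ℝ} (hD : ∀ x, |g x| ≤ D)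
    (hM : ∀ x y, |x - y| ≤ h → |g x - g y| ≤ M) (k : ℕ) :
    ∃ u, IsCardSpline k h u ∧ ∀ x, |u x - g x| ≤ (k + 1) * M := by
  induction k with
  | zero =>
    -- The step function takes the value of `g` at the knot to the left.
    refine ⟨fun x => g (⌊x / h⌋ * h), ⟨fun a b => ?_, fun j hj => by omega, fun l => ?_⟩,
      fun x => ?_⟩
    · have hmeas : Measurable fun x : ℝ => g (⌊x / h⌋ * h) := by
        have h1 : Measurable fun z : ℤ => g (z * h) := measurable_from_top
        exact h1.comp (Int.measurable_floor.comp (measurable_id.div_const h))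
      refine (intervalIntegrable_const (c := D)).mono_fun hmeas.aestronglyMeasurable
        (ae_of_all _ fun x => ?_)
      exact (hD _).trans (le_abs_self D)
    · refine ⟨Polynomial.C (g (l * h)), by simp, fun x hx => ?_⟩
      have : ⌊x / h⌋ = l := by
        rw [Int.floor_eq_iff, le_div_iff₀ hh, div_lt_iff₀ hh]
        exact hx
      simp [this]
    · have h1 := Int.floor_le (x / h)
      have h2 := Int.lt_floor_add_one (x / h)
      rw [le_div_iff₀ hh] at h1
      rw [div_lt_iff₀ hh] at h2
      have := hM (⌊x / h⌋ * h) x (by rw [abs_le]; constructor <;> nlinarith)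
      simpa using this
  | succ k ih =>
    obtain ⟨u, hu, hug⟩ := ih
    -- Averaging preserves the error `u - g`, and moving `g t` to `g x` inside a window of length
    -- `h` costs one more `M`.
    refine ⟨_, hu.average, fun x => ?_⟩
    have h1 : h⁻¹ * ∫ t in (x - h)..x, u t = h⁻¹ * (∫ t in (x - h)..x, (u t - g x)) + g x := by
      rw [intervalIntegral.integral_sub (hu.integrable _ _) intervalIntegrable_const]
      simp only [intervalIntegral.integral_const, smul_eq_mul, sub_sub_cancel]
      field_simp
      ring
    have h2 : ‖∫ t in (x - h)..x, (u t - g x)‖ ≤ ((k + 1) * M + M) * |x - (x - h)| := by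
      refine intervalIntegral.norm_integral_le_of_norm_le_const fun t ht => ?_
      rw [uIoc_of_le (by linarith)] at ht
      have h3 := hM t x (by rw [abs_le]; constructor <;> linarith [ht.1, ht.2])
      rw [Real.norm_eq_abs, show u t - g x = (u t - g t) + (g t - g x) by ring]
      exact (abs_add_le _ _).trans (add_le_add (hug t) h3)
    rw [h1, add_sub_cancel_right, abs_mul, abs_of_pos (inv_pos.2 hh)]
    rw [sub_sub_cancel, abs_of_pos hh, Real.norm_eq_abs] at h2
    rw [inv_mul_le_iff₀ hh]
    push_cast
    linarith

/-- Composing with the projection of the line onto `[0,1]`, which is 1-Lipschitz, keeps the modulus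
of continuity and makes the function bounded on the line. -/
lemma exists_cardSpline_near_Icc {h M : ℝ} (hh : 0 < h) {g : ℝ → ℝ}
    (hg : ContinuousOn g (Icc 0 1))
    (hM : ∀ x ∈ Icc (0 : ℝ) 1, ∀ y ∈ Icc (0 : ℝ) 1, |x - y| ≤ h → |g x - g y| ≤ M) (k : ℕ) :
    ∃ u, IsCardSpline k h u ∧ ∀ x ∈ Icc (0 : ℝ) 1, |g x - u x| ≤ (k + 1) * M := by
  obtain ⟨D, hD⟩ := isCompact_Icc.exists_bound_of_continuousOn hg
  let c : ℝ → ℝ := fun x => max 0 (min 1 x)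
  have hc : ∀ x, c x ∈ Icc (0 : ℝ) 1 := fun x =>
    ⟨le_max_left _ _, max_le zero_le_one (min_le_left _ _)⟩
  have hc1 : ∀ x y, |c x - c y| ≤ |x - y| := fun x y => by
    refine (abs_max_sub_max_le_max _ _ _ _).trans ?_
    simp only [sub_self, abs_zero]
    refine max_le (abs_nonneg _) ((abs_min_sub_min_le_max _ _ _ _).trans ?_)
    simp
  obtain ⟨u, hu, hug⟩ := exists_cardSpline_near (g := fun x => g (c x)) (D := D) (M := M) hh
    (fun x => hD _ (hc x)) (fun x y hxy => hM _ (hc x) _ (hc y) ((hc1 x y).trans hxy)) k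
  refine ⟨u, hu, fun x hx => ?_⟩
  have : c x = x := by simp [c, hx.1, hx.2]
  have h2 := hug x
  rw [this] at h2
  rwa [abs_sub_comm]

/-- Jackson's theorem for splines on `[0,1]`. -/
theorem exists_cardSpline_jackson {mu : ℝ} (hmu : 0 < mu) (q : ℕ) : ∀ k, q ≤ k →
    ∃ A : ℝ, 0 ≤ A ∧ ∀ h : ℝ, 0 < h → ∀ (f : ℝ → ℝ) (L : ℝ), ContDiffOn ℝ q f (Icc 0 1) →
      0 ≤ L → (∀ x ∈ Icc (0 : ℝ) 1, ∀ y ∈ Icc (0 : ℝ) 1,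
        |iteratedDerivWithin q f (Icc 0 1) x - iteratedDerivWithin q f (Icc 0 1) y|
          ≤ L * |x - y| ^ mu) →
      ∃ u, IsCardSpline k h u ∧ ∀ x ∈ Icc (0 : ℝ) 1, |f x - u x| ≤ A * L * h ^ (q + mu) := by
  induction q with
  | zero =>
    intro k _
    refine ⟨k + 1, by positivity, fun h hh f L hf hL hfL => ?_⟩
    simp only [iteratedDerivWithin_zero] at hfL
    obtain ⟨u, hu, hfu⟩ := exists_cardSpline_near_Icc (M := L * h ^ mu) hh hf.continuousOn
      (fun x hx y hy hxy => (hfL x hx y hy).trans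
        (mul_le_mul_of_nonneg_left (Real.rpow_le_rpow (abs_nonneg _) hxy hmu.le) hL)) k
    refine ⟨u, hu, fun x hx => (hfu x hx).trans_eq ?_⟩
    simp [mul_assoc]
  | succ q ih =>
    intro k hk
    obtain ⟨k, rfl⟩ : ∃ i, k = i + 1 := ⟨k - 1, by omega⟩
    obtain ⟨A, hA, ih⟩ := ih k (by omega)
    -- The factor is the constant of the first order approximation at degree `k + 1`.
    refine ⟨(k + 2) * A, by positivity, fun h hh f L hf hL hfL => ?_⟩
    have hU : UniqueDiffOn ℝ (Icc (0 : ℝ) 1) := uniqueDiffOn_Icc zero_lt_one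
    push_cast at hf
    have hf' := ((contDiffOn_succ_iff_derivWithin hU).1 hf)
    obtain ⟨s, hs, hfs⟩ := ih h hh (derivWithin f (Icc 0 1)) L hf'.2.2 hL (fun x hx y hy => by
      simpa only [iteratedDerivWithin_succ'] using hfL x hx y hy)
    set E := A * L * h ^ (q + mu) with hE
    have hScont : Continuous (fun x => ∫ t in (0 : ℝ)..x, s t) :=
      intervalIntegral.continuous_primitive hs.integrable 0
    have hdint : ∀ x ∈ Icc (0 : ℝ) 1, ∀ y ∈ Icc (0 : ℝ) 1,
        IntervalIntegrable (derivWithin f (Icc 0 1)) volume x y := fun x hx y hy =>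
      (hf'.2.2.continuousOn.mono (uIcc_subset_Icc hx hy)).intervalIntegrable
    have hftc : ∀ x ∈ Icc (0 : ℝ) 1, ∀ y ∈ Icc (0 : ℝ) 1, x ≤ y →
        ∫ t in x..y, derivWithin f (Icc 0 1) t = f y - f x := fun x hx y hy hxy => by
      refine intervalIntegral.integral_eq_sub_of_hasDerivAt_of_le hxy
        (hf.continuousOn.mono (Icc_subset_Icc hx.1 hy.2)) (fun t ht => ?_) (hdint x hx y hy)
      have ht' : Icc (0 : ℝ) 1 ∈ 𝓝 t :=
        Icc_mem_nhds (hx.1.trans_lt ht.1) (ht.2.trans_le hy.2)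
      exact ((hf'.1 t (mem_of_mem_nhds ht')).hasDerivWithinAt).hasDerivAt ht'
    -- If `s` is within `E` of the derivative, then `f` minus the primitive of `s` is Lipschitz with
    -- constant `E`. First order approximation of this remainder gains the missing factor `h`.
    have hlip : ∀ x ∈ Icc (0 : ℝ) 1, ∀ y ∈ Icc (0 : ℝ) 1, x ≤ y →
        |(f y - ∫ t in (0 : ℝ)..y, s t) - (f x - ∫ t in (0 : ℝ)..x, s t)| ≤ E * (y - x) := by
      intro x hx y hy hxy
      have h1 : (f y - ∫ t in (0 : ℝ)..y, s t) - (f x - ∫ t in (0 : ℝ)..x, s t)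
          = ∫ t in x..y, (derivWithin f (Icc 0 1) t - s t) := by
        rw [intervalIntegral.integral_sub (hdint x hx y hy) (hs.integrable x y), hftc x hx y hy hxy,
          ← intervalIntegral.integral_interval_sub_left (hs.integrable 0 y) (hs.integrable 0 x)]
        ring
      rw [h1, ← Real.norm_eq_abs]
      refine (intervalIntegral.norm_integral_le_of_norm_le_const (C := E) fun t ht => ?_).trans_eq
        (by rw [abs_of_nonneg (sub_nonneg.2 hxy)])
      rw [uIoc_of_le hxy] at ht
      exact hfs t ⟨hx.1.trans ht.1.le, ht.2.trans hy.2⟩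
    have hE0 : 0 ≤ E := by positivity
    obtain ⟨v, hv, hgv⟩ := exists_cardSpline_near_Icc (M := E * h) hh
      (g := fun x => f x - ∫ t in (0 : ℝ)..x, s t)
      (hf.continuousOn.sub hScont.continuousOn) (fun x hx y hy hxy => by
        rcases le_total x y with hle | hle
        · rw [abs_sub_comm]
          refine (hlip x hx y hy hle).trans (mul_le_mul_of_nonneg_left ?_ hE0)
          rw [abs_sub_comm] at hxy
          exact (le_abs_self _).trans hxy
        · exact (hlip y hy x hx hle).trans (mul_le_mul_of_nonneg_left
            ((le_abs_self _).trans hxy) hE0)) (k + 1)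
    refine ⟨_, hv.add hs.antideriv, fun x hx => ?_⟩
    have := hgv x hx
    rw [show f x - (v x + ∫ t in (0 : ℝ)..x, s t) = f x - (∫ t in (0 : ℝ)..x, s t) - v x by ring]
    refine this.trans_eq ?_
    rw [hE]
    push_cast
    rw [show (q : ℝ) + 1 + mu = (q + mu) + 1 by ring, Real.rpow_add hh (q + mu) 1, Real.rpow_one]
    ring

/-! ### The spline space on `[0,1]` -/

/-- The two notions differ only on the last knot interval, which is closed here; continuity,
available for `p ≥ 2`, carries the polynomial identity to the endpoint `1`. -/
lemma IsCardSpline.isSpline {p J : ℕ} (hp : 2 ≤ p) {u : ℝ → ℝ}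
    (hu : IsCardSpline (p - 1) ((1 : ℝ) / (J + 1)) u) : IsSpline p J u := by
  have hJ : (0 : ℝ) < J + 1 := by positivity
  refine ⟨fun _ => (hu.smooth (p - 2) (by omega)).contDiffOn, fun l hl => ?_⟩
  obtain ⟨Q, hQ, hQu⟩ := hu.poly l
  have hdeg : Q.degree < p := by
    refine lt_of_le_of_lt Polynomial.degree_le_natDegree ?_
    exact_mod_cast (by omega : Q.natDegree < p)
  have hco : Ico ((l : ℤ) * ((1 : ℝ) / (J + 1))) (((l : ℤ) + 1) * ((1 : ℝ) / (J + 1)))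
      = Ico ((l : ℝ) / (J + 1)) ((l + 1 : ℝ) / (J + 1)) := by
    push_cast
    simp only [mul_one_div]
  rw [hco] at hQu
  refine ⟨Q, hdeg, fun x hx => ?_⟩
  unfold knotInterval at hx
  split_ifs at hx with hlJ
  · have hcont : Continuous u := (hu.smooth 0 (by omega)).continuous
    have h1 : EqOn u (fun x => Q.eval x)
        (closure (Ico ((l : ℝ) / (J + 1)) ((l + 1 : ℝ) / (J + 1)))) :=
      EqOn.closure hQu hcont Q.continuous
    have hlt : (l : ℝ) / (J + 1) < (l + 1 : ℝ) / (J + 1) := by gcongr; linarith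
    rw [closure_Ico hlt.ne] at h1
    refine h1 ?_
    have : (l + 1 : ℝ) / (J + 1) = 1 := by rw [hlJ]; exact div_self hJ.ne'
    rwa [this]
  · exact hQu x hx

/-- Splines approximate Hölder functions to the optimal order. -/
theorem exists_isSpline_near {p q : ℕ} {mu : ℝ} (hmu : 0 < mu) (hp : 2 ≤ p) (hqp : q + mu ≤ p) :
    ∃ A : ℝ, 0 < A ∧ ∀ (J : ℕ) (f : ℝ → ℝ), MemHolder q mu f →
      ∃ s, IsSpline p J s ∧ ∀ x ∈ Icc (0 : ℝ) 1,
        |f x - s x| ≤ A * ((1 : ℝ) / (J + 1)) ^ (q + mu) * (holderSeminorm q mu f).toReal := by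
  have hq : q ≤ p - 1 := by
    have : (q : ℝ) < p := by linarith
    have : q < p := by exact_mod_cast this
    omega
  obtain ⟨A, hA, h⟩ := exists_cardSpline_jackson hmu q (p - 1) hq
  -- Adding one makes the constant strictly positive, so that it can serve as a divisor in the
  -- weighted AM-GM step later.
  refine ⟨A + 1, by positivity, fun J f hf => ?_⟩
  obtain ⟨u, hu, hfu⟩ := h ((1 : ℝ) / (J + 1)) (by positivity) f (holderSeminorm q mu f).toReal hf.1
    ENNReal.toReal_nonneg (fun x hx y hy => by
      rcases eq_or_ne x y with rfl | hxy
      · simp only [sub_self, abs_zero]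
        positivity
      · have hpos : 0 < |x - y| ^ mu := Real.rpow_pos_of_pos (abs_pos.2 (sub_ne_zero.2 hxy)) _
        rw [← div_le_iff₀ hpos]
        have h1 : ENNReal.ofReal (|iteratedDerivWithin q f (Icc 0 1) x
            - iteratedDerivWithin q f (Icc 0 1) y| / |x - y| ^ mu) ≤ holderSeminorm q mu f :=
          le_iSup₂_of_le x hx (le_iSup₂_of_le y hy (le_iSup_of_le hxy le_rfl))
        exact (ENNReal.ofReal_le_iff_le_toReal hf.2).1 h1)
  refine ⟨u, hu.isSpline hp, fun x hx => (hfu x hx).trans ?_⟩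
  have hpos : 0 ≤ ((1 : ℝ) / (J + 1)) ^ (q + mu) := by positivity
  have h1 : 0 ≤ ((1 : ℝ) / (J + 1)) ^ (q + mu) * (holderSeminorm q mu f).toReal :=
    mul_nonneg hpos ENNReal.toReal_nonneg
  nlinarith

/-- The linear space of splines. -/
def splineSpace (p J : ℕ) : Submodule ℝ (ℝ → ℝ) where
  carrier := {g | IsSpline p J g}
  add_mem' {f g} hf hg := by
    refine ⟨fun h => (hf.1 h).add (hg.1 h), fun l hl => ?_⟩
    obtain ⟨Q, hQ, hQf⟩ := hf.2 l hl
    obtain ⟨R, hR, hRg⟩ := hg.2 l hl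
    exact ⟨Q + R, (Polynomial.degree_add_le _ _).trans_lt (max_lt hQ hR), fun x hx => by
      rw [Pi.add_apply, hQf x hx, hRg x hx, Polynomial.eval_add]⟩
  zero_mem' := ⟨fun _ => contDiffOn_const, fun l _ => ⟨0, by
    simp only [Polynomial.degree_zero]; exact WithBot.bot_lt_coe p, by simp⟩⟩
  smul_mem' c f hf := by
    refine ⟨fun h => (hf.1 h).const_smul c, fun l hl => ?_⟩
    obtain ⟨Q, hQ, hQf⟩ := hf.2 l hl
    exact ⟨c • Q, (Polynomial.degree_smul_le c Q).trans_lt hQ, fun x hx => by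
      rw [Pi.smul_apply, hQf x hx, Polynomial.eval_smul]⟩

lemma mem_splineSpace {p J : ℕ} {g : ℝ → ℝ} : g ∈ splineSpace p J ↔ IsSpline p J g := Iff.rfl

lemma IsSpline.continuousOn {p J : ℕ} (hp : 2 ≤ p) {g : ℝ → ℝ} (hg : IsSpline p J g) :
    ContinuousOn g (Icc 0 1) := (hg.1 hp).continuousOn

/-- The number of the knot interval that contains `x`. -/
def knotIndex (J : ℕ) (x : ℝ) : ℕ := min ⌊x * (J + 1)⌋₊ J

lemma mem_knotInterval_knotIndex (J : ℕ) {x : ℝ} (hx : x ∈ Icc (0 : ℝ) 1) :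
    x ∈ knotInterval J (knotIndex J x) := by
  have hJ : (0 : ℝ) < J + 1 := by positivity
  have h0 : 0 ≤ x * (J + 1) := mul_nonneg hx.1 hJ.le
  have h1 := Nat.floor_le h0
  have h2 := Nat.lt_floor_add_one (x * (J + 1))
  unfold knotInterval knotIndex
  split_ifs with h
  · rw [h]
    have h3 : J ≤ ⌊x * (J + 1)⌋₊ := by omega
    have h4 : (J : ℝ) ≤ ⌊x * (J + 1)⌋₊ := by exact_mod_cast h3
    exact ⟨by rw [div_le_iff₀ hJ]; linarith, hx.2⟩
  · have h3 : min ⌊x * ((J : ℝ) + 1)⌋₊ J = ⌊x * ((J : ℝ) + 1)⌋₊ := by omega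
    rw [h3]
    exact ⟨by rwa [div_le_iff₀ hJ], by rwa [lt_div_iff₀ hJ]⟩

lemma gridPt_mem {N j : ℕ} (hj : j < N) : gridPt N j ∈ Icc (0 : ℝ) 1 := by
  have : (j : ℝ) + 1 ≤ N := by exact_mod_cast hj
  unfold gridPt
  exact ⟨by positivity, div_le_one_of_le₀ this (by positivity)⟩

/-! ### Comparison of the empirical and the continuous norm of splines -/

/-- A polynomial is controlled by its values at well separated nodes. -/
lemma eval_sq_le_of_separated {p : ℕ} {Q : Polynomial ℝ} (hQ : Q.degree < p) {t : ℕ → ℝ}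
    {δ R x : ℝ} (hδ : 0 < δ) (hR : 0 ≤ R) (ht : ∀ a < p, ∀ b < p, a ≠ b → δ ≤ |t a - t b|)
    (hx : ∀ a < p, |x - t a| ≤ R * δ) :
    Q.eval x ^ 2 ≤ p * R ^ (2 * (p - 1)) * ∑ a ∈ Finset.range p, Q.eval (t a) ^ 2 := by
  have hinj : Set.InjOn t (Finset.range p) := by
    intro a ha b hb hab
    by_contra hne
    have := ht a (by simpa using ha) b (by simpa using hb) hne
    rw [hab, sub_self, abs_zero] at this
    linarith
  have hQi := Lagrange.eq_interpolate (s := Finset.range p) (v := t) hinj (by simpa using hQ)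
  -- Each of the `p - 1` factors `|x - t b| / |t a - t b|` of the Lagrange basis polynomial is at
  -- most `R δ / δ = R`.
  have hbasis : ∀ a ∈ Finset.range p,
      |(Lagrange.basis (Finset.range p) t a).eval x| ≤ R ^ (p - 1) := by
    intro a ha
    rw [Lagrange.basis, Polynomial.eval_prod, Finset.abs_prod]
    have hcard : ((Finset.range p).erase a).card = p - 1 := by
      rw [Finset.card_erase_of_mem ha, Finset.card_range]
    rw [← hcard, ← Finset.prod_const]
    refine Finset.prod_le_prod (fun _ _ => abs_nonneg _) fun b hb => ?_
    rw [Finset.mem_erase, Finset.mem_range] at hb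
    have h1 := ht a (Finset.mem_range.1 ha) b hb.2 hb.1.symm
    have h2 := hx b hb.2
    simp only [Lagrange.basisDivisor, Polynomial.eval_mul, Polynomial.eval_C, Polynomial.eval_sub,
      Polynomial.eval_X, abs_mul, abs_inv]
    rw [inv_mul_le_iff₀ (hδ.trans_le h1)]
    nlinarith
  have hev : Q.eval x = ∑ a ∈ Finset.range p,
      Q.eval (t a) * (Lagrange.basis (Finset.range p) t a).eval x := by
    conv_lhs => rw [hQi]
    rw [Lagrange.interpolate_apply, Polynomial.eval_finsetSum]
    simp
  rw [hev]
  refine (sq_sum_le_card_mul_sum_sq).trans ?_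
  rw [Finset.card_range, mul_assoc, Finset.mul_sum _ _ (R ^ (2 * (p - 1)))]
  refine mul_le_mul_of_nonneg_left (Finset.sum_le_sum fun a ha => ?_) (Nat.cast_nonneg p)
  rw [mul_pow, mul_comm]
  refine mul_le_mul_of_nonneg_right ?_ (sq_nonneg _)
  rw [← sq_abs, mul_comm 2, pow_mul]
  exact pow_le_pow_left₀ (abs_nonneg _) (hbasis a ha) 2

/-- The constant of the comparison of the empirical and the continuous norm. -/
def normConst (p : ℕ) : ℝ := 2 * p * (p * (2 * p) ^ (2 * (p - 1)))

lemma normConst_nonneg (p : ℕ) : 0 ≤ normConst p := by unfold normConst; positivity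

/-- The continuous norm of a spline is bounded by its empirical norm. -/
theorem IsSpline.integral_sq_le {p J N : ℕ} (hp : 2 ≤ p) (hN : 2 * p * (J + 1) ≤ N) {g : ℝ → ℝ}
    (hg : IsSpline p J g) :
    ∫ x in (0 : ℝ)..1, g x ^ 2
      ≤ normConst p / N * ∑ j ∈ Finset.range N, g (gridPt N j) ^ 2 := by
  set K' : ℝ := p * (2 * p) ^ (2 * (p - 1)) with hK'
  have hK'0 : 0 ≤ K' := by positivity
  have hJ : (0 : ℝ) < J + 1 := by positivity
  have hM : 0 < p * (J + 1) := by positivity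
  -- Every knot interval will contain a block of `p * m` consecutive grid points. Using `N - 1`
  -- gives the strict bound `m p (J + 1) < N`, which keeps the blocks strictly inside the half-open
  -- intervals and hence disjoint.
  set m := (N - 1) / (p * (J + 1)) with hm
  have hmN : m * (p * (J + 1)) < N := by
    have : m * (p * (J + 1)) ≤ N - 1 := Nat.div_mul_le_self (N - 1) (p * (J + 1))
    have h2 : 0 < N := lt_of_lt_of_le (by positivity) hN
    omega
  have hm1 : 1 ≤ m := by
    rw [hm, Nat.le_div_iff_mul_le hM]
    have : 2 * p * (J + 1) = p * (J + 1) + p * (J + 1) := by ring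
    omega
  have hNm : N ≤ 2 * p * m * (J + 1) := by
    have h1 := Nat.lt_div_mul_add hM (a := N - 1)
    rw [← hm] at h1
    have h2 : p * (J + 1) ≤ m * (p * (J + 1)) := Nat.le_mul_of_pos_left _ hm1
    have h3 : 2 * p * m * (J + 1) = m * (p * (J + 1)) + m * (p * (J + 1)) := by ring
    omega
  have hN0 : 0 < N := lt_of_lt_of_le (by positivity) hN
  have hN0' : (0 : ℝ) < N := by exact_mod_cast hN0
  have hm0' : (0 : ℝ) < m := by exact_mod_cast hm1
  let b : ℕ → ℕ := fun l => l * N / (J + 1)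
  have hb1 : ∀ l, b l * (J + 1) ≤ l * N := fun l => Nat.div_mul_le_self _ _
  have hb2 : ∀ l, l * N < (b l + 1) * (J + 1) := fun l => by
    have := Nat.lt_div_mul_add (Nat.succ_pos J) (a := l * N)
    simp only [b, add_mul, one_mul]
    exact this
  have hs : ∀ a < p, ∀ r < m, a * m + r + 1 ≤ m * p := fun a ha r hr => by
    have : (a + 1) * m ≤ p * m := Nat.mul_le_mul_right _ ha
    rw [mul_comm m p]
    linarith [add_mul a 1 m]
  have hup : ∀ l, ∀ a < p, ∀ r < m, (b l + (a * m + r) + 1) * (J + 1) < (l + 1) * N := by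
    intro l a ha r hr
    have h1 := Nat.mul_le_mul_right (J + 1) (hs a ha r hr)
    have h2 := hb1 l
    nlinarith
  have hlow : ∀ l a r, l * N < (b l + (a * m + r) + 1) * (J + 1) := fun l a r =>
    (hb2 l).trans_le (Nat.mul_le_mul_right _ (by omega))
  have hlowR : ∀ l a r : ℕ, (l : ℝ) / (J + 1) ≤ gridPt N (b l + (a * m + r)) := fun l a r => by
    unfold gridPt
    rw [div_le_div_iff₀ hJ hN0']
    exact_mod_cast (hlow l a r).le
  have hupR : ∀ l : ℕ, ∀ a < p, ∀ r < m,
      gridPt N (b l + (a * m + r)) < (l + 1 : ℝ) / (J + 1) := fun l a ha r hr => by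
    unfold gridPt
    rw [div_lt_div_iff₀ hN0' hJ]
    exact_mod_cast hup l a ha r hr
  -- the pointwise bound on each knot interval
  have hpt : ∀ l ≤ J, ∀ x ∈ Ico ((l : ℝ) / (J + 1)) ((l + 1 : ℝ) / (J + 1)),
      m * g x ^ 2 ≤ K' * ∑ r ∈ Finset.range m, ∑ a ∈ Finset.range p,
        g (gridPt N (b l + (a * m + r))) ^ 2 := by
    intro l hl x hx
    obtain ⟨Q, hQ, hQg⟩ := hg.2 l hl
    have hsub : Ico ((l : ℝ) / (J + 1)) ((l + 1 : ℝ) / (J + 1)) ⊆ knotInterval J l := by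
      unfold knotInterval
      split_ifs with h
      · intro y hy
        refine ⟨hy.1, hy.2.le.trans ?_⟩
        rw [h, div_self hJ.ne']
      · exact subset_rfl
    -- For each offset `r`, the `p` nodes with indices `b l + (a m + r)` are `m / N` apart, which is
    -- a fixed fraction of the interval length. Summing over all offsets uses every point of the
    -- block once, and this produces the factor `1 / N` in the final bound.
    have hterm : ∀ r ∈ Finset.range m, g x ^ 2 ≤ K' * ∑ a ∈ Finset.range p,
        g (gridPt N (b l + (a * m + r))) ^ 2 := by
      intro r hr
      rw [Finset.mem_range] at hr
      have h1 := eval_sq_le_of_separated (x := x) hQ (t := fun a => gridPt N (b l + (a * m + r)))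
        (δ := m / N) (R := 2 * p) (by positivity) (by positivity) (fun a ha c hc hac => ?_)
        (fun a ha => ?_)
      · rw [hQg x (hsub hx)]
        refine h1.trans_eq ?_
        congr 1
        refine Finset.sum_congr rfl fun a ha => ?_
        rw [hQg _ (hsub ⟨hlowR l a r, hupR l a (Finset.mem_range.1 ha) r hr⟩)]
      · have : gridPt N (b l + (a * m + r)) - gridPt N (b l + (c * m + r))
            = ((a : ℝ) - c) * (m / N) := by
          unfold gridPt
          push_cast
          ring
        rw [this, abs_mul, abs_of_pos (by positivity : (0 : ℝ) < m / N)]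
        refine le_mul_of_one_le_left (by positivity) ?_
        have h3 : (1 : ℤ) ≤ |(a : ℤ) - c| := Int.one_le_abs (by omega)
        exact_mod_cast h3
      · have h2 := hlowR l a r
        have h3 := hupR l a ha r hr
        have h4 : (1 : ℝ) / (J + 1) ≤ 2 * p * (m / N) := by
          rw [← mul_div_assoc, div_le_div_iff₀ hJ hN0']
          exact_mod_cast (by linarith : 1 * N ≤ 2 * p * m * (J + 1))
        have h5 : (l + 1 : ℝ) / (J + 1) = l / (J + 1) + 1 / (J + 1) := add_div _ _ _
        rw [abs_le]
        constructor <;> linarith [hx.1, hx.2]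
    have := Finset.sum_le_sum hterm
    rwa [Finset.sum_const, Finset.card_range, nsmul_eq_mul, ← Finset.mul_sum] at this
  -- the integral over each knot interval
  have hcont := (hg.continuousOn hp).pow 2
  have hmemI : ∀ l : ℕ, l ≤ J + 1 → (l : ℝ) / (J + 1) ∈ Icc (0 : ℝ) 1 := fun l hl =>
    ⟨by positivity, div_le_one_of_le₀ (by exact_mod_cast hl) hJ.le⟩
  have hint : ∀ x ∈ Icc (0 : ℝ) 1, ∀ y ∈ Icc (0 : ℝ) 1,
      IntervalIntegrable (fun x => g x ^ 2) volume x y := fun x hx y hy =>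
    (hcont.mono (uIcc_subset_Icc hx hy)).intervalIntegrable
  let F : ℕ → ℝ := fun l => ∑ r ∈ Finset.range m, ∑ a ∈ Finset.range p,
        g (gridPt N (b l + (a * m + r))) ^ 2
  have hpiece : ∀ l ∈ Finset.range (J + 1),
      ∫ x in ((l : ℝ) / (J + 1))..((l + 1 : ℕ) / (J + 1) : ℝ), g x ^ 2
        ≤ normConst p / N * F l := by
    intro l hl
    have hl' : l < J + 1 := Finset.mem_range.1 hl
    have hle : (l : ℝ) / (J + 1) ≤ ((l + 1 : ℕ) / (J + 1) : ℝ) := by gcongr; omega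
    have hF0 : 0 ≤ F l := Finset.sum_nonneg fun _ _ => Finset.sum_nonneg fun _ _ => sq_nonneg _
    have h1 : ∫ x in ((l : ℝ) / (J + 1))..((l + 1 : ℕ) / (J + 1) : ℝ), g x ^ 2
        ≤ ∫ x in ((l : ℝ) / (J + 1))..((l + 1 : ℕ) / (J + 1) : ℝ), K' / m * F l := by
      refine intervalIntegral.integral_mono_on_of_le_Ioo hle
        (hint _ (hmemI l hl'.le) _ (by exact_mod_cast hmemI (l + 1) hl'))
        intervalIntegrable_const fun x hx => ?_
      have := hpt l (by omega) x ⟨hx.1.le, by exact_mod_cast hx.2⟩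
      rw [div_mul_eq_mul_div, le_div_iff₀ hm0']
      linarith
    refine h1.trans ?_
    rw [intervalIntegral.integral_const, smul_eq_mul]
    rw [← mul_assoc]
    refine mul_le_mul_of_nonneg_right ?_ hF0
    have h2 : ((l + 1 : ℕ) : ℝ) / (J + 1) - l / (J + 1) = 1 / (J + 1) := by
      push_cast
      ring
    rw [h2, normConst, ← hK', div_mul_div_comm, one_mul, div_le_div_iff₀ (by positivity) hN0']
    have h3 : (N : ℝ) ≤ 2 * p * m * (J + 1) := by exact_mod_cast hNm
    nlinarith
  have hsum := intervalIntegral.sum_integral_adjacent_intervals (μ := volume)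
    (f := fun x => g x ^ 2) (a := fun l : ℕ => (l : ℝ) / (J + 1)) (n := J + 1)
    (fun l hl => hint _ (hmemI l hl.le) _ (hmemI (l + 1) hl))
  have hend : ((J + 1 : ℕ) : ℝ) / (J + 1) = 1 := by
    push_cast
    exact div_self hJ.ne'
  simp only [hend, Nat.cast_zero, zero_div] at hsum
  rw [← hsum]
  refine (Finset.sum_le_sum hpiece).trans ?_
  rw [← Finset.mul_sum]
  refine mul_le_mul_of_nonneg_left ?_ (div_nonneg (normConst_nonneg p) hN0'.le)
  -- the nodes are distinct grid points
  simp only [F]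
  rw [Finset.sum_congr rfl fun l _ => (Finset.sum_product' (Finset.range m) (Finset.range p)
    fun r a => g (gridPt N (b l + (a * m + r))) ^ 2).symm,
    ← Finset.sum_product' (Finset.range (J + 1)) (Finset.range m ×ˢ Finset.range p)
      fun l z => g (gridPt N (b l + (z.2 * m + z.1))) ^ 2]
  rw [← Finset.sum_image (s := Finset.range (J + 1) ×ˢ Finset.range m ×ˢ Finset.range p)
    (g := fun z => b z.1 + (z.2.2 * m + z.2.1)) (f := fun j => g (gridPt N j) ^ 2)]
  · refine Finset.sum_le_sum_of_subset_of_nonneg ?_ fun _ _ _ => sq_nonneg _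
    intro j hj
    simp only [Finset.mem_image, Finset.mem_product, Finset.mem_range, Prod.exists] at hj ⊢
    obtain ⟨l, r, a, ⟨hl, hr, ha⟩, rfl⟩ := hj
    have h1 := hup l a ha r hr
    have h2 : (l + 1) * N ≤ (J + 1) * N := Nat.mul_le_mul_right _ hl
    have h3 : (b l + (a * m + r) + 1) * (J + 1) < N * (J + 1) := by linarith
    have := Nat.lt_of_mul_lt_mul_right h3
    omega
  · rintro ⟨l, r, a⟩ hz ⟨l', r', a'⟩ hz' heq
    simp only [Finset.coe_product, Finset.coe_range, Set.mem_prod, Set.mem_Iio] at hz hz' heq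
    obtain ⟨hl, hr, ha⟩ := hz
    obtain ⟨hl', hr', ha'⟩ := hz'
    -- Points of block `l` lie below the knot `(l + 1) / (J + 1)` and points of block `l'` above `l'
    -- / (J + 1)`, so equal indices force equal blocks.
    have hll : ∀ l l' a a' r r', a < p → r < m →
        b l + (a * m + r) = b l' + (a' * m + r') → l' ≤ l := by
      intro l l' a a' r r' ha hr heq
      have h1 := hup l a ha r hr
      have h2 := hlow l' a' r'
      rw [heq] at h1
      have := Nat.lt_of_mul_lt_mul_right (h2.trans h1)
      omega
    have hl_eq : l = l' :=
      le_antisymm (hll _ _ _ _ _ _ ha' hr' heq.symm) (hll _ _ _ _ _ _ ha hr heq)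
    subst hl_eq
    have h1 : a * m + r = a' * m + r' := by omega
    have h2 : a = a' := by
      have e1 : (a * m + r) / m = a := by
        rw [mul_comm, Nat.mul_add_div hm1, Nat.div_eq_of_lt hr, add_zero]
      have e2 : (a' * m + r') / m = a' := by
        rw [mul_comm, Nat.mul_add_div hm1, Nat.div_eq_of_lt hr', add_zero]
      rw [← e1, ← e2, h1]
    subst h2
    have h3 : r = r' := by omega
    rw [h3]

/-! ### The normal equations of spline regression -/

/-- The pairs of data `y` and splines `g` that satisfy the normal equations. -/
def normalFits (p J N : ℕ) : Submodule ℝ ((ℕ → ℝ) × (ℝ → ℝ)) where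
  carrier := {z | z.2 ∈ splineSpace p J ∧ ∀ s ∈ splineSpace p J,
    ∑ j ∈ Finset.range N, (z.1 j - z.2 (gridPt N j)) * s (gridPt N j) = 0}
  add_mem' {z z'} hz hz' := by
    refine ⟨Submodule.add_mem _ hz.1 hz'.1, fun s hs => ?_⟩
    refine Eq.trans ?_ ((congrArg₂ (· + ·) (hz.2 s hs) (hz'.2 s hs)).trans (add_zero 0))
    rw [← Finset.sum_add_distrib]
    refine Finset.sum_congr rfl fun j _ => ?_
    simp only [Prod.fst_add, Prod.snd_add, Pi.add_apply]
    ring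
  zero_mem' := ⟨Submodule.zero_mem _, fun s _ => by simp⟩
  smul_mem' c z hz := by
    refine ⟨Submodule.smul_mem _ _ hz.1, fun s hs => ?_⟩
    rw [← mul_zero c, ← hz.2 s hs, Finset.mul_sum]
    refine Finset.sum_congr rfl fun j _ => ?_
    simp only [Prod.smul_fst, Prod.smul_snd, Pi.smul_apply, smul_eq_mul]
    ring

lemma mem_normalFits {p J N : ℕ} {y : ℕ → ℝ} {g : ℝ → ℝ} :
    (y, g) ∈ normalFits p J N ↔ IsSpline p J g ∧ ∀ s, IsSpline p J s →
      ∑ j ∈ Finset.range N, (y j - g (gridPt N j)) * s (gridPt N j) = 0 := Iff.rfl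

/-- First variation of the residual sum of squares in a spline direction. Passing to the normal
equations replaces the argmin, which may be non-unique off the grid, by a linear relation. -/
lemma IsSplineFit.mem_normalFits {p J N : ℕ} {y : ℕ → ℝ} {g : ℝ → ℝ}
    (h : IsSplineFit p J N y g) : (y, g) ∈ normalFits p J N := by
  refine ⟨h.1, fun s hs => ?_⟩
  set S := ∑ j ∈ Finset.range N, (y j - g (gridPt N j)) * s (gridPt N j) with hS
  set T := ∑ j ∈ Finset.range N, s (gridPt N j) ^ 2 with hT
  have hT0 : 0 ≤ T := Finset.sum_nonneg fun _ _ => sq_nonneg _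
  have key : ∀ t : ℝ, 0 ≤ -(2 * t * S) + t ^ 2 * T := by
    intro t
    have h1 := h.2 (g + t • s) (Submodule.add_mem _ (mem_splineSpace.2 h.1)
      (Submodule.smul_mem _ t hs))
    have h2 : rss N y (g + t • s) = rss N y g + (-(2 * t * S) + t ^ 2 * T) := by
      simp only [rss, hS, hT, Finset.mul_sum, ← Finset.sum_neg_distrib, ← Finset.sum_add_distrib]
      refine Finset.sum_congr rfl fun j _ => ?_
      simp only [Pi.add_apply, Pi.smul_apply, smul_eq_mul]
      ring
    linarith
  by_contra hne
  -- The minimizing choice would be `S / T`; the added one covers directions that vanish on the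
  -- grid.
  have h1 := key (S / (T + 1))
  have hT1 : 0 < T + 1 := by linarith
  have h2 : -(2 * (S / (T + 1)) * S) + (S / (T + 1)) ^ 2 * T
      = -(S ^ 2 * (T + 2)) / (T + 1) ^ 2 := by
    field_simp
    ring
  rw [h2] at h1
  have h3 : 0 < S ^ 2 * (T + 2) / (T + 1) ^ 2 := by positivity
  rw [neg_div] at h1
  linarith

/-- Pythagoras: the residual is orthogonal to the fit itself. -/
lemma sum_sq_le_of_mem_normalFits {p J N : ℕ} {y : ℕ → ℝ} {g : ℝ → ℝ}
    (h : (y, g) ∈ normalFits p J N) :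
    ∑ j ∈ Finset.range N, g (gridPt N j) ^ 2 ≤ ∑ j ∈ Finset.range N, y j ^ 2 := by
  have h1 := h.2 g h.1
  have h2 : ∑ j ∈ Finset.range N, y j ^ 2 - ∑ j ∈ Finset.range N, g (gridPt N j) ^ 2
      = 2 * ∑ j ∈ Finset.range N, (y j - g (gridPt N j)) * g (gridPt N j)
        + ∑ j ∈ Finset.range N, (y j - g (gridPt N j)) ^ 2 := by
    rw [Finset.mul_sum, ← Finset.sum_sub_distrib, ← Finset.sum_add_distrib]
    refine Finset.sum_congr rfl fun j _ => ?_
    ring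
  have h3 : 0 ≤ ∑ j ∈ Finset.range N, (y j - g (gridPt N j)) ^ 2 :=
    Finset.sum_nonneg fun _ _ => sq_nonneg _
  simp only at h1
  rw [h1] at h2
  linarith

/-- Evaluation at the grid. -/
def gridEval (N : ℕ) : (ℝ → ℝ) →ₗ[ℝ] EuclideanSpace ℝ (Fin N) where
  toFun g := WithLp.toLp 2 fun j => g (gridPt N j)
  map_add' _ _ := rfl
  map_smul' _ _ := rfl

lemma gridEval_apply (N : ℕ) (g : ℝ → ℝ) (j : Fin N) : gridEval N g j = g (gridPt N j) := rfl

/-- The grid vectors of splines. -/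
def gridSplines (p J N : ℕ) : Submodule ℝ (EuclideanSpace ℝ (Fin N)) :=
  (splineSpace p J).map (gridEval N)

lemma inner_gridEval (N : ℕ) (y : ℕ → ℝ) (s : ℝ → ℝ) :
    inner ℝ (gridEval N s) (WithLp.toLp 2 fun j : Fin N => y j)
      = ∑ j ∈ Finset.range N, y j * s (gridPt N j) := by
  rw [PiLp.inner_apply, Finset.sum_range (fun j => y j * s (gridPt N j))]
  rfl

/-- Only the piecewise polynomial structure is used, with `p` coefficients on each of `J + 1`
intervals. Ignoring the smoothness conditions loses only a bounded factor. -/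
lemma finrank_gridSplines_le (p J N : ℕ) :
    Module.finrank ℝ (gridSplines p J N) ≤ p * (J + 1) := by
  let Φ : (Fin (J + 1) → Fin p → ℝ) →ₗ[ℝ] EuclideanSpace ℝ (Fin N) :=
    { toFun := fun c => WithLp.toLp 2 fun j => ∑ i : Fin p,
        c ⟨knotIndex J (gridPt N j), by unfold knotIndex; omega⟩ i * gridPt N j ^ (i : ℕ)
      map_add' := fun c c' => by
        ext j
        simp [add_mul, Finset.sum_add_distrib]
      map_smul' := fun a c => by
        ext j
        simp [mul_assoc, Finset.mul_sum] }
  have hle : gridSplines p J N ≤ LinearMap.range Φ := by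
    rintro _ ⟨g, hg, rfl⟩
    have hg' : IsSpline p J g := hg
    choose Q hQ hQg using hg'.2
    refine ⟨fun l i => (Q l (by omega)).coeff i, ?_⟩
    ext j
    have h1 := hQg (knotIndex J (gridPt N j)) (by unfold knotIndex; omega) (gridPt N j)
      (mem_knotInterval_knotIndex J (gridPt_mem j.2))
    rw [gridEval_apply, h1, Polynomial.eval_eq_sum_degreeLTEquiv (p := _) (n := p)]
    · rfl
    · exact Polynomial.mem_degreeLT.2 (hQ _ _)
  refine (Submodule.finrank_mono hle).trans ((LinearMap.finrank_range_le Φ).trans_eq ?_)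
  simp [Module.finrank_pi_fintype, mul_comm]

/-- This provides a fit of the unobserved noise, with which the fit of the observations is compared.
-/
lemma exists_mem_normalFits (p J N : ℕ) (y : ℕ → ℝ) : ∃ g, (y, g) ∈ normalFits p J N := by
  set Y : EuclideanSpace ℝ (Fin N) := WithLp.toLp 2 fun j : Fin N => y j with hY
  obtain ⟨g, hg, hgY⟩ := ((gridSplines p J N).orthogonalProjectionOnto Y).2
  refine ⟨g, hg, fun s hs => ?_⟩
  have h1 := (gridSplines p J N).starProjection_inner_eq_zero Y (gridEval N s) ⟨s, hs, rfl⟩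
  rw [Submodule.starProjection_apply, ← hgY, real_inner_comm, inner_sub_right, hY,
    inner_gridEval, show gridEval N g = WithLp.toLp 2 fun j : Fin N => g (gridPt N j) from rfl,
    inner_gridEval N (fun j => g (gridPt N j)) s, ← Finset.sum_sub_distrib] at h1
  rw [← h1]
  refine Finset.sum_congr rfl fun j _ => ?_
  ring

/-- The grid values of a spline fit, as an orthogonal projection. -/
theorem exists_fit_basis (p J N : ℕ) : ∃ d ≤ p * (J + 1), ∃ v : Fin d → ℕ → ℝ,
    (∀ a, ∑ j ∈ Finset.range N, v a j ^ 2 = 1) ∧ ∀ y g, (y, g) ∈ normalFits p J N →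
      ∑ j ∈ Finset.range N, g (gridPt N j) ^ 2
        = ∑ a, (∑ j ∈ Finset.range N, v a j * y j) ^ 2 := by
  let b := stdOrthonormalBasis ℝ (gridSplines p J N)
  refine ⟨_, finrank_gridSplines_le p J N,
    fun a j => if hj : j < N then (b a : EuclideanSpace ℝ (Fin N)) ⟨j, hj⟩ else 0,
    fun a => ?_, fun y g hg => ?_⟩
  · rw [Finset.sum_range]
    have h1 : ‖(b a : EuclideanSpace ℝ (Fin N))‖ ^ 2 = 1 := by
      have := b.orthonormal.1 a
      rw [← Submodule.coe_norm, this, one_pow]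
    rw [EuclideanSpace.norm_sq_eq] at h1
    rw [← h1]
    refine Finset.sum_congr rfl fun j _ => ?_
    simp
  · have hgV : gridEval N g ∈ gridSplines p J N := ⟨g, hg.1, rfl⟩
    have h1 := b.sum_sq_norm_inner_right ⟨gridEval N g, hgV⟩
    have h2 : ‖(⟨gridEval N g, hgV⟩ : gridSplines p J N)‖ ^ 2
        = ∑ j ∈ Finset.range N, g (gridPt N j) ^ 2 := by
      rw [Submodule.coe_norm, EuclideanSpace.norm_sq_eq, Finset.sum_range]
      refine Finset.sum_congr rfl fun j _ => ?_
      rw [Real.norm_eq_abs, sq_abs, gridEval_apply]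
    rw [← h2, ← h1]
    refine Finset.sum_congr rfl fun a _ => ?_
    rw [Real.norm_eq_abs, sq_abs]
    congr 1
    -- A basis vector is the grid vector of a spline, so the normal equations let the data replace
    -- the fit in its inner products; then Parseval applies.
    obtain ⟨s, hs, hsb⟩ := (b a).2
    have h3 := hg.2 s hs
    simp only [sub_mul, Finset.sum_sub_distrib] at h3
    rw [Submodule.coe_inner, ← hsb]
    refine (inner_gridEval N (fun j => g (gridPt N j)) s).trans ?_
    rw [← sub_eq_zero.1 h3, Finset.sum_range, Finset.sum_range]
    refine Finset.sum_congr rfl fun j _ => ?_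
    simp [← hsb, gridEval_apply, mul_comm]

/-! ### Averages -/

/-- The average of the first `n` terms of a sequence. -/
def avg (n : ℕ) (f : ℕ → ℝ) : ℝ := (1 / (n : ℝ)) * ∑ i ∈ Finset.range n, f i

lemma avg_add (n : ℕ) (f g : ℕ → ℝ) : avg n (fun i => f i + g i) = avg n f + avg n g := by
  simp [avg, Finset.sum_add_distrib, mul_add]

lemma avg_sub (n : ℕ) (f g : ℕ → ℝ) : avg n (fun i => f i - g i) = avg n f - avg n g := by
  simp [avg, Finset.sum_sub_distrib, mul_sub]

lemma avg_const_mul (n : ℕ) (c : ℝ) (f : ℕ → ℝ) : avg n (fun i => c * f i) = c * avg n f := by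
  simp only [avg, ← Finset.mul_sum]
  ring

lemma avg_mul_const (n : ℕ) (c : ℝ) (f : ℕ → ℝ) : avg n (fun i => f i * c) = avg n f * c := by
  simp only [avg, ← Finset.sum_mul]
  ring

lemma avg_const {n : ℕ} (hn : 0 < n) (c : ℝ) : avg n (fun _ => c) = c := by
  have : (n : ℝ) ≠ 0 := by positivity
  simp [avg, this]

lemma avg_congr {n : ℕ} {f g : ℕ → ℝ} (h : ∀ i < n, f i = g i) : avg n f = avg n g := by
  unfold avg
  rw [Finset.sum_congr rfl fun i hi => h i (Finset.mem_range.1 hi)]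

lemma avg_mono {n : ℕ} {f g : ℕ → ℝ} (h : ∀ i < n, f i ≤ g i) : avg n f ≤ avg n g :=
  mul_le_mul_of_nonneg_left (Finset.sum_le_sum fun i hi => h i (Finset.mem_range.1 hi))
    (by positivity)

lemma avg_nonneg {n : ℕ} {f : ℕ → ℝ} (h : ∀ i < n, 0 ≤ f i) : 0 ≤ avg n f :=
  mul_nonneg (by positivity) (Finset.sum_nonneg fun i hi => h i (Finset.mem_range.1 hi))

lemma abs_avg_le (n : ℕ) (f : ℕ → ℝ) : |avg n f| ≤ avg n fun i => |f i| := by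
  unfold avg
  rw [abs_mul, abs_of_nonneg (by positivity : (0 : ℝ) ≤ 1 / n)]
  exact mul_le_mul_of_nonneg_left (Finset.abs_sum_le_sum_abs _ _) (by positivity)

/-- The empirical variance is nonnegative. -/
lemma avg_sq_le {n : ℕ} (hn : 0 < n) (f : ℕ → ℝ) : avg n f ^ 2 ≤ avg n fun i => f i ^ 2 := by
  have h1 : 0 ≤ avg n fun i => (f i - avg n f) ^ 2 := avg_nonneg fun i _ => sq_nonneg _
  have h2 : (avg n fun i => (f i - avg n f) ^ 2)
      = avg n (fun i => f i ^ 2) - avg n f * (2 * avg n f) + avg n f ^ 2 := by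
    have h3 : (avg n fun i => (f i - avg n f) ^ 2)
        = avg n fun i => f i ^ 2 - f i * (2 * avg n f) + avg n f ^ 2 :=
      avg_congr fun i _ => by ring
    rw [h3, avg_add, avg_sub, avg_mul_const, avg_const hn]
  nlinarith

lemma continuousOn_avg {n : ℕ} {f : ℕ → ℝ → ℝ} {s : Set ℝ} (h : ∀ i < n, ContinuousOn (f i) s) :
    ContinuousOn (fun x => avg n fun i => f i x) s :=
  continuousOn_const.mul (continuousOn_finsetSum _ fun i hi => h i (Finset.mem_range.1 hi))

lemma integral_avg {n : ℕ} {f : ℕ → ℝ → ℝ} (h : ∀ i < n, ContinuousOn (f i) (Icc 0 1)) :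
    ∫ x in (0 : ℝ)..1, avg n (fun i => f i x) = avg n fun i => ∫ x in (0 : ℝ)..1, f i x := by
  unfold avg
  rw [intervalIntegral.integral_const_mul, intervalIntegral.integral_finsetSum]
  intro i hi
  refine ContinuousOn.intervalIntegrable ?_
  rw [uIcc_of_le zero_le_one]
  exact h i (Finset.mem_range.1 hi)

/-- With `c = 1` this centers the fits; with the scores as weights it shows that `W_k = avg_i (ξ_ik
G_i)` is itself a fit. -/
lemma normalFits_avg {p J N n : ℕ} {y : ℕ → ℕ → ℝ} {g : ℕ → ℝ → ℝ} (c : ℕ → ℝ)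
    (h : ∀ i < n, (y i, g i) ∈ normalFits p J N) :
    (fun j => avg n fun i => c i * y i j, fun x => avg n fun i => c i * g i x)
      ∈ normalFits p J N := by
  have h1 := Submodule.smul_mem (normalFits p J N) (1 / (n : ℝ))
    (Submodule.sum_mem (normalFits p J N) (t := Finset.range n)
      (f := fun i => c i • ((y i, g i) : (ℕ → ℝ) × (ℝ → ℝ)))
      fun i hi => Submodule.smul_mem _ _ (h i (Finset.mem_range.1 hi)))
  convert h1 using 1
  ext j
  · simp [avg, Prod.fst_sum, Finset.sum_apply]
  · simp [avg, Prod.snd_sum, Finset.sum_apply]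

/-- The pointwise decomposition of the error of the empirical covariance. -/
lemma abs_avg_mul_sub_le {n : ℕ} (hn : 0 < n) {ρ : ℝ} (hρ : 0 < ρ) (hρ1 : ρ ≤ 1)
    {z z' u u' r r' g g' : ℕ → ℝ}
    (hz : ∀ i < n, z i = u i + r i - avg n u + g i - avg n g)
    (hz' : ∀ i < n, z' i = u' i + r' i - avg n u' + g' i - avg n g') :
    |avg n (fun i => z i * z' i) - avg n (fun i => u i * u' i)|
      ≤ |avg n fun i => u i * g' i| + |avg n fun i => u' i * g i|
        + ((avg n fun i => ρ * u i ^ 2 + 3 / ρ * r i ^ 2 + 5 * g i ^ 2) + 4 * avg n u ^ 2)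
        + ((avg n fun i => ρ * u' i ^ 2 + 3 / ρ * r' i ^ 2 + 5 * g' i ^ 2) + 4 * avg n u' ^ 2) := by
  set U := avg n u
  set U' := avg n u'
  set γ := avg n g
  set γ' := avg n g'
  let e : ℕ → ℝ := fun i => r i - U + g i - γ
  let e' : ℕ → ℝ := fun i => r' i - U' + g' i - γ'
  -- With `z = u + e`, the averages of `u i` times the constants `U'` and `γ'` collapse to products
  -- of averages. The two terms `u g'` and `u' g` are kept intact, because only cancellation over
  -- `i` makes them small enough.
  have hid : avg n (fun i => z i * z' i) - avg n (fun i => u i * u' i)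
      = (avg n fun i => u i * g' i) + (avg n fun i => u' i * g i)
        + ((avg n fun i => u i * r' i + u' i * r i + e i * e' i)
          - (2 * (U * U') + U * γ' + U' * γ)) := by
    have h1 : 2 * (U * U') + U * γ' + U' * γ
        = avg n fun i => u i * (U' + γ') + u' i * (U + γ) := by
      rw [avg_add, avg_mul_const, avg_mul_const]
      ring
    rw [h1, ← avg_sub, ← avg_sub, ← avg_add, ← avg_add]
    refine avg_congr fun i hi => ?_
    rw [hz i hi, hz' i hi]
    simp only [e, e']
    ring
  have hγ : γ ^ 2 ≤ avg n fun i => g i ^ 2 := avg_sq_le hn g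
  have hγ' : γ' ^ 2 ≤ avg n fun i => g' i ^ 2 := avg_sq_le hn g'
  have hmain : |avg n fun i => u i * r' i + u' i * r i + e i * e' i|
      ≤ (avg n fun i => ρ * u i ^ 2 + 3 / ρ * r i ^ 2 + 2 * g i ^ 2)
        + (avg n fun i => ρ * u' i ^ 2 + 3 / ρ * r' i ^ 2 + 2 * g' i ^ 2)
        + (2 * U ^ 2 + 2 * γ ^ 2 + 2 * U' ^ 2 + 2 * γ' ^ 2) := by
    rw [← avg_const hn (2 * U ^ 2 + 2 * γ ^ 2 + 2 * U' ^ 2 + 2 * γ' ^ 2), ← avg_add, ← avg_add]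
    refine (abs_avg_le n _).trans (avg_mono fun i _ => ?_)
    -- The weight `ρ` fits remainders of size `ρ`: both `ρ u ^ 2` and `r ^ 2 / ρ` are then of order
    -- `ρ`.
    have key : ∀ a b : ℝ, |a * b| ≤ ρ * a ^ 2 / 2 + b ^ 2 / ρ / 2 := by
      intro a b
      have h2 : ρ * a ^ 2 / 2 + b ^ 2 / ρ / 2 - |a * b| = (ρ * |a| - |b|) ^ 2 / (2 * ρ) := by
        rw [abs_mul]
        field_simp
        rw [← sq_abs a, ← sq_abs b]
        ring
      have h3 : 0 ≤ (ρ * |a| - |b|) ^ 2 / (2 * ρ) := by positivity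
      linarith
    have he : ∀ a b c d : ℝ, (a - b + c - d) ^ 2 ≤ 4 * (a ^ 2 + b ^ 2 + c ^ 2 + d ^ 2) := by
      intro a b c d
      nlinarith [sq_nonneg (a + b), sq_nonneg (a - c), sq_nonneg (a + d), sq_nonneg (b + c),
        sq_nonneg (b - d), sq_nonneg (c + d)]
    have h4 : |e i * e' i| ≤ e i ^ 2 / 2 + e' i ^ 2 / 2 := by
      rw [abs_mul]
      nlinarith [sq_nonneg (|e i| - |e' i|), sq_abs (e i), sq_abs (e' i)]
    have h5 := he (r i) U (g i) γ
    have h6 := he (r' i) U' (g' i) γ'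
    have h7 := key (u i) (r' i)
    have h8 := key (u' i) (r i)
    have h9 : ∀ b : ℝ, 2 * b ^ 2 + b ^ 2 / ρ / 2 ≤ 3 / ρ * b ^ 2 := by
      intro b
      have : b ^ 2 ≤ b ^ 2 / ρ := le_div_self (sq_nonneg b) hρ hρ1
      rw [div_mul_eq_mul_div, mul_div_assoc]
      linarith [sq_nonneg b]
    have h10 := h9 (r i)
    have h11 := h9 (r' i)
    have h12 : 0 ≤ ρ * u i ^ 2 := by positivity
    have h13 : 0 ≤ ρ * u' i ^ 2 := by positivity
    have h14 := abs_add_le (u i * r' i + u' i * r i) (e i * e' i)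
    have h15 := abs_add_le (u i * r' i) (u' i * r i)
    simp only [e, e'] at *
    linarith
  have hprod : |2 * (U * U') + U * γ' + U' * γ|
      ≤ 3 / 2 * U ^ 2 + 3 / 2 * U' ^ 2 + γ ^ 2 / 2 + γ' ^ 2 / 2 := by
    rw [abs_le]
    constructor <;> nlinarith [sq_nonneg (U + U'), sq_nonneg (U - U'), sq_nonneg (U + γ'),
      sq_nonneg (U - γ'), sq_nonneg (U' + γ), sq_nonneg (U' - γ)]
  have hsplit : ∀ (u r g : ℕ → ℝ), (avg n fun i => ρ * u i ^ 2 + 3 / ρ * r i ^ 2 + 5 * g i ^ 2)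
      = (avg n fun i => ρ * u i ^ 2 + 3 / ρ * r i ^ 2 + 2 * g i ^ 2)
        + 3 * avg n fun i => g i ^ 2 := by
    intro u r g
    rw [← avg_const_mul, ← avg_add]
    congr 1
    funext i
    ring
  rw [hid, hsplit, hsplit]
  have h1 := abs_add_le ((avg n fun i => u i * g' i) + (avg n fun i => u' i * g i))
    ((avg n fun i => u i * r' i + u' i * r i + e i * e' i) - (2 * (U * U') + U * γ' + U' * γ))
  have h2 := abs_add_le (avg n fun i => u i * g' i) (avg n fun i => u' i * g i)
  have h3 := abs_sub (avg n fun i => u i * r' i + u' i * r i + e i * e' i)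
    (2 * (U * U') + U * γ' + U' * γ)
  nlinarith [sq_nonneg U, sq_nonneg U', sq_nonneg γ, sq_nonneg γ']

/-! ### Integrals over shifted products -/

/-- Both `[0, 1 - h]` and its translate by `h` lie in `[0,1]`, so the right side does not depend on
`h`. This turns a pointwise domination into a bound uniform over all lags. -/
lemma ofReal_abs_integral_shift_le {h : ℝ} (hh : 0 ≤ h) (hh1 : h ≤ 1) {Ψ : ℝ → ℝ} {F : ℝ → ℝ≥0∞}
    (hF : AEMeasurable F (volume.restrict (Icc 0 1)))
    (hΨ : ∀ x ∈ Icc (0 : ℝ) (1 - h), ENNReal.ofReal |Ψ x| ≤ F x + F (x + h)) :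
    ENNReal.ofReal |∫ x in (0 : ℝ)..(1 - h), Ψ x| ≤ 2 * ∫⁻ x in Icc 0 1, F x := by
  rw [intervalIntegral.integral_of_le (by linarith), ← integral_Icc_eq_integral_Ioc]
  have h1 : ENNReal.ofReal |∫ x in Icc 0 (1 - h), Ψ x| ≤ ∫⁻ x in Icc 0 (1 - h), ‖Ψ x‖ₑ := by
    rw [← Real.enorm_eq_ofReal_abs]
    exact enorm_integral_le_lintegral_enorm _
  refine h1.trans ?_
  have h2 : ∫⁻ x in Icc 0 (1 - h), ‖Ψ x‖ₑ ≤ ∫⁻ x in Icc 0 (1 - h), (F x + F (x + h)) :=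
    setLIntegral_mono' measurableSet_Icc fun x hx => by
      rw [Real.enorm_eq_ofReal_abs]
      exact hΨ x hx
  refine h2.trans ?_
  have hsub : Icc 0 (1 - h) ⊆ Icc (0 : ℝ) 1 := Icc_subset_Icc_right (by linarith)
  rw [lintegral_add_left' (hF.mono_measure (Measure.restrict_mono hsub le_rfl)), two_mul]
  refine add_le_add (lintegral_mono_set hsub) ?_
  have h3 : ∫⁻ x in Icc 0 (1 - h), F (x + h) = ∫⁻ x in Icc h 1, F x := by
    rw [← lintegral_indicator measurableSet_Icc, ← lintegral_indicator measurableSet_Icc,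
      ← lintegral_add_right_eq_self ((Icc h 1).indicator F) h]
    refine lintegral_congr fun x => ?_
    have : x ∈ Icc 0 (1 - h) ↔ x + h ∈ Icc h 1 := by
      simp only [mem_Icc]
      constructor <;> rintro ⟨h1, h2⟩ <;> constructor <;> linarith
    by_cases hx : x ∈ Icc 0 (1 - h)
    · rw [indicator_of_mem hx, indicator_of_mem (this.1 hx)]
    · rw [indicator_of_notMem hx, indicator_of_notMem (fun h => hx (this.2 h))]
  rw [h3]
  exact lintegral_mono_set (Icc_subset_Icc_left hh)

lemma lintegral_ofReal_continuousOn {f : ℝ → ℝ} (hf : ContinuousOn f (Icc 0 1))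
    (h0 : ∀ x ∈ Icc (0 : ℝ) 1, 0 ≤ f x) :
    ∫⁻ x in Icc 0 1, ENNReal.ofReal (f x) = ENNReal.ofReal (∫ x in (0 : ℝ)..1, f x) := by
  rw [intervalIntegral.integral_of_le zero_le_one, ← integral_Icc_eq_integral_Ioc,
    ofReal_integral_eq_lintegral_ofReal (hf.integrableOn_Icc)]
  exact ae_restrict_of_forall_mem measurableSet_Icc h0

/-! ### Series in the principal components -/

/-- The function with the scores `c` in the system `φ`. -/
def scoreSeries (φ : ℕ → ℝ → ℝ) (c : ℕ → ℝ) (x : ℝ) : ℝ := ∑' k, c k * φ k x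

section Series

variable {φ : ℕ → ℝ → ℝ} {a c : ℕ → ℝ}

lemma summable_mul_abs (ha : Summable a) (ha0 : ∀ k, 0 ≤ a k)
    (hc : Summable fun k => a k * c k ^ 2) : Summable fun k => a k * |c k| := by
  refine Summable.of_nonneg_of_le (fun k => mul_nonneg (ha0 k) (abs_nonneg _)) (fun k => ?_)
    (ha.add hc)
  rw [← mul_one_add]
  exact mul_le_mul_of_nonneg_left (by nlinarith [sq_nonneg (|c k| - 1), sq_abs (c k)]) (ha0 k)

/-- Cauchy-Schwarz with weights `a k`, first for finite sums so that no further summability is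
needed. -/
lemma tsum_mul_abs_sq_le (ha : Summable a) (ha0 : ∀ k, 0 ≤ a k)
    (hc : Summable fun k => a k * c k ^ 2) :
    (∑' k, a k * |c k|) ^ 2 ≤ (∑' k, a k) * ∑' k, a k * c k ^ 2 := by
  have h0 : 0 ≤ (∑' k, a k) * ∑' k, a k * c k ^ 2 :=
    mul_nonneg (tsum_nonneg ha0) (tsum_nonneg fun k => mul_nonneg (ha0 k) (sq_nonneg _))
  refine (Real.le_sqrt (tsum_nonneg fun k => mul_nonneg (ha0 k) (abs_nonneg _)) h0).1 ?_
  refine Real.tsum_le_of_sum_le (fun k => mul_nonneg (ha0 k) (abs_nonneg _)) fun s => ?_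
  refine Real.le_sqrt_of_sq_le ?_
  refine (Finset.sum_sq_le_sum_mul_sum_of_sq_le_mul s (f := a) (g := fun k => a k * c k ^ 2)
    (fun k _ => ha0 k) (fun k _ => mul_nonneg (ha0 k) (sq_nonneg _)) fun k _ => ?_).trans ?_
  · rw [mul_pow, sq_abs]
    exact le_of_eq (by ring)
  · exact mul_le_mul (ha.sum_le_tsum s fun k _ => ha0 k)
      (hc.sum_le_tsum s fun k _ => mul_nonneg (ha0 k) (sq_nonneg _))
      (Finset.sum_nonneg fun k _ => mul_nonneg (ha0 k) (sq_nonneg _)) (tsum_nonneg ha0)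

variable (hφ : ∀ k, ∀ x ∈ Icc (0 : ℝ) 1, |φ k x| ≤ a k)
include hφ

lemma abs_mul_phi_le {x : ℝ} (hx : x ∈ Icc (0 : ℝ) 1) (k : ℕ) : |c k * φ k x| ≤ a k * |c k| := by
  rw [abs_mul, mul_comm]
  exact mul_le_mul_of_nonneg_right (hφ k x hx) (abs_nonneg _)

lemma summable_scoreSeries (hs : Summable fun k => a k * |c k|) {x : ℝ}
    (hx : x ∈ Icc (0 : ℝ) 1) : Summable fun k => c k * φ k x :=
  Summable.of_norm_bounded hs fun k => abs_mul_phi_le hφ hx k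

lemma abs_scoreSeries_le (hs : Summable fun k => a k * |c k|) {x : ℝ}
    (hx : x ∈ Icc (0 : ℝ) 1) : |scoreSeries φ c x| ≤ ∑' k, a k * |c k| := by
  rw [← Real.norm_eq_abs]
  exact tsum_of_norm_bounded hs.hasSum fun k => abs_mul_phi_le hφ hx k

lemma continuousOn_scoreSeries (hφc : ∀ k, ContinuousOn (φ k) (Icc 0 1))
    (hs : Summable fun k => a k * |c k|) : ContinuousOn (scoreSeries φ c) (Icc 0 1) :=
  continuousOn_tsum (fun k => continuousOn_const.mul (hφc k)) hs
    fun k _ hx => abs_mul_phi_le hφ hx k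

/-- The point `x` of the trajectory is separated from the factors `v i`: with `v i = G i x'` the
remaining average does not depend on `x`, so one bound for it serves all lags. -/
lemma scoreSeries_avg {n : ℕ} {ξ : ℕ → ℕ → ℝ} (hs : ∀ i < n, Summable fun k => a k * |ξ i k|)
    {x : ℝ} (hx : x ∈ Icc (0 : ℝ) 1) (v : ℕ → ℝ) :
    HasSum (fun k => φ k x * avg n fun i => ξ i k * v i)
      (avg n fun i => scoreSeries φ (ξ i) x * v i) := by
  have h1 : HasSum (fun k => ∑ i ∈ Finset.range n, ξ i k * φ k x * v i)
      (∑ i ∈ Finset.range n, scoreSeries φ (ξ i) x * v i) :=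
    hasSum_sum fun i hi =>
      ((summable_scoreSeries hφ (hs i (Finset.mem_range.1 hi)) hx).hasSum).mul_right (v i)
  have h2 := h1.mul_left (1 / (n : ℝ))
  have h3 : (fun k => φ k x * avg n fun i => ξ i k * v i)
      = fun k => 1 / (n : ℝ) * ∑ i ∈ Finset.range n, ξ i k * φ k x * v i := by
    funext k
    simp only [avg, Finset.mul_sum]
    refine Finset.sum_congr rfl fun i _ => ?_
    ring
  rw [h3]
  exact h2

lemma exists_spline_near_scoreSeries {p J : ℕ} {ρ : ℝ} (hρ : 0 < ρ)
    (hφs : ∀ k, ∃ s, IsSpline p J s ∧ ∀ x ∈ Icc (0 : ℝ) 1, |φ k x - s x| ≤ ρ * a k)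
    (hs : Summable fun k => a k * |c k|) (ha0 : ∀ k, 0 ≤ a k) :
    ∃ s, IsSpline p J s ∧ ∀ x ∈ Icc (0 : ℝ) 1,
      |scoreSeries φ c x - s x| ≤ ρ * ((∑' k, a k * |c k|) + 1) := by
  choose s hs1 hs2 using hφs
  -- Cutting the series where its tail is below `ρ` leaves a finite combination of splines. The tail
  -- is the origin of the `+ 1` in the bound.
  have htail := (tendsto_sum_nat_add fun k => a k * |c k|).eventually (gt_mem_nhds hρ)
  obtain ⟨K, hK⟩ := htail.exists
  refine ⟨∑ k ∈ Finset.range K, c k • s k,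
    Submodule.sum_mem (splineSpace p J) fun k _ => Submodule.smul_mem _ _ (hs1 k), fun x hx => ?_⟩
  have hsum := summable_scoreSeries hφ hs hx
  rw [scoreSeries, ← hsum.sum_add_tsum_nat_add K, Finset.sum_apply]
  have h1 : |∑' k, c (k + K) * φ (k + K) x| ≤ ρ := by
    rw [← Real.norm_eq_abs]
    exact (tsum_of_norm_bounded ((summable_nat_add_iff K).2 hs).hasSum
      fun k => abs_mul_phi_le hφ hx (k + K)).trans hK.le
  have h2 : |∑ k ∈ Finset.range K, (c k * φ k x - c k * s k x)| ≤ ρ * ∑' k, a k * |c k| := by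
    refine (Finset.abs_sum_le_sum_abs _ _).trans ?_
    refine (Finset.sum_le_sum (g := fun k => ρ * (a k * |c k|)) fun k _ => ?_).trans ?_
    · rw [← mul_sub, abs_mul]
      nlinarith [hs2 k x hx, abs_nonneg (c k)]
    · rw [← Finset.mul_sum]
      exact mul_le_mul_of_nonneg_left
        (hs.sum_le_tsum _ fun k _ => mul_nonneg (ha0 k) (abs_nonneg _)) hρ.le
  rw [Finset.sum_sub_distrib] at h2
  simp only [Pi.smul_apply, smul_eq_mul]
  have h3 := abs_add_le (∑ k ∈ Finset.range K, c k * φ k x - ∑ k ∈ Finset.range K, c k * s k x)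
    (∑' k, c (k + K) * φ (k + K) x)
  rw [show ∑ k ∈ Finset.range K, c k * φ k x + ∑' k, c (k + K) * φ (k + K) x
      - ∑ k ∈ Finset.range K, c k * s k x = (∑ k ∈ Finset.range K, c k * φ k x
      - ∑ k ∈ Finset.range K, c k * s k x) + ∑' k, c (k + K) * φ (k + K) x by ring]
  linarith

end Series

/-! ### The deterministic error bound -/

lemma intervalIntegrable_of_continuousOn {f : ℝ → ℝ} (hf : ContinuousOn f (Icc 0 1)) {x y : ℝ}
    (hx : x ∈ Icc (0 : ℝ) 1) (hy : y ∈ Icc (0 : ℝ) 1) : IntervalIntegrable f volume x y :=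
  (hf.mono (uIcc_subset_Icc hx hy)).intervalIntegrable

lemma integral_mono_Icc {f g : ℝ → ℝ} (hf : ContinuousOn f (Icc 0 1))
    (hg : ContinuousOn g (Icc 0 1)) (h : ∀ x ∈ Icc (0 : ℝ) 1, f x ≤ g x) :
    ∫ x in (0 : ℝ)..1, f x ≤ ∫ x in (0 : ℝ)..1, g x :=
  intervalIntegral.integral_mono_on zero_le_one
    (intervalIntegrable_of_continuousOn hf (by simp) (by simp))
    (intervalIntegrable_of_continuousOn hg (by simp) (by simp)) h

lemma continuousOn_sq {f : ℝ → ℝ} {s : Set ℝ} (hf : ContinuousOn f s) :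
    ContinuousOn (fun x => f x ^ 2) s := hf.pow 2

lemma continuousOn_const_mul {f : ℝ → ℝ} {s : Set ℝ} (c : ℝ) (hf : ContinuousOn f s) :
    ContinuousOn (fun x => c * f x) s := continuousOn_const.mul hf

lemma abs_sub_avg_le {n : ℕ} {d b : ℕ → ℝ} (h : ∀ i < n, |d i| ≤ b i) {i : ℕ} (hi : i < n) :
    |d i - avg n d| ≤ b i + avg n b :=
  (abs_sub _ _).trans (add_le_add (h i hi) ((abs_avg_le n d).trans (avg_mono h)))

/-- Centering a sequence of bounds costs at most a factor four in mean square. -/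
lemma avg_add_avg_sq_le {n : ℕ} (hn : 0 < n) (b : ℕ → ℝ) :
    (avg n fun i => (b i + avg n b) ^ 2) ≤ 4 * avg n fun i => b i ^ 2 := by
  have h1 : (avg n fun i => (b i + avg n b) ^ 2)
      = (avg n fun i => b i ^ 2) + avg n b * (2 * avg n b) + avg n b ^ 2 := by
    have h3 : (avg n fun i => (b i + avg n b) ^ 2)
        = avg n fun i => b i ^ 2 + b i * (2 * avg n b) + avg n b ^ 2 :=
      avg_congr fun i _ => by ring
    rw [h3, avg_add, avg_add, avg_mul_const, avg_const hn]
  have h2 := avg_sq_le hn b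
  nlinarith

section Deterministic

variable {p J N n : ℕ} {ρ : ℝ} {φ : ℕ → ℝ → ℝ} {a : ℕ → ℝ} {ξ : ℕ → ℕ → ℝ}
  {mN : ℕ → ℝ} {y e : ℕ → ℕ → ℝ} {gh G : ℕ → ℝ → ℝ}

/-- The part of the fitted trajectories that comes from the approximation of the trajectories by
splines. -/
lemma exists_fit_residual (hp : 2 ≤ p) (hN : 2 * p * (J + 1) ≤ N) (hn : 0 < n)
    (hρ : 0 < ρ) (ha : Summable a) (ha0 : ∀ k, 0 ≤ a k)
    (hφc : ∀ k, ContinuousOn (φ k) (Icc 0 1)) (hφ : ∀ k, ∀ x ∈ Icc (0 : ℝ) 1, |φ k x| ≤ a k)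
    (hφs : ∀ k, ∃ s, IsSpline p J s ∧ ∀ x ∈ Icc (0 : ℝ) 1, |φ k x - s x| ≤ ρ * a k)
    (hξ : ∀ i < n, Summable fun k => a k * ξ i k ^ 2)
    (hy : ∀ i < n, ∀ j < N, y i j = mN j + scoreSeries φ (ξ i) (gridPt N j) + e i j)
    (hgh : ∀ i < n, (y i, gh i) ∈ normalFits p J N)
    (hG : ∀ i < n, (e i, G i) ∈ normalFits p J N) :
    ∃ r : ℕ → ℝ → ℝ, (∀ i < n, ContinuousOn (r i) (Icc 0 1)) ∧
      (∀ i x, gh i x - meanHat n gh x = scoreSeries φ (ξ i) x + r i x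
        - avg n (fun i => scoreSeries φ (ξ i) x) + G i x - avg n fun i => G i x) ∧
      (avg n fun i => ∫ x in (0 : ℝ)..1, r i x ^ 2)
        ≤ 16 * (normConst p + 1) * ρ ^ 2 *
          ((∑' k, a k) * (avg n fun i => ∑' k, a k * ξ i k ^ 2) + 1) := by
  set Z : ℕ → ℝ → ℝ := fun i => scoreSeries φ (ξ i) with hZ
  have hS : ∀ i < n, Summable fun k => a k * |ξ i k| := fun i hi =>
    summable_mul_abs ha ha0 (hξ i hi)
  have hN0 : 0 < N := lt_of_lt_of_le (by positivity) hN
  have hN0' : (0 : ℝ) < N := by exact_mod_cast hN0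
  have hc := normConst_nonneg p
  have hex : ∀ i, ∃ s, i < n → IsSpline p J s ∧ ∀ x ∈ Icc (0 : ℝ) 1,
      |Z i x - s x| ≤ ρ * ((∑' k, a k * |ξ i k|) + 1) := fun i => by
    by_cases hi : i < n
    · obtain ⟨s, hs⟩ := exists_spline_near_scoreSeries hφ hρ hφs (hS i hi) ha0
      exact ⟨s, fun _ => hs⟩
    · exact ⟨0, fun h => absurd h hi⟩
  choose s hs using hex
  set b : ℕ → ℝ := fun i => ρ * ((∑' k, a k * |ξ i k|) + 1) with hb
  -- By linearity `H i` is a fit of `Y i`, and on the grid `Y i` equals `mN` plus the spline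
  -- approximation error of `Z i`.
  let H : ℕ → ℝ → ℝ := fun i => gh i - s i - G i
  let Y : ℕ → ℕ → ℝ := fun i j => y i j - s i (gridPt N j) - e i j
  have hH : ∀ i < n, (Y i, H i) ∈ normalFits p J N := fun i hi =>
    Submodule.sub_mem _ (Submodule.sub_mem _ (hgh i hi)
      (mem_normalFits.2 ⟨(hs i hi).1, by simp⟩ :
        (fun j => s i (gridPt N j), s i) ∈ normalFits p J N)) (hG i hi)
  let D : ℕ → ℝ → ℝ := fun i x => H i x - avg n fun i => H i x
  have hD : ∀ i < n, (fun j => Y i j - avg n fun i => Y i j, D i) ∈ normalFits p J N := by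
    intro i hi
    have h1 := Submodule.sub_mem _ (hH i hi) (normalFits_avg (fun _ => 1) hH)
    simp only [one_mul] at h1
    exact h1
  -- The term `mN` is common to all `i` and cancels on centering, so the mean function need not be
  -- approximated by splines.
  have hYb : ∀ i < n, ∀ j < N, |Y i j - avg n fun i => Y i j| ≤ b i + avg n b := by
    intro i hi j hj
    have h1 : ∀ i < n, Y i j = mN j + (Z i (gridPt N j) - s i (gridPt N j)) := fun i hi => by
      simp only [Y, hy i hi j hj]
      ring
    rw [avg_congr h1, avg_add, avg_const hn, h1 i hi, add_sub_add_left_eq_sub]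
    exact abs_sub_avg_le (fun i hi => (hs i hi).2 _ (gridPt_mem hj)) hi
  have hDint : ∀ i < n, ∫ x in (0 : ℝ)..1, D i x ^ 2 ≤ normConst p * (b i + avg n b) ^ 2 := by
    intro i hi
    refine (IsSpline.integral_sq_le hp hN (hD i hi).1).trans ?_
    have h1 : ∑ j ∈ Finset.range N, D i (gridPt N j) ^ 2 ≤ N * (b i + avg n b) ^ 2 := by
      refine (sum_sq_le_of_mem_normalFits (hD i hi)).trans ?_
      refine (Finset.sum_le_card_nsmul _ _ ((b i + avg n b) ^ 2) fun j hj => ?_).trans_eq ?_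
      · rw [← sq_abs]
        exact pow_le_pow_left₀ (abs_nonneg _) (hYb i hi j (Finset.mem_range.1 hj)) 2
      · simp
    refine (mul_le_mul_of_nonneg_left h1 (by positivity)).trans_eq ?_
    field_simp
  let r : ℕ → ℝ → ℝ := fun i x => (gh i x - G i x - Z i x) - avg n fun i => gh i x - G i x - Z i x
  have hZc : ∀ i < n, ContinuousOn (Z i) (Icc 0 1) := fun i hi =>
    continuousOn_scoreSeries hφ hφc (hS i hi)
  have hRc : ∀ i < n, ContinuousOn (fun x => gh i x - G i x - Z i x) (Icc 0 1) := fun i hi =>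
    ((IsSpline.continuousOn hp (hgh i hi).1).sub (IsSpline.continuousOn hp (hG i hi).1)).sub
      (hZc i hi)
  have hrc : ∀ i < n, ContinuousOn (r i) (Icc 0 1) := fun i hi =>
    (hRc i hi).sub (continuousOn_avg hRc)
  have hrD : ∀ i < n, ∀ x ∈ Icc (0 : ℝ) 1, r i x ^ 2 ≤ 2 * D i x ^ 2 + 2 * (b i + avg n b) ^ 2 := by
    intro i hi x hx
    -- The remainder is the centered fit of the approximation errors minus the centered
    -- approximation errors themselves. The grid bound covers the first part, the uniform bound the
    -- second.
    have h1 : r i x = D i x - ((Z i x - s i x) - avg n fun i => Z i x - s i x) := by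
      have h2 : (avg n fun i => gh i x - G i x - Z i x)
          = (avg n fun i => H i x) - avg n fun i => Z i x - s i x := by
        rw [← avg_sub]
        refine avg_congr fun i _ => ?_
        simp only [H, Pi.sub_apply]
        ring
      simp only [r, D, h2, H, Pi.sub_apply]
      ring
    have h2 := abs_sub_avg_le (fun i hi => (hs i hi).2 x hx) hi
    have h3 : ((Z i x - s i x) - avg n fun i => Z i x - s i x) ^ 2 ≤ (b i + avg n b) ^ 2 := by
      rw [← sq_abs]
      exact pow_le_pow_left₀ (abs_nonneg _) h2 2
    rw [h1]
    nlinarith [sq_nonneg (D i x + ((Z i x - s i x) - avg n fun i => Z i x - s i x))]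
  refine ⟨r, hrc, fun i x => ?_, ?_⟩
  · simp only [r, avg_sub]
    rw [show meanHat n gh x = avg n fun i => gh i x from rfl]
    ring
  · have hrint : ∀ i < n, ∫ x in (0 : ℝ)..1, r i x ^ 2
        ≤ 2 * (normConst p + 1) * (b i + avg n b) ^ 2 := by
      intro i hi
      have hDc : ContinuousOn (fun x => D i x ^ 2) (Icc 0 1) :=
        (IsSpline.continuousOn hp (hD i hi).1).pow 2
      refine (integral_mono_Icc (g := fun x => 2 * D i x ^ 2 + 2 * (b i + avg n b) ^ 2)
        (continuousOn_sq (hrc i hi)) ((continuousOn_const_mul 2 hDc).add continuousOn_const)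
        (hrD i hi)).trans ?_
      have hDi := intervalIntegrable_of_continuousOn hDc (x := 0) (y := 1) (by simp) (by simp)
      rw [intervalIntegral.integral_add (hDi.const_mul 2) intervalIntegrable_const,
        intervalIntegral.integral_const_mul]
      simp only [intervalIntegral.integral_const, sub_zero, one_smul]
      linarith [hDint i hi]
    have hbsq : ∀ i < n, b i ^ 2
        ≤ 2 * ρ ^ 2 * ((∑' k, a k) * (∑' k, a k * ξ i k ^ 2) + 1) := by
      intro i hi
      have h1 := tsum_mul_abs_sq_le ha ha0 (hξ i hi)
      simp only [hb, mul_pow]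
      have h2 : ((∑' k, a k * |ξ i k|) + 1) ^ 2
          ≤ 2 * ((∑' k, a k) * (∑' k, a k * ξ i k ^ 2) + 1) := by
        nlinarith [sq_nonneg ((∑' k, a k * |ξ i k|) - 1)]
      nlinarith [sq_nonneg ρ]
    have h1 := avg_mono hrint
    have h2 := avg_mono hbsq
    rw [avg_const_mul] at h1
    rw [avg_const_mul, avg_add, avg_const_mul, avg_const hn] at h2
    have h3 := avg_add_avg_sq_le hn b
    calc _ ≤ _ := h1
      _ ≤ 2 * (normConst p + 1) * (4 * avg n fun i => b i ^ 2) := by gcongr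
      _ ≤ 2 * (normConst p + 1) * (4 * (2 * ρ ^ 2 * ((∑' k, a k) *
          (avg n fun i => ∑' k, a k * ξ i k ^ 2) + 1))) := by gcongr
      _ = _ := by ring

/-- The error of the spline covariance estimator, for fixed data. -/
theorem ofReal_abs_lagCov_sub_le (hp : 2 ≤ p) (hN : 2 * p * (J + 1) ≤ N) (hn : 0 < n)
    (hρ : 0 < ρ) (hρ1 : ρ ≤ 1) (ha : Summable a) (ha0 : ∀ k, 0 ≤ a k)
    (hφc : ∀ k, ContinuousOn (φ k) (Icc 0 1)) (hφ : ∀ k, ∀ x ∈ Icc (0 : ℝ) 1, |φ k x| ≤ a k)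
    (hφs : ∀ k, ∃ s, IsSpline p J s ∧ ∀ x ∈ Icc (0 : ℝ) 1, |φ k x - s x| ≤ ρ * a k)
    (hξ : ∀ i < n, Summable fun k => a k * ξ i k ^ 2)
    (hy : ∀ i < n, ∀ j < N, y i j = mN j + scoreSeries φ (ξ i) (gridPt N j) + e i j)
    (hgh : ∀ i < n, (y i, gh i) ∈ normalFits p J N)
    (hG : ∀ i < n, (e i, G i) ∈ normalFits p J N)
    {s : ℝ} (hs : 0 < s) {h h₀ : ℝ} (hh : h ∈ Icc 0 h₀) (hh₀ : h₀ < 1) :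
    ENNReal.ofReal |lagCov n (fun i x => gh i x - meanHat n gh x) h
        - lagCov n (fun i => scoreSeries φ (ξ i)) h|
      ≤ ENNReal.ofReal (2 / (1 - h₀)) *
        (ENNReal.ofReal (50 * (normConst p + 1) * ((∑' k, a k) + 1) *
          ((∑' k, a k * (avg n fun i => ξ i k) ^ 2)
            + ρ * (1 + avg n fun i => ∑' k, a k * ξ i k ^ 2)
            + avg n fun i => ∫ x in (0 : ℝ)..1, G i x ^ 2))
        + ∑' k, ENNReal.ofReal (a k * (s + (∫ x in (0 : ℝ)..1,
            (avg n fun i => ξ i k * G i x) ^ 2) / s))) := by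
  obtain ⟨r, hrc, hdec, hr⟩ := exists_fit_residual hp hN hn hρ ha ha0 hφc hφ hφs hξ hy hgh hG
  have hS : ∀ i < n, Summable fun k => a k * |ξ i k| := fun i hi =>
    summable_mul_abs ha ha0 (hξ i hi)
  set Z : ℕ → ℝ → ℝ := fun i => scoreSeries φ (ξ i) with hZ
  have hZc : ∀ i < n, ContinuousOn (Z i) (Icc 0 1) := fun i hi =>
    continuousOn_scoreSeries hφ hφc (hS i hi)
  have hGc : ∀ i < n, ContinuousOn (G i) (Icc 0 1) := fun i hi =>
    IsSpline.continuousOn hp (hG i hi).1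
  have hghc : ∀ i < n, ContinuousOn (gh i) (Icc 0 1) := fun i hi =>
    IsSpline.continuousOn hp (hgh i hi).1
  have hh1 : 0 < 1 - h := by linarith [hh.2]
  have hh01 : 0 < 1 - h₀ := by linarith
  set α := ∑' k, a k with hα
  have hα0 : 0 ≤ α := tsum_nonneg ha0
  set W : ℕ → ℝ → ℝ := fun k x => avg n fun i => ξ i k * G i x with hW
  have hWc : ∀ k, ContinuousOn (W k) (Icc 0 1) := fun k =>
    continuousOn_avg fun i hi => continuousOn_const.mul (hGc i hi)
  -- the dominating function
  let f : ℝ → ℝ := fun x => (avg n fun i => ρ * Z i x ^ 2 + 3 / ρ * r i x ^ 2 + 5 * G i x ^ 2)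
    + 4 * (avg n fun i => Z i x) ^ 2
  -- Through `|W| ≤ s + W ^ 2 / s` the first moment of `W k` is traded for its second. The free
  -- parameter `s` will be taken of the order of the root mean square of `W k`.
  let w : ℕ → ℝ → ℝ := fun k x => a k * (s + W k x ^ 2 / s)
  let F : ℝ → ℝ≥0∞ := fun x => ENNReal.ofReal (f x) + ∑' k, ENNReal.ofReal (w k x)
  have hf1c : ∀ i < n, ContinuousOn (fun x => ρ * Z i x ^ 2 + 3 / ρ * r i x ^ 2 + 5 * G i x ^ 2)
      (Icc 0 1) := fun i hi => ((continuousOn_const.mul ((hZc i hi).pow 2)).add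
        (continuousOn_const.mul ((hrc i hi).pow 2))).add
        (continuousOn_const.mul ((hGc i hi).pow 2))
  have hZbc : ContinuousOn (fun x => avg n fun i => Z i x) (Icc 0 1) := continuousOn_avg hZc
  have hfc : ContinuousOn f (Icc 0 1) :=
    (continuousOn_avg hf1c).add (continuousOn_const.mul (hZbc.pow 2))
  have hf0 : ∀ x, 0 ≤ f x := fun x =>
    add_nonneg (avg_nonneg fun i _ => by positivity) (by positivity)
  have hwc : ∀ k, ContinuousOn (w k) (Icc 0 1) := fun k =>
    continuousOn_const.mul (continuousOn_const.add (((hWc k).pow 2).div_const s))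
  have hw0 : ∀ k x, 0 ≤ w k x := fun k x => mul_nonneg (ha0 k) (by positivity)
  have hmeasw : ∀ k, AEMeasurable (fun x => ENNReal.ofReal (w k x)) (volume.restrict (Icc 0 1)) :=
    fun k => ((hwc k).aemeasurable measurableSet_Icc).ennreal_ofReal
  have hmeasf : AEMeasurable (fun x => ENNReal.ofReal (f x)) (volume.restrict (Icc 0 1)) :=
    (hfc.aemeasurable measurableSet_Icc).ennreal_ofReal
  have hFm : AEMeasurable F (volume.restrict (Icc 0 1)) :=
    hmeasf.add (AEMeasurable.tsum hmeasw)
  -- the cross terms of the trajectories and the noise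
  have hcross : ∀ x ∈ Icc (0 : ℝ) 1, ∀ x' ∈ Icc (0 : ℝ) 1,
      ENNReal.ofReal |avg n fun i => Z i x * G i x'| ≤ ∑' k, ENNReal.ofReal (w k x') := by
    intro x hx x' hx'
    have h1 := scoreSeries_avg hφ hS hx fun i => G i x'
    rw [← h1.tsum_eq, ← Real.enorm_eq_ofReal_abs]
    refine enorm_tsum_le_tsum_enorm.trans (ENNReal.tsum_le_tsum fun k => ?_)
    rw [Real.enorm_eq_ofReal_abs]
    refine ENNReal.ofReal_le_ofReal ?_
    change |φ k x * W k x'| ≤ a k * (s + W k x' ^ 2 / s)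
    rw [abs_mul]
    have h2 : |W k x'| ≤ s + W k x' ^ 2 / s := by
      have h3 : s + W k x' ^ 2 / s - |W k x'| = ((s - |W k x'|) ^ 2 + s * |W k x'|) / s := by
        rw [← sq_abs (W k x')]
        field_simp
        ring
      have h4 : 0 ≤ ((s - |W k x'|) ^ 2 + s * |W k x'|) / s := by positivity
      linarith
    exact mul_le_mul (hφ k x hx) h2 (abs_nonneg _) (ha0 k)
  let Ψ : ℝ → ℝ := fun x => avg n (fun i => (gh i x - meanHat n gh x)
    * (gh i (x + h) - meanHat n gh (x + h))) - avg n fun i => Z i x * Z i (x + h)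
  have hΨ : ∀ x ∈ Icc (0 : ℝ) (1 - h), ENNReal.ofReal |Ψ x| ≤ F x + F (x + h) := by
    intro x hx
    have hx1 : x ∈ Icc (0 : ℝ) 1 := ⟨hx.1, by linarith [hx.2, hh.1]⟩
    have hx2 : x + h ∈ Icc (0 : ℝ) 1 := ⟨by linarith [hx.1, hh.1], by linarith [hx.2]⟩
    have h1 := abs_avg_mul_sub_le hn hρ hρ1 (fun i (_ : i < n) => hdec i x)
      (fun i (_ : i < n) => hdec i (x + h))
    refine (ENNReal.ofReal_le_ofReal h1).trans ?_
    rw [ENNReal.ofReal_add (by have := hf0 x; positivity) (hf0 (x + h)),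
      ENNReal.ofReal_add (by positivity) (hf0 x),
      ENNReal.ofReal_add (abs_nonneg _) (abs_nonneg _)]
    have h2 := hcross x hx1 (x + h) hx2
    have h3 := hcross (x + h) hx2 x hx1
    calc _ ≤ (∑' k, ENNReal.ofReal (w k (x + h)) + ∑' k, ENNReal.ofReal (w k x))
          + ENNReal.ofReal (f x) + ENNReal.ofReal (f (x + h)) := by gcongr
      _ = F x + F (x + h) := by simp only [F]; ring
  have hIcc : ∀ {g : ℝ → ℝ}, ContinuousOn g (Icc 0 1) →
      ContinuousOn (fun x => g (x + h)) (Icc 0 (1 - h)) := fun hg =>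
    hg.comp (by fun_prop) fun x hx =>
      ⟨by linarith [hx.1, hh.1], by linarith [hx.2]⟩
  have hsub : Icc 0 (1 - h) ⊆ Icc (0 : ℝ) 1 := Icc_subset_Icc_right (by linarith [hh.1])
  have hprodint : ∀ g : ℕ → ℝ → ℝ, (∀ i < n, ContinuousOn (g i) (Icc 0 1)) →
      IntervalIntegrable (fun x => avg n fun i => g i x * g i (x + h)) volume 0 (1 - h) := by
    intro g hg
    refine ContinuousOn.intervalIntegrable ?_
    rw [uIcc_of_le hh1.le]
    exact continuousOn_avg fun i hi => ((hg i hi).mono hsub).mul (hIcc (hg i hi))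
  have hlag : lagCov n (fun i x => gh i x - meanHat n gh x) h - lagCov n Z h
      = 1 / (1 - h) * ∫ x in (0 : ℝ)..(1 - h), Ψ x := by
    rw [show lagCov n (fun i x => gh i x - meanHat n gh x) h = 1 / (1 - h) *
      ∫ x in (0 : ℝ)..(1 - h), avg n fun i => (gh i x - meanHat n gh x)
        * (gh i (x + h) - meanHat n gh (x + h)) from rfl,
      show lagCov n Z h = 1 / (1 - h) * ∫ x in (0 : ℝ)..(1 - h), avg n fun i =>
        Z i x * Z i (x + h) from rfl, ← mul_sub, ← intervalIntegral.integral_sub]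
    · exact hprodint (fun i x => gh i x - meanHat n gh x)
        fun i hi => (hghc i hi).sub (continuousOn_avg hghc)
    · exact hprodint Z hZc
  have hFint : ∫⁻ x in Icc 0 1, F x = ENNReal.ofReal (∫ x in (0 : ℝ)..1, f x)
      + ∑' k, ENNReal.ofReal (a k * (s + (∫ x in (0 : ℝ)..1, W k x ^ 2) / s)) := by
    rw [lintegral_add_left' hmeasf, lintegral_tsum hmeasw,
      lintegral_ofReal_continuousOn hfc fun x _ => hf0 x]
    congr 1
    refine tsum_congr fun k => ?_
    rw [lintegral_ofReal_continuousOn (hwc k) fun x _ => hw0 k x]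
    have h1 := intervalIntegrable_of_continuousOn (continuousOn_sq (hWc k)) (x := 0) (y := 1)
      (by simp)
      (by simp)
    simp only [w]
    rw [intervalIntegral.integral_const_mul, intervalIntegral.integral_add intervalIntegrable_const
      (h1.div_const s), intervalIntegral.integral_div]
    simp
  have hfint : ∫ x in (0 : ℝ)..1, f x ≤ 50 * (normConst p + 1) * (α + 1) *
          ((∑' k, a k * (avg n fun i => ξ i k) ^ 2)
            + ρ * (1 + avg n fun i => ∑' k, a k * ξ i k ^ 2)
            + avg n fun i => ∫ x in (0 : ℝ)..1, G i x ^ 2) := by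
    have hii : ∀ {g : ℝ → ℝ}, ContinuousOn g (Icc 0 1) → IntervalIntegrable g volume 0 1 :=
      fun hg => intervalIntegrable_of_continuousOn hg (by simp) (by simp)
    have h1 : ∫ x in (0 : ℝ)..1, f x = (avg n fun i => ρ * (∫ x in (0 : ℝ)..1, Z i x ^ 2)
        + 3 / ρ * (∫ x in (0 : ℝ)..1, r i x ^ 2) + 5 * (∫ x in (0 : ℝ)..1, G i x ^ 2))
        + 4 * ∫ x in (0 : ℝ)..1, (avg n fun i => Z i x) ^ 2 := by
      simp only [f]
      rw [intervalIntegral.integral_add (hii (continuousOn_avg hf1c))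
        (hii (continuousOn_const_mul 4 (continuousOn_sq hZbc))),
        intervalIntegral.integral_const_mul,
        integral_avg hf1c]
      congr 1
      refine avg_congr fun i hi => ?_
      have e1 := hii (continuousOn_sq (hZc i hi))
      have e2 := hii (continuousOn_sq (hrc i hi))
      have e3 := hii (continuousOn_sq (hGc i hi))
      rw [intervalIntegral.integral_add ((e1.const_mul ρ).add (e2.const_mul _)) (e3.const_mul 5),
        intervalIntegral.integral_add (e1.const_mul ρ) (e2.const_mul _),
        intervalIntegral.integral_const_mul, intervalIntegral.integral_const_mul,
        intervalIntegral.integral_const_mul]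
    have hsq : ∀ c : ℕ → ℝ, Summable (fun k => a k * c k ^ 2) →
        ∫ x in (0 : ℝ)..1, scoreSeries φ c x ^ 2 ≤ α * ∑' k, a k * c k ^ 2 := by
      intro c hc
      have hcs := summable_mul_abs ha ha0 hc
      have h2 := integral_mono_Icc ((continuousOn_scoreSeries hφ hφc hcs).pow 2)
        (continuousOn_const (c := α * ∑' k, a k * c k ^ 2)) fun x hx => by
          rw [Pi.pow_apply, ← sq_abs]
          exact (pow_le_pow_left₀ (abs_nonneg _) (abs_scoreSeries_le hφ hcs hx) 2).trans
            (tsum_mul_abs_sq_le ha ha0 hc)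
      simpa using h2
    have hbar : Summable fun k => a k * (avg n fun i => ξ i k) ^ 2 := by
      refine Summable.of_nonneg_of_le (fun k => mul_nonneg (ha0 k) (sq_nonneg _)) (fun k => ?_)
        (f := fun k => avg n fun i => a k * ξ i k ^ 2) ?_
      · rw [avg_const_mul]
        exact mul_le_mul_of_nonneg_left (avg_sq_le hn _) (ha0 k)
      · exact (summable_sum fun i hi => hξ i (Finset.mem_range.1 hi)).mul_left _
    have hZbar : ∀ x ∈ Icc (0 : ℝ) 1, (avg n fun i => Z i x)
        = scoreSeries φ (fun k => avg n fun i => ξ i k) x := by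
      intro x hx
      have h2 := (scoreSeries_avg hφ hS hx fun _ => 1).tsum_eq
      simp only [mul_one] at h2
      rw [← h2]
      exact tsum_congr fun k => mul_comm _ _
    have h2 : ∫ x in (0 : ℝ)..1, (avg n fun i => Z i x) ^ 2
        ≤ α * ∑' k, a k * (avg n fun i => ξ i k) ^ 2 := by
      refine le_trans (le_of_eq ?_) (hsq _ hbar)
      refine intervalIntegral.integral_congr fun x hx => ?_
      rw [uIcc_of_le zero_le_one] at hx
      simp only [hZbar x hx]
    have h3 : (avg n fun i => ∫ x in (0 : ℝ)..1, Z i x ^ 2)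
        ≤ α * avg n fun i => ∑' k, a k * ξ i k ^ 2 := by
      rw [← avg_const_mul]
      exact avg_mono fun i hi => hsq _ (hξ i hi)
    rw [h1, avg_add, avg_add, avg_const_mul, avg_const_mul, avg_const_mul]
    set Γ := avg n fun i => ∑' k, a k * ξ i k ^ 2
    set Γb := ∑' k, a k * (avg n fun i => ξ i k) ^ 2
    set I := avg n fun i => ∫ x in (0 : ℝ)..1, G i x ^ 2
    have hΓ0 : 0 ≤ Γ := avg_nonneg fun i _ => tsum_nonneg fun k => mul_nonneg (ha0 k) (sq_nonneg _)
    have hΓb0 : 0 ≤ Γb := tsum_nonneg fun k => mul_nonneg (ha0 k) (sq_nonneg _)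
    have hI0 : 0 ≤ I := avg_nonneg fun i _ =>
      intervalIntegral.integral_nonneg zero_le_one fun x _ => sq_nonneg _
    have hc := normConst_nonneg p
    have h4 : 3 / ρ * (avg n fun i => ∫ x in (0 : ℝ)..1, r i x ^ 2)
        ≤ 48 * (normConst p + 1) * ρ * (α * Γ + 1) := by
      refine (mul_le_mul_of_nonneg_left hr (by positivity)).trans_eq ?_
      field_simp
      ring
    have h5 : ρ * (avg n fun i => ∫ x in (0 : ℝ)..1, Z i x ^ 2) ≤ ρ * (α * Γ) :=
      mul_le_mul_of_nonneg_left h3 hρ.le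
    set c := normConst p
    have p1 : 0 ≤ c * α := by positivity
    have p2 : 0 ≤ ρ * Γ := by positivity
    have q1 : 5 * I ≤ 50 * (c + 1) * (α + 1) * I := by
      refine mul_le_mul_of_nonneg_right ?_ hI0
      linarith
    have q2 : 4 * (α * Γb) ≤ 50 * (c + 1) * (α + 1) * Γb := by
      rw [← mul_assoc]
      refine mul_le_mul_of_nonneg_right ?_ hΓb0
      linarith
    have q3 : ρ * (α * Γ) + 48 * (c + 1) * ρ * (α * Γ + 1)
        ≤ 50 * (c + 1) * (α + 1) * (ρ * (1 + Γ)) := by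
      have e1 : 0 ≤ c * α * ρ := by positivity
      have e2 : 0 ≤ c * ρ := by positivity
      have e3 : 0 ≤ α * ρ := by positivity
      have e4 : 0 ≤ c * α * (ρ * Γ) := by positivity
      have e5 : 0 ≤ c * (ρ * Γ) := by positivity
      have e6 : 0 ≤ α * (ρ * Γ) := by positivity
      linarith
    linarith
  rw [hlag, abs_mul, abs_of_pos (by positivity), ENNReal.ofReal_mul (by positivity)]
  have hI := ofReal_abs_integral_shift_le hh.1 (by linarith) hFm hΨ
  rw [hFint] at hI
  have h1 : ENNReal.ofReal (1 / (1 - h)) ≤ ENNReal.ofReal (1 / (1 - h₀)) :=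
    ENNReal.ofReal_le_ofReal (one_div_le_one_div_of_le hh01 (by linarith [hh.2]))
  have h2 : ENNReal.ofReal (2 / (1 - h₀)) = ENNReal.ofReal (1 / (1 - h₀)) * 2 := by
    rw [show 2 / (1 - h₀) = 1 / (1 - h₀) * 2 by ring, ENNReal.ofReal_mul (by positivity)]
    simp
  rw [h2, mul_assoc]
  refine mul_le_mul' h1 (hI.trans ?_)
  gcongr

end Deterministic

/-! ### Second moments -/

section Moments

variable {Ω : Type*} [MeasurableSpace Ω] {P : Measure Ω}

/-- The second moment of a linear combination of an orthonormal family. -/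
lemma lintegral_sq_sum_of_orthonormal {ι : Type*} [DecidableEq ι] (s : Finset ι) (v : ι → ℝ)
    (y : ι → Ω → ℝ) (hint : ∀ i ∈ s, ∀ j ∈ s, Integrable (fun ω => y i ω * y j ω) P)
    (horth : ∀ i ∈ s, ∀ j ∈ s, ∫ ω, y i ω * y j ω ∂P = if i = j then 1 else 0) :
    ∫⁻ ω, ENNReal.ofReal ((∑ i ∈ s, v i * y i ω) ^ 2) ∂P
      = ENNReal.ofReal (∑ i ∈ s, v i ^ 2) := by
  have hexp : ∀ ω, (∑ i ∈ s, v i * y i ω) ^ 2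
      = ∑ i ∈ s, ∑ j ∈ s, v i * v j * (y i ω * y j ω) := fun ω => by
    rw [sq, Finset.sum_mul_sum]
    refine Finset.sum_congr rfl fun i _ => Finset.sum_congr rfl fun j _ => ?_
    ring
  simp only [hexp]
  have hi : ∀ i ∈ s, Integrable (fun ω => ∑ j ∈ s, v i * v j * (y i ω * y j ω)) P := fun i hi =>
    integrable_finsetSum _ fun j hj => (hint i hi j hj).const_mul _
  rw [← ofReal_integral_eq_lintegral_ofReal (integrable_finsetSum _ hi)
    (ae_of_all _ fun ω => by simp only [← hexp]; exact sq_nonneg _), integral_finsetSum _ hi]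
  congr 1
  refine Finset.sum_congr rfl fun i hi => ?_
  rw [integral_finsetSum _ fun j hj => (hint i hi j hj).const_mul _,
    Finset.sum_eq_single_of_mem i hi fun j hj hne => ?_]
  · rw [integral_const_mul, horth i hi i hi, if_pos rfl]
    ring
  · rw [integral_const_mul, horth i hi j hj, if_neg hne.symm, mul_zero]

/-- A first moment bound uniform in the point `a` suffices for Fubini, because `ν` is finite. -/
lemma integrable_prod_of_integral_norm_le {α : Type*} [MeasurableSpace α] {ν : Measure α}
    [IsFiniteMeasure ν] [SFinite P] {H : α × Ω → ℝ} (hm : AEStronglyMeasurable H (ν.prod P))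
    (h1 : ∀ a, Integrable (fun ω => H (a, ω)) P) {B : ℝ} (h2 : ∀ a, ∫ ω, ‖H (a, ω)‖ ∂P ≤ B) :
    Integrable H (ν.prod P) := by
  refine (integrable_prod_iff hm).2 ⟨ae_of_all _ h1, ?_⟩
  refine (integrable_const B).mono' hm.norm.integral_prod_right' (ae_of_all _ fun a => ?_)
  rw [Real.norm_eq_abs, abs_of_nonneg (integral_nonneg fun _ => norm_nonneg _)]
  exact h2 a

end Moments

/-! ### The trajectories as functions on the line -/

/-- The projection of the line onto `[0,1]`. -/
def clamp (x : ℝ) : ℝ := projIcc (0 : ℝ) 1 zero_le_one x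

lemma clamp_mem (x : ℝ) : clamp x ∈ Icc (0 : ℝ) 1 := (projIcc (0 : ℝ) 1 zero_le_one x).2

lemma clamp_of_mem {x : ℝ} (hx : x ∈ Icc (0 : ℝ) 1) : clamp x = x := by
  rw [clamp, projIcc_of_mem _ hx]

lemma continuous_clamp : Continuous clamp := continuous_subtype_val.comp continuous_projIcc

/-- The Lebesgue measure on `[0,1]`. -/
def unitMeasure : Measure ℝ := volume.restrict (Icc 0 1)

instance : IsFiniteMeasure unitMeasure := by unfold unitMeasure; infer_instance

lemma integral_unitMeasure (f : ℝ → ℝ) : ∫ x, f x ∂unitMeasure = ∫ x in (0 : ℝ)..1, f x := by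
  rw [intervalIntegral.integral_of_le zero_le_one, ← integral_Icc_eq_integral_Ioc, unitMeasure]

section Trajectories

variable {Ω : Type*} [MeasurableSpace Ω] {P : Measure Ω}
  {η : ℕ → ℝ → Ω → ℝ} {m C : ℝ → ℝ} {lam : ℕ → ℝ} {psi : ℕ → ℝ → ℝ} {ξ ε : ℕ → ℕ → Ω → ℝ}

/-- The centered trajectory, extended by constants beyond `[0,1]`. -/
def centered (η : ℕ → ℝ → Ω → ℝ) (m : ℝ → ℝ) (i : ℕ) (x : ℝ) (ω : Ω) : ℝ :=
  η i (clamp x) ω - m (clamp x)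

lemma measurable_centered (hη : IsStationarySample P η m C) (hm : ContinuousOn m (Icc 0 1))
    (i : ℕ) : Measurable fun z : ℝ × Ω => centered η m i z.1 z.2 := by
  have h1 : Measurable fun z : ℝ × Ω => η i (clamp z.1) z.2 :=
    (hη.measurable i).comp
      (((continuous_projIcc (h := zero_le_one)).measurable.comp measurable_fst).prodMk
        measurable_snd)
  have h2 : Continuous fun x => m (clamp x) := hm.comp_continuous continuous_clamp clamp_mem
  exact h1.sub (h2.measurable.comp measurable_fst)

lemma memLp_centered [IsProbabilityMeasure P] (hη : IsStationarySample P η m C) (i : ℕ) (x : ℝ) :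
    MemLp (centered η m i x) 2 P :=
  (hη.memLp i _ (clamp_mem x)).sub (memLp_const _)

lemma integral_centered_mul (hη : IsStationarySample P η m C) (i : ℕ) (x y : ℝ) :
    ∫ ω, centered η m i x ω * centered η m i y ω ∂P = C |clamp x - clamp y| := by
  rw [← hη.cov i _ (clamp_mem x) _ (clamp_mem y), covariance, hη.mean i _ (clamp_mem x),
    hη.mean i _ (clamp_mem y)]
  rfl

/-- AM-GM and stationarity: the bound `C 0` is the same for all points, as the Fubini arguments
below require. -/
lemma integral_norm_centered_mul_le [IsProbabilityMeasure P]
    (hη : IsStationarySample P η m C) (i l : ℕ) (x y : ℝ) :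
    ∫ ω, ‖centered η m i x ω * centered η m l y ω‖ ∂P ≤ C 0 := by
  have h1 := integral_centered_mul hη i x x
  have h2 := integral_centered_mul hη l y y
  rw [sub_self, abs_zero] at h1 h2
  have i1 : Integrable (fun ω => centered η m i x ω * centered η m i x ω) P :=
    (memLp_centered hη i x).integrable_mul (memLp_centered hη i x)
  have i2 : Integrable (fun ω => centered η m l y ω * centered η m l y ω) P :=
    (memLp_centered hη l y).integrable_mul (memLp_centered hη l y)
  have h3 : ∫ ω, ‖centered η m i x ω * centered η m l y ω‖ ∂P
      ≤ ∫ ω, (1 / 2 * (centered η m i x ω * centered η m i x ω)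
        + 1 / 2 * (centered η m l y ω * centered η m l y ω)) ∂P := by
    refine integral_mono ((memLp_centered hη i x).integrable_mul (memLp_centered hη l y)).norm
      ((i1.const_mul _).add (i2.const_mul _)) fun ω => ?_
    simp only [Real.norm_eq_abs, abs_mul]
    nlinarith [sq_nonneg (|centered η m i x ω| - |centered η m l y ω|),
      sq_abs (centered η m i x ω), sq_abs (centered η m l y ω)]
  refine h3.trans_eq ?_
  rw [integral_add (i1.const_mul (1 / 2)) (i2.const_mul (1 / 2)), integral_const_mul,
    integral_const_mul, h1, h2]
  ring

/-- The integral of a trajectory against a function. -/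
def trajCoeff (η : ℕ → ℝ → Ω → ℝ) (m f : ℝ → ℝ) (i : ℕ) (ω : Ω) : ℝ :=
  ∫ x, centered η m i x ω * f (clamp x) ∂unitMeasure

lemma trajCoeff_eq {Ω : Type*} {η : ℕ → ℝ → Ω → ℝ} (f : ℝ → ℝ) (i : ℕ) (ω : Ω) :
    trajCoeff η m f i ω = ∫ x in (0 : ℝ)..1, (η i x ω - m x) * f x := by
  rw [trajCoeff, integral_unitMeasure]
  refine intervalIntegral.integral_congr fun x hx => ?_
  rw [uIcc_of_le zero_le_one] at hx
  simp only [centered, clamp_of_mem hx]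

/-- Factors that are independent of the trajectories split off from second moments. -/
lemma integral_trajCoeff_mul [IsProbabilityMeasure P]
    (hη : IsStationarySample P η m C) (hm : ContinuousOn m (Icc 0 1))
    {f : ℝ → ℝ} (hf : ContinuousOn f (Icc 0 1)) {V : Ω → ℝ} (hV : Integrable V P) (i l : ℕ)
    (hind : ∀ x y, IndepFun (fun ω => centered η m i x ω * centered η m l y ω) V P) :
    Integrable (fun ω => trajCoeff η m f i ω * trajCoeff η m f l ω * V ω) P ∧
      ∫ ω, trajCoeff η m f i ω * trajCoeff η m f l ω * V ω ∂P
        = (∫ z : ℝ × ℝ, (∫ ω, centered η m i z.1 ω * centered η m l z.2 ω ∂P)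
            * (f (clamp z.1) * f (clamp z.2)) ∂(unitMeasure.prod unitMeasure)) * ∫ ω, V ω ∂P := by
  have hfc : Continuous fun x => f (clamp x) := hf.comp_continuous continuous_clamp clamp_mem
  obtain ⟨B, hB⟩ := isCompact_Icc.exists_bound_of_continuousOn hf
  -- Independence is available for the values of the trajectories at fixed points. The product of
  -- two integrals is therefore written as a double integral over points, and the factorization is
  -- made under it.
  let H : (ℝ × ℝ) × Ω → ℝ := fun z =>
    centered η m i z.1.1 z.2 * centered η m l z.1.2 z.2 * V z.2
      * (f (clamp z.1.1) * f (clamp z.1.2))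
  have hmeas : AEStronglyMeasurable H ((unitMeasure.prod unitMeasure).prod P) := by
    have h1 : Measurable fun z : (ℝ × ℝ) × Ω => centered η m i z.1.1 z.2 :=
      (measurable_centered hη hm i).comp (measurable_fst.fst.prodMk measurable_snd)
    have h2 : Measurable fun z : (ℝ × ℝ) × Ω => centered η m l z.1.2 z.2 :=
      (measurable_centered hη hm l).comp (measurable_fst.snd.prodMk measurable_snd)
    have h3 : Measurable fun z : (ℝ × ℝ) × Ω => f (clamp z.1.1) * f (clamp z.1.2) :=
      (hfc.measurable.comp measurable_fst.fst).mul (hfc.measurable.comp measurable_fst.snd)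
    exact ((h1.mul h2).aestronglyMeasurable.mul hV.aestronglyMeasurable.comp_snd).mul
      h3.aestronglyMeasurable
  have hprod : ∀ x y, Integrable (fun ω => centered η m i x ω * centered η m l y ω) P :=
    fun x y => (memLp_centered hη i x).integrable_mul (memLp_centered hη l y)
  have hint : ∀ z : ℝ × ℝ, Integrable (fun ω =>
      centered η m i z.1 ω * centered η m l z.2 ω * V ω) P := fun z =>
    (hind z.1 z.2).integrable_mul (hprod z.1 z.2) hV
  have hBf : ∀ x, |f (clamp x)| ≤ B := fun x => hB _ (clamp_mem x)
  have hH : Integrable H ((unitMeasure.prod unitMeasure).prod P) := by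
    refine integrable_prod_of_integral_norm_le (B := C 0 * (∫ ω, ‖V ω‖ ∂P) * (B * B)) hmeas
      (fun z => (hint z).mul_const (f (clamp z.1) * f (clamp z.2))) fun z => ?_
    simp only [H, norm_mul _ (f (clamp z.1) * f (clamp z.2))]
    rw [integral_mul_const]
    have h1 : ∫ ω, ‖centered η m i z.1 ω * centered η m l z.2 ω * V ω‖ ∂P
        = (∫ ω, ‖centered η m i z.1 ω * centered η m l z.2 ω‖ ∂P) * ∫ ω, ‖V ω‖ ∂P := by
      simp only [norm_mul _ (V _)]
      exact ((hind z.1 z.2).comp measurable_norm measurable_norm).integral_fun_mul_eq_mul_integral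
        (hprod z.1 z.2).norm.aestronglyMeasurable hV.norm.aestronglyMeasurable
    rw [h1]
    have hB0 : 0 ≤ B := (abs_nonneg _).trans (hBf 0)
    have hV0 : 0 ≤ ∫ ω, ‖V ω‖ ∂P := integral_nonneg fun _ => norm_nonneg _
    have h2 := integral_norm_centered_mul_le hη i l z.1 z.2
    have h3 : ‖f (clamp z.1) * f (clamp z.2)‖ ≤ B * B := by
      rw [norm_mul]
      exact mul_le_mul (hBf _) (hBf _) (norm_nonneg _) hB0
    have h4 : 0 ≤ ∫ ω, ‖centered η m i z.1 ω * centered η m l z.2 ω‖ ∂P :=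
      integral_nonneg fun _ => norm_nonneg _
    exact mul_le_mul (mul_le_mul_of_nonneg_right h2 hV0) h3 (norm_nonneg _)
      (mul_nonneg (h4.trans h2) hV0)
  have hcoeff : ∀ ω, trajCoeff η m f i ω * trajCoeff η m f l ω * V ω
      = ∫ z, H (z, ω) ∂(unitMeasure.prod unitMeasure) := by
    intro ω
    rw [trajCoeff, trajCoeff, ← integral_prod_mul, ← integral_mul_const]
    refine integral_congr_ae (ae_of_all _ fun z => ?_)
    simp only [H]
    ring
  simp only [hcoeff]
  refine ⟨hH.integral_prod_right, ?_⟩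
  rw [← integral_integral_swap hH, ← integral_mul_const]
  refine integral_congr_ae (ae_of_all _ fun z => ?_)
  simp only [H]
  rw [integral_mul_const, (hind z.1 z.2).integral_fun_mul_eq_mul_integral
    (hprod z.1 z.2).aestronglyMeasurable hV.aestronglyMeasurable]
  ring

/-- The covariance of a trajectory and its integral against a function. -/
lemma integral_centered_mul_trajCoeff [IsProbabilityMeasure P] (hη : IsStationarySample P η m C)
    (hm : ContinuousOn m (Icc 0 1)) {f : ℝ → ℝ} (hf : ContinuousOn f (Icc 0 1)) (i : ℕ)
    {x : ℝ} (hx : x ∈ Icc (0 : ℝ) 1) :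
    ∫ ω, centered η m i x ω * trajCoeff η m f i ω ∂P = ∫ y in (0 : ℝ)..1, C |x - y| * f y := by
  have hfc : Continuous fun x => f (clamp x) := hf.comp_continuous continuous_clamp clamp_mem
  obtain ⟨B, hB⟩ := isCompact_Icc.exists_bound_of_continuousOn hf
  have hBf : ∀ x, |f (clamp x)| ≤ B := fun x => hB _ (clamp_mem x)
  let H : ℝ × Ω → ℝ := fun z =>
    centered η m i x z.2 * centered η m i z.1 z.2 * f (clamp z.1)
  have hmeas : AEStronglyMeasurable H (unitMeasure.prod P) := by
    have h1 : Measurable fun z : ℝ × Ω => centered η m i x z.2 :=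
      (measurable_centered hη hm i).comp (measurable_const.prodMk measurable_snd)
    exact ((h1.mul (measurable_centered hη hm i)).mul
      (hfc.measurable.comp measurable_fst)).aestronglyMeasurable
  have hprod : ∀ y, Integrable (fun ω => centered η m i x ω * centered η m i y ω) P :=
    fun y => (memLp_centered hη i x).integrable_mul (memLp_centered hη i y)
  have hH : Integrable H (unitMeasure.prod P) := by
    refine integrable_prod_of_integral_norm_le (B := C 0 * B) hmeas
      (fun z => (hprod z).mul_const (f (clamp z))) fun z => ?_
    simp only [H, norm_mul _ (f (clamp z))]
    rw [integral_mul_const]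
    have h2 := integral_norm_centered_mul_le hη i i x z
    exact mul_le_mul h2 (hBf _) (norm_nonneg _)
      ((integral_nonneg fun _ => norm_nonneg _).trans h2)
  have hcoeff : ∀ ω, centered η m i x ω * trajCoeff η m f i ω
      = ∫ z, H (z, ω) ∂unitMeasure := by
    intro ω
    rw [trajCoeff, ← integral_const_mul]
    refine integral_congr_ae (ae_of_all _ fun z => ?_)
    simp only [H]
    ring
  simp only [hcoeff]
  rw [← integral_integral_swap hH, integral_unitMeasure]
  refine intervalIntegral.integral_congr fun y hy => ?_
  rw [uIcc_of_le zero_le_one] at hy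
  simp only [H]
  rw [integral_mul_const, integral_centered_mul hη, clamp_of_mem hx, clamp_of_mem hy]

end Trajectories

section Scores

variable {Ω : Type*} [MeasurableSpace Ω] {P : Measure Ω}
  {η : ℕ → ℝ → Ω → ℝ} {m C : ℝ → ℝ} {lam : ℕ → ℝ} {psi : ℕ → ℝ → ℝ} {ξ ε : ℕ → ℕ → Ω → ℝ}

/-! ### Moments of the scores and of the errors -/

/-- Distinct trajectories have independent scores of mean zero. -/
lemma integral_score_mul (hξ : IsScores P η m lam psi ξ) (i l k : ℕ) :
    ∫ ω, ξ i k ω * ξ l k ω ∂P = if i = l then 1 else 0 := by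
  split_ifs with h
  · subst h
    simpa using hξ.cov i k k
  · have hind : IndepFun (ξ i k) (ξ l k) P :=
      (hξ.indep.indepFun h).comp (measurable_pi_apply k) (measurable_pi_apply k)
    rw [hind.integral_fun_mul_eq_mul_integral (hξ.memLp i k).aestronglyMeasurable
      (hξ.memLp l k).aestronglyMeasurable, hξ.mean, zero_mul]

lemma integral_noise_mul (hε : IsNoise P η ε) (z z' : ℕ × ℕ) :
    ∫ ω, ε z.1 z.2 ω * ε z'.1 z'.2 ω ∂P = if z = z' then 1 else 0 := by
  split_ifs with h
  · subst h
    rw [← hε.sq z.1 z.2]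
    simp only [sq]
  · rw [(hε.indep.indepFun h).integral_fun_mul_eq_mul_integral
      (hε.memLp _ _).aestronglyMeasurable (hε.memLp _ _).aestronglyMeasurable, hε.mean, zero_mul]

lemma trajCoeff_fpc_ae (hξ : IsScores P η m lam psi ξ) (i k : ℕ) :
    trajCoeff η m (fpc lam psi k) i =ᵐ[P] fun ω => lam k * ξ i k ω := by
  filter_upwards [hξ.integral_eq i k] with ω hω
  rw [trajCoeff_eq, hω]

lemma indepFun_centered_mul_noise (hε : IsNoise P η ε) (i l : ℕ) (z z' : ℕ × ℕ) (x y : ℝ) :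
    IndepFun (fun ω => centered η m i x ω * centered η m l y ω)
      (fun ω => ε z.1 z.2 ω * ε z'.1 z'.2 ω) P := by
  let f : (ℕ × ℕ → ℝ) → ℝ := fun e => e z * e z'
  let g : (ℕ × unitInterval → ℝ) → ℝ := fun t =>
    (t (i, projIcc (0 : ℝ) 1 zero_le_one x) - m (clamp x))
      * (t (l, projIcc (0 : ℝ) 1 zero_le_one y) - m (clamp y))
  have hf : Measurable f := (measurable_pi_apply z).mul (measurable_pi_apply z')
  have hg : Measurable g := ((measurable_pi_apply _).sub measurable_const).mul
    ((measurable_pi_apply _).sub measurable_const)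
  exact (hε.indep_traj.comp hf hg).symm

/-- The products of the scores and the errors are orthonormal. -/
lemma score_mul_noise_orthonormal [IsProbabilityMeasure P] (hη : IsStationarySample P η m C)
    (hξ : IsScores P η m lam psi ξ) (hε : IsNoise P η ε) (hm : ContinuousOn m (Icc 0 1)) {k : ℕ}
    (hφc : ContinuousOn (fpc lam psi k) (Icc 0 1)) (hk : lam k ≠ 0) (z z' : ℕ × ℕ) :
    Integrable (fun ω => (ξ z.1 k ω * ε z.1 z.2 ω) * (ξ z'.1 k ω * ε z'.1 z'.2 ω)) P ∧
      ∫ ω, (ξ z.1 k ω * ε z.1 z.2 ω) * (ξ z'.1 k ω * ε z'.1 z'.2 ω) ∂P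
        = if z = z' then 1 else 0 := by
  set f := fpc lam psi k
  have hk2 : lam k * lam k ≠ 0 := mul_ne_zero hk hk
  have hV : Integrable (fun ω => ε z.1 z.2 ω * ε z'.1 z'.2 ω) P :=
    (hε.memLp z.1 z.2).integrable_mul (hε.memLp z'.1 z'.2)
  have h1 := integral_trajCoeff_mul hη hm hφc hV z.1 z'.1
    (indepFun_centered_mul_noise hε z.1 z'.1 z z')
  -- The same identity with `V = 1` identifies the double integral as `lam k ^ 2` times the score
  -- moment. It thus need not be computed from the covariance.
  have h2 := integral_trajCoeff_mul hη hm hφc (integrable_const (1 : ℝ)) z.1 z'.1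
    (fun x y => indepFun_const_right _ 1)
  have hae1 : (fun ω => trajCoeff η m f z.1 ω * trajCoeff η m f z'.1 ω
      * (ε z.1 z.2 ω * ε z'.1 z'.2 ω)) =ᵐ[P] fun ω => lam k * lam k *
        ((ξ z.1 k ω * ε z.1 z.2 ω) * (ξ z'.1 k ω * ε z'.1 z'.2 ω)) := by
    filter_upwards [trajCoeff_fpc_ae hξ z.1 k, trajCoeff_fpc_ae hξ z'.1 k] with ω e1 e2
    rw [e1, e2]
    ring
  have hae2 : (fun ω => trajCoeff η m f z.1 ω * trajCoeff η m f z'.1 ω * 1)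
      =ᵐ[P] fun ω => lam k * lam k * (ξ z.1 k ω * ξ z'.1 k ω) := by
    filter_upwards [trajCoeff_fpc_ae hξ z.1 k, trajCoeff_fpc_ae hξ z'.1 k] with ω e1 e2
    rw [e1, e2]
    ring
  refine ⟨?_, ?_⟩
  · have := (h1.1.congr hae1).const_mul (lam k * lam k)⁻¹
    simpa only [inv_mul_cancel_left₀ hk2] using this
  · have e1 := h1.2
    have e2 := h2.2
    rw [integral_congr_ae hae1, integral_const_mul, integral_noise_mul hε] at e1
    rw [integral_congr_ae hae2, integral_const_mul, integral_score_mul hξ] at e2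
    simp only [integral_const, probReal_univ, smul_eq_mul, mul_one] at e2
    rw [← e2] at e1
    split_ifs with h
    · subst h
      simp only [if_true, mul_one] at e1
      exact mul_left_cancel₀ hk2 (e1.trans (mul_one _).symm)
    · rw [if_neg h, mul_zero] at e1
      exact (mul_eq_zero.1 e1).resolve_left hk2

/-! ### The Karhunen-Loève expansion -/

/-- The covariance of `Z_i(x)` and `ξ_ik` is `φ_k(x)`, by the eigenvalue equation. The extra factor
`φ_k(x)` makes the identity valid also when `lam k = 0`, where the score is not determined by the
trajectory. -/
lemma integral_centered_mul_score [IsProbabilityMeasure P] (hη : IsStationarySample P η m C)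
    (hG : IsEigenSystem C lam psi) (hξ : IsScores P η m lam psi ξ) (hm : ContinuousOn m (Icc 0 1))
    (hφc : ∀ k, ContinuousOn (fpc lam psi k) (Icc 0 1)) (i k : ℕ) {x : ℝ}
    (hx : x ∈ Icc (0 : ℝ) 1) :
    fpc lam psi k x * ∫ ω, centered η m i x ω * ξ i k ω ∂P = fpc lam psi k x ^ 2 := by
  rcases eq_or_ne (lam k) 0 with hk | hk
  · simp [fpc, hk]
  · have h1 := integral_centered_mul_trajCoeff hη hm (hφc k) i hx
    have h2 : (fun ω => centered η m i x ω * trajCoeff η m (fpc lam psi k) i ω)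
        =ᵐ[P] fun ω => lam k * (centered η m i x ω * ξ i k ω) := by
      filter_upwards [trajCoeff_fpc_ae hξ i k] with ω e1
      rw [e1]
      ring
    have h3 : ∫ y in (0 : ℝ)..1, C |x - y| * fpc lam psi k y = lam k * fpc lam psi k x := by
      have h4 : ∀ y, C |x - y| * fpc lam psi k y = √(lam k) * (C |x - y| * psi k y) := fun y => by
        simp only [fpc]
        ring
      simp only [h4]
      rw [intervalIntegral.integral_const_mul, hG.eigen k x hx, fpc]
      ring
    rw [integral_congr_ae h2, integral_const_mul, h3] at h1
    rw [mul_left_cancel₀ hk h1]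
    ring

/-- Bessel's identity for the orthonormal scores, proved one term at a time. -/
lemma integral_centered_sub_sq [IsProbabilityMeasure P] (hη : IsStationarySample P η m C)
    (hG : IsEigenSystem C lam psi) (hξ : IsScores P η m lam psi ξ) (hm : ContinuousOn m (Icc 0 1))
    (hφc : ∀ k, ContinuousOn (fpc lam psi k) (Icc 0 1)) (i : ℕ) {x : ℝ}
    (hx : x ∈ Icc (0 : ℝ) 1) (K : ℕ) :
    ∫ ω, (centered η m i x ω - ∑ k ∈ Finset.range K, ξ i k ω * fpc lam psi k x) ^ 2 ∂P
      = C 0 - ∑ k ∈ Finset.range K, fpc lam psi k x ^ 2 := by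
  set f := fun k => fpc lam psi k x with hf
  have hsLp : ∀ K, MemLp (fun ω => ∑ k ∈ Finset.range K, ξ i k ω * f k) 2 P := fun K =>
    memLp_finsetSum _ fun k _ => (hξ.memLp i k).mul_const (f k)
  have hdLp : ∀ K, MemLp (fun ω => centered η m i x ω - ∑ k ∈ Finset.range K, ξ i k ω * f k) 2 P :=
    fun K => (memLp_centered hη i x).sub (hsLp K)
  induction K with
  | zero =>
    simp only [Finset.range_zero, Finset.sum_empty, sub_zero, sq]
    rw [integral_centered_mul hη, sub_self, abs_zero]
  | succ K ih =>
    have hexp : ∀ ω, (centered η m i x ω - ∑ k ∈ Finset.range (K + 1), ξ i k ω * f k) ^ 2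
        = (centered η m i x ω - ∑ k ∈ Finset.range K, ξ i k ω * f k) ^ 2
          - 2 * f K * (centered η m i x ω * ξ i K ω)
          + 2 * f K * ((∑ k ∈ Finset.range K, ξ i k ω * f k) * ξ i K ω)
          + f K ^ 2 * (ξ i K ω * ξ i K ω) := fun ω => by
      rw [Finset.sum_range_succ]
      ring
    have i1 : Integrable (fun ω =>
        (centered η m i x ω - ∑ k ∈ Finset.range K, ξ i k ω * f k) ^ 2) P := (hdLp K).integrable_sq
    have i2 : Integrable (fun ω => 2 * f K * (centered η m i x ω * ξ i K ω)) P :=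
      ((memLp_centered hη i x).integrable_mul (hξ.memLp i K)).const_mul _
    have i3 : Integrable (fun ω => 2 * f K * ((∑ k ∈ Finset.range K, ξ i k ω * f k) * ξ i K ω)) P :=
      ((hsLp K).integrable_mul (hξ.memLp i K)).const_mul _
    have i4 : Integrable (fun ω => f K ^ 2 * (ξ i K ω * ξ i K ω)) P :=
      ((hξ.memLp i K).integrable_mul (hξ.memLp i K)).const_mul _
    have hzero : ∫ ω, (∑ k ∈ Finset.range K, ξ i k ω * f k) * ξ i K ω ∂P = 0 := by
      simp only [Finset.sum_mul]
      rw [integral_finsetSum]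
      · refine Finset.sum_eq_zero fun k hk => ?_
        have h1 : ∀ ω, ξ i k ω * f k * ξ i K ω = f k * (ξ i k ω * ξ i K ω) := fun ω => by ring
        simp only [h1]
        rw [integral_const_mul, hξ.cov, if_neg (Finset.mem_range.1 hk).ne, mul_zero]
      · intro k _
        exact ((hξ.memLp i k).mul_const (f k)).integrable_mul (hξ.memLp i K)
    have hc := integral_centered_mul_score hη hG hξ hm hφc i K hx
    have hexp' : (fun ω => (centered η m i x ω
        - ∑ k ∈ Finset.range (K + 1), ξ i k ω * fpc lam psi k x) ^ 2) = _ := funext hexp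
    have i12 : Integrable (fun ω =>
        (centered η m i x ω - ∑ k ∈ Finset.range K, ξ i k ω * f k) ^ 2
          - 2 * f K * (centered η m i x ω * ξ i K ω)) P := i1.sub i2
    have i123 : Integrable (fun ω =>
        (centered η m i x ω - ∑ k ∈ Finset.range K, ξ i k ω * f k) ^ 2
          - 2 * f K * (centered η m i x ω * ξ i K ω)
          + 2 * f K * ((∑ k ∈ Finset.range K, ξ i k ω * f k) * ξ i K ω)) P := i12.add i3
    rw [hexp', integral_add i123 i4, integral_add i12 i3, integral_sub i1 i2, ih,
      integral_const_mul, integral_const_mul, integral_const_mul, hzero, hξ.cov, if_pos rfl,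
      Finset.sum_range_succ, mul_assoc 2 (f K), hc]
    simp only [hf]
    ring

/-- The Karhunen-Loève expansion, at a fixed point. -/
lemma tendsto_centered_sub_ae [IsProbabilityMeasure P] (hη : IsStationarySample P η m C)
    (hG : IsEigenSystem C lam psi) (hξ : IsScores P η m lam psi ξ) (hm : ContinuousOn m (Icc 0 1))
    (hφc : ∀ k, ContinuousOn (fpc lam psi k) (Icc 0 1)) (i : ℕ) {x : ℝ}
    (hx : x ∈ Icc (0 : ℝ) 1) (hs : ∀ᵐ ω ∂P, Summable fun k => ξ i k ω * fpc lam psi k x) :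
    ∀ᵐ ω ∂P, Tendsto (fun K => centered η m i x ω
      - ∑ k ∈ Finset.range K, ξ i k ω * fpc lam psi k x) atTop (𝓝 0) := by
  set D : ℕ → Ω → ℝ := fun K ω => centered η m i x ω
      - ∑ k ∈ Finset.range K, ξ i k ω * fpc lam psi k x with hD
  have hDLp : ∀ K, MemLp (D K) 2 P := fun K => (memLp_centered hη i x).sub
    (memLp_finsetSum _ fun k _ => (hξ.memLp i k).mul_const (fpc lam psi k x))
  have hmeas : ∀ K, AEMeasurable (fun ω => ENNReal.ofReal (D K ω ^ 2)) P := fun K =>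
    ((hDLp K).aestronglyMeasurable.aemeasurable.pow_const 2).ennreal_ofReal
  have hint : ∀ K, ∫⁻ ω, ENNReal.ofReal (D K ω ^ 2) ∂P
      = ENNReal.ofReal (C 0 - ∑ k ∈ Finset.range K, fpc lam psi k x ^ 2) := fun K => by
    rw [← integral_centered_sub_sq hη hG hξ hm hφc i hx K,
      ofReal_integral_eq_lintegral_ofReal (hDLp K).integrable_sq
        (ae_of_all _ fun _ => sq_nonneg _)]
  have hsum : HasSum (fun k => fpc lam psi k x ^ 2) (C 0) := by
    have h1 := hG.expansion x hx x hx
    rw [sub_self, abs_zero] at h1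
    convert h1 using 2 with k
    rw [fpc, mul_pow, Real.sq_sqrt (hG.nonneg k)]
    ring
  have hlim : Tendsto (fun K => ∫⁻ ω, ENNReal.ofReal (D K ω ^ 2) ∂P) atTop (𝓝 0) := by
    simp only [hint]
    have h1 := (tendsto_const_nhds (x := C 0)).sub hsum.tendsto_sum_nat
    rw [sub_self] at h1
    simpa using ENNReal.tendsto_ofReal h1
  have htend : ∀ᵐ ω ∂P, Tendsto (fun K => ENNReal.ofReal (D K ω ^ 2)) atTop
      (𝓝 (ENNReal.ofReal ((centered η m i x ω - ∑' k, ξ i k ω * fpc lam psi k x) ^ 2))) := by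
    filter_upwards [hs] with ω h2
    exact ENNReal.tendsto_ofReal
      ((tendsto_const_nhds.sub h2.hasSum.tendsto_sum_nat).pow 2)
  -- The partial sums converge to `Z_i(x)` in mean square, since their errors `C 0 - ∑ φ_k(x) ^ 2`
  -- tend to zero by the spectral expansion. They also converge almost surely, and Fatou's lemma
  -- identifies the two limits.
  have hfatou := lintegral_liminf_le' (μ := P) (u := atTop) hmeas
  rw [hlim.liminf_eq, nonpos_iff_eq_zero,
    lintegral_congr_ae (htend.mono fun ω hω => hω.liminf_eq),
    lintegral_eq_zero_iff' (aemeasurable_of_tendsto_metrizable_ae atTop hmeas htend)] at hfatou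
  filter_upwards [hfatou, hs] with ω h1 h2
  have h3 : Tendsto (fun K => D K ω) atTop
      (𝓝 (centered η m i x ω - ∑' k, ξ i k ω * fpc lam psi k x)) :=
    tendsto_const_nhds.sub h2.hasSum.tendsto_sum_nat
  rw [Pi.zero_apply, ENNReal.ofReal_eq_zero] at h1
  rw [pow_eq_zero_iff two_ne_zero |>.1 (le_antisymm h1 (sq_nonneg _))] at h3
  exact h3

lemma lintegral_score_sq (hξ : IsScores P η m lam psi ξ) (i k : ℕ) :
    ∫⁻ ω, ENNReal.ofReal (ξ i k ω ^ 2) ∂P = 1 := by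
  rw [← ofReal_integral_eq_lintegral_ofReal (hξ.memLp i k).integrable_sq
    (ae_of_all _ fun _ => sq_nonneg _)]
  have := hξ.cov i k k
  simp only [if_true, ← sq] at this
  rw [this, ENNReal.ofReal_one]

variable {a : ℕ → ℝ}

lemma summable_of_tsum_ofReal_ne_top {f : ℕ → ℝ} (hf : ∀ k, 0 ≤ f k)
    (h : ∑' k, ENNReal.ofReal (f k) ≠ ∞) : Summable f := by
  have := ENNReal.summable_toReal h
  simpa only [ENNReal.toReal_ofReal (hf _)] using this

/-- The series has expectation `∑ a k`, which is finite. -/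
lemma summable_score_sq_ae (hξ : IsScores P η m lam psi ξ) (ha : Summable a) (ha0 : ∀ k, 0 ≤ a k)
    (i : ℕ) : ∀ᵐ ω ∂P, Summable fun k => a k * ξ i k ω ^ 2 := by
  have hmeas : ∀ k, AEMeasurable (fun ω => ENNReal.ofReal (a k * ξ i k ω ^ 2)) P := fun k =>
    (((hξ.memLp i k).aestronglyMeasurable.aemeasurable.pow_const 2).const_mul _).ennreal_ofReal
  have h1 : ∫⁻ ω, ∑' k, ENNReal.ofReal (a k * ξ i k ω ^ 2) ∂P ≠ ∞ := by
    rw [lintegral_tsum hmeas]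
    have h2 : ∀ k, ∫⁻ ω, ENNReal.ofReal (a k * ξ i k ω ^ 2) ∂P = ENNReal.ofReal (a k) := fun k => by
      simp only [ENNReal.ofReal_mul (ha0 k)]
      rw [lintegral_const_mul' _ _ ENNReal.ofReal_ne_top, lintegral_score_sq hξ, mul_one]
    simp only [h2]
    rw [← ENNReal.ofReal_tsum_of_nonneg ha0 ha]
    exact ENNReal.ofReal_ne_top
  filter_upwards [ae_lt_top' (AEMeasurable.tsum hmeas) h1] with ω hω
  exact summable_of_tsum_ofReal_ne_top (fun k => mul_nonneg (ha0 k) (sq_nonneg _)) hω.ne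

/-- The Karhunen-Loève expansion: at almost all points, and on the grids. -/
theorem eq_scoreSeries_ae [IsProbabilityMeasure P] (hη : IsStationarySample P η m C)
    (hG : IsEigenSystem C lam psi) (hξ : IsScores P η m lam psi ξ) (hm : ContinuousOn m (Icc 0 1))
    (hφc : ∀ k, ContinuousOn (fpc lam psi k) (Icc 0 1)) (ha : Summable a) (ha0 : ∀ k, 0 ≤ a k)
    (hφ : ∀ k, ∀ x ∈ Icc (0 : ℝ) 1, |fpc lam psi k x| ≤ a k) :
    ∀ᵐ ω ∂P, ∀ i, (Summable fun k => a k * ξ i k ω ^ 2) ∧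
      (∀ᵐ x ∂unitMeasure, η i x ω - m x = scoreSeries (fpc lam psi) (fun k => ξ i k ω) x) ∧
      ∀ N, ∀ j < N, η i (gridPt N j) ω - m (gridPt N j)
        = scoreSeries (fpc lam psi) (fun k => ξ i k ω) (gridPt N j) := by
  rw [ae_all_iff]
  intro i
  have hsum := summable_score_sq_ae hξ ha ha0 i
  have hsx : ∀ x ∈ Icc (0 : ℝ) 1, ∀ᵐ ω ∂P, Summable fun k => ξ i k ω * fpc lam psi k x := by
    intro x hx
    filter_upwards [hsum] with ω hω
    exact summable_scoreSeries hφ (summable_mul_abs ha ha0 hω) hx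
  have hpt : ∀ x ∈ Icc (0 : ℝ) 1, ∀ᵐ ω ∂P, Tendsto (fun K => centered η m i x ω
      - ∑ k ∈ Finset.range K, ξ i k ω * fpc lam psi k x) atTop (𝓝 0) := fun x hx =>
    tendsto_centered_sub_ae hη hG hξ hm hφc i hx (hsx x hx)
  -- a measurable version of the scores
  have hmk : ∀ k, AEMeasurable (ξ i k) P := fun k =>
    (hξ.memLp i k).aestronglyMeasurable.aemeasurable
  -- Exchanging the two almost everywhere quantifiers needs a jointly measurable event, and the
  -- scores are only almost everywhere measurable.
  let ζ : ℕ → Ω → ℝ := fun k => (hmk k).mk (ξ i k)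
  have hζ : ∀ᵐ ω ∂P, ∀ k, ξ i k ω = ζ k ω := ae_all_iff.2 fun k => (hmk k).ae_eq_mk
  have hae : ∀ᵐ x ∂unitMeasure, ∀ᵐ ω ∂P, Tendsto (fun K => centered η m i x ω
      - ∑ k ∈ Finset.range K, ζ k ω * fpc lam psi k (clamp x)) atTop (𝓝 0) := by
    refine ae_restrict_of_forall_mem measurableSet_Icc fun x hx => ?_
    filter_upwards [hpt x hx, hζ] with ω h1 h2
    simpa only [clamp_of_mem hx, h2] using h1
  -- From "for every `x`, almost surely" to "almost surely, for almost every `x`". The grid points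
  -- are countably many and keep the pointwise statement.
  rw [Measure.ae_ae_comm] at hae
  · filter_upwards [hsum, hζ, hae, ae_all_iff.2 fun N => ae_all_iff.2 fun j =>
      (ae_all_iff.2 fun hj : j < N => hpt _ (gridPt_mem hj))] with ω h1 h2 h3 h4
    have hlim : ∀ x ∈ Icc (0 : ℝ) 1, Tendsto (fun K => centered η m i x ω
        - ∑ k ∈ Finset.range K, ξ i k ω * fpc lam psi k x) atTop (𝓝 0) →
        η i x ω - m x = scoreSeries (fpc lam psi) (fun k => ξ i k ω) x := by
      intro x hx hlim
      have h5 := summable_scoreSeries hφ (summable_mul_abs ha ha0 h1) hx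
      have h6 := tendsto_nhds_unique hlim (tendsto_const_nhds.sub h5.hasSum.tendsto_sum_nat)
      simp only [centered, clamp_of_mem hx] at h6
      exact (sub_eq_zero.1 h6.symm)
    refine ⟨h1, ?_, fun N j hj => hlim _ (gridPt_mem hj) (h4 N j hj)⟩
    have hmem : ∀ᵐ x ∂unitMeasure, x ∈ Icc (0 : ℝ) 1 := ae_restrict_mem measurableSet_Icc
    filter_upwards [h3, hmem] with x hx hxI
    refine hlim x hxI ?_
    simpa only [clamp_of_mem hxI, ← h2] using hx
  · refine measurableSet_tendsto (𝓝 0) fun K => ?_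
    refine (measurable_centered hη hm i).sub (Finset.measurable_sum _ fun k _ => ?_)
    have hφm : Continuous fun x => fpc lam psi k (clamp x) :=
      (hφc k).comp_continuous continuous_clamp clamp_mem
    exact ((hmk k).measurable_mk.comp measurable_snd).mul (hφm.measurable.comp measurable_fst)

end Scores

section Expectation

variable {Ω : Type*} [MeasurableSpace Ω] {P : Measure Ω}
  {η : ℕ → ℝ → Ω → ℝ} {m C σ : ℝ → ℝ} {lam : ℕ → ℝ} {psi : ℕ → ℝ → ℝ} {ξ ε : ℕ → ℕ → Ω → ℝ}
  {a : ℕ → ℝ} {p J N n : ℕ} {M : ℝ}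

/-! ### Expectations of the terms of the error bound -/

/-- The error at the `j`-th grid point, scaled by its standard deviation. -/
def scaledNoise (σ : ℝ → ℝ) (ε : ℕ → ℕ → Ω → ℝ) (N i : ℕ) (ω : Ω) (j : ℕ) : ℝ :=
  σ (gridPt N j) * ε i j ω

lemma sum_mul_sq_le {v w : ℕ → ℝ} (hv : ∑ j ∈ Finset.range N, v j ^ 2 = 1)
    (hw : ∀ j < N, |w j| ≤ M) : ∑ j ∈ Finset.range N, (v j * w j) ^ 2 ≤ M ^ 2 := by
  have h1 : ∑ j ∈ Finset.range N, (v j * w j) ^ 2 ≤ ∑ j ∈ Finset.range N, v j ^ 2 * M ^ 2 := by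
    refine Finset.sum_le_sum fun j hj => ?_
    rw [mul_pow]
    refine mul_le_mul_of_nonneg_left ?_ (sq_nonneg _)
    rw [← sq_abs]
    exact pow_le_pow_left₀ (abs_nonneg _) (hw j (Finset.mem_range.1 hj)) 2
  rwa [← Finset.sum_mul, hv, one_mul] at h1

lemma lintegral_sq_avg_score (hξ : IsScores P η m lam psi ξ)
    (hn : 0 < n) (k : ℕ) :
    ∫⁻ ω, ENNReal.ofReal ((avg n fun i => ξ i k ω) ^ 2) ∂P = ENNReal.ofReal (1 / n) := by
  have h1 := lintegral_sq_sum_of_orthonormal (P := P) (Finset.range n) (fun _ => 1 / (n : ℝ))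
    (fun i => ξ i k) (fun i _ l _ => (hξ.memLp i k).integrable_mul (hξ.memLp l k))
    (fun i _ l _ => integral_score_mul hξ i l k)
  simp only [avg, Finset.mul_sum]
  rw [h1]
  congr 1
  have : (n : ℝ) ≠ 0 := by positivity
  simp
  field_simp

lemma lintegral_sq_sum_noise_le (hε : IsNoise P η ε) {v : ℕ → ℝ}
    (hv : ∑ j ∈ Finset.range N, v j ^ 2 = 1) (hσ : ∀ x ∈ Icc (0 : ℝ) 1, |σ x| ≤ M) (i : ℕ) :
    ∫⁻ ω, ENNReal.ofReal ((∑ j ∈ Finset.range N, v j * scaledNoise σ ε N i ω j) ^ 2) ∂P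
      ≤ ENNReal.ofReal (M ^ 2) := by
  have h1 := lintegral_sq_sum_of_orthonormal (P := P) (Finset.range N)
    (fun j => v j * σ (gridPt N j)) (fun j => ε i j)
    (fun j _ l _ => (hε.memLp i j).integrable_mul (hε.memLp i l))
    (fun j _ l _ => by simpa using integral_noise_mul hε (i, j) (i, l))
  simp only [scaledNoise, ← mul_assoc]
  rw [h1]
  exact ENNReal.ofReal_le_ofReal (sum_mul_sq_le hv fun j hj => hσ _ (gridPt_mem hj))

/-- Orthonormality of `ξ_ik ε_ij` over the pairs `(i, j)` produces the gain `1 / n` over the bound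
for a single noise vector. -/
lemma lintegral_sq_sum_cross_le [IsProbabilityMeasure P] (hη : IsStationarySample P η m C)
    (hξ : IsScores P η m lam psi ξ) (hε : IsNoise P η ε) (hm : ContinuousOn m (Icc 0 1)) {k : ℕ}
    (hφc : ContinuousOn (fpc lam psi k) (Icc 0 1)) (hk : lam k ≠ 0) (hn : 0 < n) {v : ℕ → ℝ}
    (hv : ∑ j ∈ Finset.range N, v j ^ 2 = 1) (hσ : ∀ x ∈ Icc (0 : ℝ) 1, |σ x| ≤ M) :
    ∫⁻ ω, ENNReal.ofReal ((∑ j ∈ Finset.range N,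
        v j * avg n fun i => ξ i k ω * scaledNoise σ ε N i ω j) ^ 2) ∂P
      ≤ ENNReal.ofReal (M ^ 2 / n) := by
  have hn0 : (n : ℝ) ≠ 0 := by positivity
  have h1 := lintegral_sq_sum_of_orthonormal (P := P) (Finset.range n ×ˢ Finset.range N)
    (fun z => v z.2 * σ (gridPt N z.2) / n) (fun z ω => ξ z.1 k ω * ε z.1 z.2 ω)
    (fun z _ z' _ => (score_mul_noise_orthonormal hη hξ hε hm hφc hk z z').1)
    (fun z _ z' _ => (score_mul_noise_orthonormal hη hξ hε hm hφc hk z z').2)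
  have h2 : ∀ ω, ∑ j ∈ Finset.range N, v j * (avg n fun i => ξ i k ω * scaledNoise σ ε N i ω j)
      = ∑ z ∈ Finset.range n ×ˢ Finset.range N,
        v z.2 * σ (gridPt N z.2) / n * (ξ z.1 k ω * ε z.1 z.2 ω) := fun ω => by
    rw [Finset.sum_product, Finset.sum_comm]
    refine Finset.sum_congr rfl fun j _ => ?_
    simp only [avg, Finset.mul_sum, scaledNoise]
    refine Finset.sum_congr rfl fun i _ => ?_
    ring
  simp only [h2]
  rw [h1]
  refine ENNReal.ofReal_le_ofReal ?_
  rw [Finset.sum_product]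
  simp only [Finset.sum_const, Finset.card_range, nsmul_eq_mul]
  have h3 := sum_mul_sq_le hv fun j hj => hσ _ (gridPt_mem hj)
  simp only [div_pow]
  rw [← Finset.sum_div]
  have h4 : (n : ℝ) * ((∑ j ∈ Finset.range N, (v j * σ (gridPt N j)) ^ 2) / n ^ 2)
      = (∑ j ∈ Finset.range N, (v j * σ (gridPt N j)) ^ 2) / n := by
    field_simp
  rw [h4]
  gcongr

lemma aemeasurable_sum_sq {d : ℕ} {v : Fin d → ℕ → ℝ} {y : ℕ → Ω → ℝ}
    (hy : ∀ j, AEMeasurable (y j) P) (κ : ℝ) :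
    AEMeasurable (fun ω => ENNReal.ofReal
      (κ * ∑ b, (∑ j ∈ Finset.range N, v b j * y j ω) ^ 2)) P := by
  refine AEMeasurable.ennreal_ofReal (AEMeasurable.const_mul ?_ κ)
  exact Finset.aemeasurable_fun_sum _ fun b _ => AEMeasurable.pow_const
    (Finset.aemeasurable_fun_sum _ fun j _ => (hy j).const_mul _) 2

lemma lintegral_sum_sq_le {d : ℕ} {v : Fin d → ℕ → ℝ} {y : ℕ → Ω → ℝ}
    (hy : ∀ j, AEMeasurable (y j) P) {κ B : ℝ} (hκ : 0 ≤ κ)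
    (h : ∀ b, ∫⁻ ω, ENNReal.ofReal ((∑ j ∈ Finset.range N, v b j * y j ω) ^ 2) ∂P
      ≤ ENNReal.ofReal B) :
    ∫⁻ ω, ENNReal.ofReal (κ * ∑ b, (∑ j ∈ Finset.range N, v b j * y j ω) ^ 2) ∂P
      ≤ ENNReal.ofReal (κ * (d * B)) := by
  simp only [ENNReal.ofReal_mul hκ, ENNReal.ofReal_sum_of_nonneg fun _ _ => sq_nonneg _]
  rw [lintegral_const_mul' _ _ ENNReal.ofReal_ne_top, lintegral_finsetSum']
  · refine mul_le_mul_right ((Finset.sum_le_sum fun b _ => h b).trans_eq ?_) _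
    rw [Finset.sum_const, Finset.card_univ, Fintype.card_fin, nsmul_eq_mul,
      ENNReal.ofReal_mul (Nat.cast_nonneg d), ENNReal.ofReal_natCast]
  · intro b _
    exact (AEMeasurable.pow_const (Finset.aemeasurable_fun_sum _ fun j _ =>
      (hy j).const_mul _) 2).ennreal_ofReal

end Expectation

/-! ### Almost everywhere equality and passage to extended nonnegative reals -/

/-- Translation preserves null sets, so equality almost everywhere also holds at the shifted
argument. -/
lemma lagCov_congr_ae {n : ℕ} {f g : ℕ → ℝ → ℝ} {h : ℝ} (hh : 0 ≤ h) (hh1 : h ≤ 1)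
    (hfg : ∀ i < n, ∀ᵐ x ∂unitMeasure, f i x = g i x) : lagCov n f h = lagCov n g h := by
  unfold lagCov
  congr 1
  have h1 : ∀ᵐ x : ℝ, ∀ i < n, x ∈ Icc (0 : ℝ) 1 → f i x = g i x := by
    rw [ae_all_iff]
    intro i
    rw [ae_all_iff]
    intro hi
    exact (ae_restrict_iff' measurableSet_Icc).1 (hfg i hi)
  have h2 : ∀ᵐ x : ℝ, ∀ i < n, x + h ∈ Icc (0 : ℝ) 1 → f i (x + h) = g i (x + h) :=
    (measurePreserving_add_right volume h).quasiMeasurePreserving.ae h1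
  refine intervalIntegral.integral_congr_ae ?_
  filter_upwards [h1, h2] with x hx1 hx2 hx
  rw [uIoc_of_le (by linarith)] at hx
  congr 1
  refine Finset.sum_congr rfl fun i hi => ?_
  have hi' := Finset.mem_range.1 hi
  rw [hx1 i hi' ⟨hx.1.le, by linarith [hx.2]⟩, hx2 i hi' ⟨by linarith [hx.1], by linarith [hx.2]⟩]

/-- No summability is required, since a divergent real series has sum zero by convention. -/
lemma ofReal_tsum_le {f : ℕ → ℝ} (hf : ∀ k, 0 ≤ f k) :
    ENNReal.ofReal (∑' k, f k) ≤ ∑' k, ENNReal.ofReal (f k) := by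
  by_cases h : Summable f
  · rw [ENNReal.ofReal_tsum_of_nonneg hf h]
  · simp [tsum_eq_zero_of_not_summable h]

lemma ofReal_avg {n : ℕ} {f : ℕ → ℝ} (hf : ∀ i < n, 0 ≤ f i) :
    ENNReal.ofReal (avg n f)
      = ENNReal.ofReal (1 / n) * ∑ i ∈ Finset.range n, ENNReal.ofReal (f i) := by
  rw [avg, ENNReal.ofReal_mul (by positivity), ENNReal.ofReal_sum_of_nonneg]
  exact fun i hi => hf i (Finset.mem_range.1 hi)

lemma ofReal_mul_add_add_add {A K x y z t : ℝ} (hA : 0 ≤ A) (hK : 0 ≤ K) (hx : 0 ≤ x)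
    (hy : 0 ≤ y) (hz : 0 ≤ z) (ht : 0 ≤ t) :
    ENNReal.ofReal (A * (K * (x + y + z) + t)) = ENNReal.ofReal A * (ENNReal.ofReal K *
      (ENNReal.ofReal x + ENNReal.ofReal y + ENNReal.ofReal z) + ENNReal.ofReal t) := by
  rw [ENNReal.ofReal_mul hA, ENNReal.ofReal_add (by positivity) ht, ENNReal.ofReal_mul hK,
    ENNReal.ofReal_add (by positivity) hz, ENNReal.ofReal_add hx hy]

/-! ### The error in probability for fixed sample sizes -/

section Probability

variable {Ω : Type*} [MeasurableSpace Ω] {P : Measure Ω}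
  {η : ℕ → ℝ → Ω → ℝ} {m C σ : ℝ → ℝ} {lam : ℕ → ℝ} {psi : ℕ → ℝ → ℝ} {ξ ε : ℕ → ℕ → Ω → ℝ}
  {a : ℕ → ℝ} {p J N n : ℕ} {M : ℝ}

/-- The error of the spline covariance estimator, in probability, for fixed sample sizes. -/
theorem measure_error_le [IsProbabilityMeasure P] (hη : IsStationarySample P η m C)
    (hG : IsEigenSystem C lam psi) (hξ : IsScores P η m lam psi ξ) (hε : IsNoise P η ε)
    (hm : ContinuousOn m (Icc 0 1)) (hφc : ∀ k, ContinuousOn (fpc lam psi k) (Icc 0 1))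
    (ha : Summable a) (ha0 : ∀ k, 0 ≤ a k) (hak : ∀ k, lam k = 0 → a k = 0)
    (hφ : ∀ k, ∀ x ∈ Icc (0 : ℝ) 1, |fpc lam psi k x| ≤ a k)
    (hσ : ∀ x ∈ Icc (0 : ℝ) 1, |σ x| ≤ M)
    (hp : 2 ≤ p) (hN : 2 * p * (J + 1) ≤ N) (hn : 0 < n) {ρ : ℝ} (hρ : 0 < ρ) (hρ1 : ρ ≤ 1)
    (hφs : ∀ k, ∃ s, IsSpline p J s ∧ ∀ x ∈ Icc (0 : ℝ) 1, |fpc lam psi k x - s x| ≤ ρ * a k)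
    {gh : Ω → ℕ → ℝ → ℝ} (hfit : ∀ ω, ∀ i < n, IsSplineFit p J N (obs η σ ε N i ω) (gh ω i))
    {h₀ : ℝ} (hh₀ : h₀ < 1) {s : ℝ} (hs : 0 < s) {t : ℝ} (ht : 0 < t) :
    P {ω | ENNReal.ofReal t < ⨆ h ∈ Icc (0 : ℝ) h₀,
        ENNReal.ofReal |covHat n (gh ω) h - C h - Delta n η m C ω h|}
      ≤ ENNReal.ofReal (2 / (1 - h₀) * (50 * (normConst p + 1) * ((∑' k, a k) + 1) *
          ((∑' k, a k) / n + ρ * (1 + ∑' k, a k)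
            + normConst p / N * ((p * (J + 1) : ℕ) * M ^ 2))
          + (∑' k, a k) * (s + normConst p / N * ((p * (J + 1) : ℕ) * (M ^ 2 / n)) / s)))
        / ENNReal.ofReal t := by
  obtain ⟨d, hd, v, hv, hvg⟩ := exists_fit_basis p J N
  have hd' : (d : ℝ) ≤ (p * (J + 1) : ℕ) := by exact_mod_cast hd
  have hN0 : 0 < N := lt_of_lt_of_le (by positivity) hN
  have hN0' : (0 : ℝ) < N := by exact_mod_cast hN0
  have hn0' : (0 : ℝ) < n := by exact_mod_cast hn
  set α := ∑' k, a k with hα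
  have hα0 : 0 ≤ α := tsum_nonneg ha0
  have hc := normConst_nonneg p
  set κ := normConst p / N with hκ
  have hκ0 : 0 ≤ κ := by positivity
  set K := 50 * (normConst p + 1) * (α + 1) with hK
  have hK0 : 0 ≤ K := by positivity
  have hsh : 0 < 1 - h₀ := by linarith
  choose G hGfit using fun i ω => exists_mem_normalFits p J N (scaledNoise σ ε N i ω)
  let Q : ℕ → Ω → ℝ := fun i ω =>
    κ * ∑ b, (∑ j ∈ Finset.range N, v b j * scaledNoise σ ε N i ω j) ^ 2
  let Q' : ℕ → Ω → ℝ := fun k ω => κ * ∑ b, (∑ j ∈ Finset.range N,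
    v b j * avg n fun i => ξ i k ω * scaledNoise σ ε N i ω j) ^ 2
  have hQ0 : ∀ i ω, 0 ≤ Q i ω := fun i ω => by positivity
  have hQ'0 : ∀ i ω, 0 ≤ Q' i ω := fun i ω => by positivity
  have hintfit : ∀ y g, (y, g) ∈ normalFits p J N → ∫ x in (0 : ℝ)..1, g x ^ 2
      ≤ κ * ∑ b, (∑ j ∈ Finset.range N, v b j * y j) ^ 2 := fun y g hg => by
    rw [← hvg y g hg]
    exact IsSpline.integral_sq_le hp hN hg.1
  -- The bound is kept in the extended nonnegative reals, where sums and expectations commute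
  -- without integrability conditions. It is free of `G`, whose choice depends on `ω` in no
  -- measurable way: `Q` and `Q'` are explicit in the data.
  let Bnd : Ω → ℝ≥0∞ := fun ω => ENNReal.ofReal (2 / (1 - h₀)) *
    (ENNReal.ofReal K * ((∑' k, ENNReal.ofReal (a k) *
      ENNReal.ofReal ((avg n fun i => ξ i k ω) ^ 2))
      + ENNReal.ofReal ρ * (1 + ENNReal.ofReal (1 / n) * ∑ i ∈ Finset.range n,
          ∑' k, ENNReal.ofReal (a k) * ENNReal.ofReal (ξ i k ω ^ 2))
      + ENNReal.ofReal (1 / n) * ∑ i ∈ Finset.range n, ENNReal.ofReal (Q i ω))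
    + ∑' k, ENNReal.ofReal (a k) *
        (ENNReal.ofReal s + ENNReal.ofReal (1 / s) * ENNReal.ofReal (Q' k ω)))
  -- the pointwise bound
  have hpt : ∀ᵐ ω ∂P, (⨆ h ∈ Icc (0 : ℝ) h₀,
      ENNReal.ofReal |covHat n (gh ω) h - C h - Delta n η m C ω h|) ≤ Bnd ω := by
    filter_upwards [eq_scoreSeries_ae hη hG hξ hm hφc ha ha0 hφ] with ω hω
    refine iSup₂_le fun h hh => ?_
    have e1 : covHat n (gh ω) h - C h - Delta n η m C ω h
        = lagCov n (fun i x => gh ω i x - meanHat n (gh ω) x) h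
          - lagCov n (fun i => scoreSeries (fpc lam psi) fun k => ξ i k ω) h := by
      rw [← lagCov_congr_ae hh.1 (hh.2.trans hh₀.le) fun i _ => (hω i).2.1]
      simp only [covHat, Delta, covTilde]
      ring
    rw [e1]
    refine (ofReal_abs_lagCov_sub_le (a := a) (ξ := fun i k => ξ i k ω)
      (y := fun i => obs η σ ε N i ω) (mN := fun j => m (gridPt N j))
      (e := fun i => scaledNoise σ ε N i ω) (G := fun i => G i ω) hp hN hn hρ hρ1 ha ha0 hφc hφ hφs
      (fun i _ => (hω i).1) (fun i _ j hj => ?_) (fun i hi => (hfit ω i hi).mem_normalFits)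
      (fun i _ => hGfit i ω) hs hh hh₀).trans ?_
    · rw [obs, scaledNoise, ← (hω i).2.2 N j hj]
      ring
    · refine mul_le_mul_right (add_le_add ?_ (ENNReal.tsum_le_tsum fun k => ?_)) _
      · have hΓ0 : ∀ i, 0 ≤ ∑' k, a k * ξ i k ω ^ 2 := fun i =>
          tsum_nonneg fun k => mul_nonneg (ha0 k) (sq_nonneg _)
        have hI0 : ∀ i, 0 ≤ ∫ x in (0 : ℝ)..1, G i ω x ^ 2 := fun i =>
          intervalIntegral.integral_nonneg zero_le_one fun x _ => sq_nonneg _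
        have b1 : 0 ≤ ∑' k, a k * (avg n fun i => ξ i k ω) ^ 2 :=
          tsum_nonneg fun k => mul_nonneg (ha0 k) (sq_nonneg _)
        have b2 : 0 ≤ avg n fun i => ∑' k, a k * ξ i k ω ^ 2 := avg_nonneg fun i _ => hΓ0 i
        have b3 : 0 ≤ avg n fun i => ∫ x in (0 : ℝ)..1, G i ω x ^ 2 := avg_nonneg fun i _ => hI0 i
        rw [ENNReal.ofReal_mul hK0, ENNReal.ofReal_add (by positivity) b3,
          ENNReal.ofReal_add b1 (by positivity), ENNReal.ofReal_mul hρ.le,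
          ENNReal.ofReal_add zero_le_one b2, ENNReal.ofReal_one,
          ofReal_avg fun i _ => hΓ0 i, ofReal_avg fun i _ => hI0 i]
        have b4 : ∀ i, ENNReal.ofReal (∑' k, a k * ξ i k ω ^ 2)
            ≤ ∑' k, ENNReal.ofReal (a k) * ENNReal.ofReal (ξ i k ω ^ 2) := fun i => by
          simp only [← ENNReal.ofReal_mul (ha0 _)]
          exact ofReal_tsum_le fun k => mul_nonneg (ha0 k) (sq_nonneg _)
        have b5 : ENNReal.ofReal (∑' k, a k * (avg n fun i => ξ i k ω) ^ 2)
            ≤ ∑' k, ENNReal.ofReal (a k) * ENNReal.ofReal ((avg n fun i => ξ i k ω) ^ 2) := by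
          simp only [← ENNReal.ofReal_mul (ha0 _)]
          exact ofReal_tsum_le fun k => mul_nonneg (ha0 k) (sq_nonneg _)
        have b6 : ∀ i, ENNReal.ofReal (∫ x in (0 : ℝ)..1, G i ω x ^ 2) ≤ ENNReal.ofReal (Q i ω) :=
          fun i => ENNReal.ofReal_le_ofReal (hintfit _ _ (hGfit i ω))
        exact mul_le_mul_right (add_le_add (add_le_add b5 (mul_le_mul_right (add_le_add le_rfl
          (mul_le_mul_right (Finset.sum_le_sum fun i _ => b4 i) _)) _))
          (mul_le_mul_right (Finset.sum_le_sum fun i _ => b6 i) _)) _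
      · rw [← ENNReal.ofReal_mul (by positivity), ← ENNReal.ofReal_add hs.le
          (mul_nonneg (by positivity) (hQ'0 k ω)), ← ENNReal.ofReal_mul (ha0 k)]
        refine ENNReal.ofReal_le_ofReal (mul_le_mul_of_nonneg_left ?_ (ha0 k))
        -- The weighted average of noise fits is the fit of the weighted average of the noise, so
        -- the same norm comparison bounds it by `Q' k`.
        have hW := hintfit _ _ (normalFits_avg (n := n) (fun i => ξ i k ω)
          fun i _ => hGfit i ω)
        rw [one_div_mul_eq_div]
        exact add_le_add le_rfl (div_le_div_of_nonneg_right hW hs.le)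
  -- measurability
  have hξm : ∀ i k, AEMeasurable (ξ i k) P := fun i k =>
    (hξ.memLp i k).aestronglyMeasurable.aemeasurable
  have hεm : ∀ i j, AEMeasurable (fun ω => scaledNoise σ ε N i ω j) P := fun i j =>
    (hε.memLp i j).aestronglyMeasurable.aemeasurable.const_mul _
  have hcm : ∀ k j, AEMeasurable (fun ω => avg n fun i => ξ i k ω * scaledNoise σ ε N i ω j) P :=
    fun k j => (Finset.aemeasurable_fun_sum _ fun i _ => (hξm i k).mul (hεm i j)).const_mul _
  have hQm : ∀ i, AEMeasurable (fun ω => ENNReal.ofReal (Q i ω)) P := fun i =>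
    aemeasurable_sum_sq (fun j => hεm i j) κ
  have hQ'm : ∀ k, AEMeasurable (fun ω => ENNReal.ofReal (Q' k ω)) P := fun k =>
    aemeasurable_sum_sq (fun j => hcm k j) κ
  have m1 : ∀ k, AEMeasurable (fun ω => ENNReal.ofReal (a k)
      * ENNReal.ofReal ((avg n fun i => ξ i k ω) ^ 2)) P := fun k =>
    ((((Finset.aemeasurable_fun_sum _ fun i _ => hξm i k).const_mul _).pow_const 2).ennreal_ofReal
      ).const_mul _
  have m2 : ∀ i k, AEMeasurable (fun ω => ENNReal.ofReal (a k) * ENNReal.ofReal (ξ i k ω ^ 2)) P :=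
    fun i k => (((hξm i k).pow_const 2).ennreal_ofReal).const_mul _
  have m4 : ∀ k, AEMeasurable (fun ω => ENNReal.ofReal (a k) *
      (ENNReal.ofReal s + ENNReal.ofReal (1 / s) * ENNReal.ofReal (Q' k ω))) P := fun k =>
    (((hQ'm k).const_mul _).const_add _).const_mul _
  have M1 : AEMeasurable (fun ω => ∑' k, ENNReal.ofReal (a k)
      * ENNReal.ofReal ((avg n fun i => ξ i k ω) ^ 2)) P := AEMeasurable.tsum m1
  have M2 : AEMeasurable (fun ω => ENNReal.ofReal ρ * (1 + ENNReal.ofReal (1 / n)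
      * ∑ i ∈ Finset.range n, ∑' k, ENNReal.ofReal (a k) * ENNReal.ofReal (ξ i k ω ^ 2))) P :=
    (((Finset.aemeasurable_fun_sum _ fun i _ => AEMeasurable.tsum (m2 i)).const_mul _).const_add
      _).const_mul _
  have M3 : AEMeasurable (fun ω => ENNReal.ofReal (1 / n)
      * ∑ i ∈ Finset.range n, ENNReal.ofReal (Q i ω)) P :=
    (Finset.aemeasurable_fun_sum _ fun i _ => hQm i).const_mul _
  have M4 : AEMeasurable (fun ω => ∑' k, ENNReal.ofReal (a k) *
      (ENNReal.ofReal s + ENNReal.ofReal (1 / s) * ENNReal.ofReal (Q' k ω))) P :=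
    AEMeasurable.tsum m4
  have M123 := (M1.add M2).add M3
  have hBm : AEMeasurable Bnd P := ((M123.const_mul _).add M4).const_mul _
  -- expectations
  have hsumα : ∑' k, ENNReal.ofReal (a k) = ENNReal.ofReal α :=
    (ENNReal.ofReal_tsum_of_nonneg ha0 ha).symm
  have E1 : ∫⁻ ω, ∑' k, ENNReal.ofReal (a k) * ENNReal.ofReal ((avg n fun i => ξ i k ω) ^ 2) ∂P
      = ENNReal.ofReal (α / n) := by
    rw [lintegral_tsum m1]
    have : ∀ k, ∫⁻ ω, ENNReal.ofReal (a k) * ENNReal.ofReal ((avg n fun i => ξ i k ω) ^ 2) ∂P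
        = ENNReal.ofReal (a k) * ENNReal.ofReal (1 / n) := fun k => by
      rw [lintegral_const_mul' _ _ ENNReal.ofReal_ne_top, lintegral_sq_avg_score hξ hn]
    simp only [this]
    rw [ENNReal.tsum_mul_right, hsumα, ← ENNReal.ofReal_mul hα0, mul_one_div]
  have hν : ENNReal.ofReal (1 / n) * (n : ℝ≥0∞) = 1 := by
    rw [← ENNReal.ofReal_natCast, ← ENNReal.ofReal_mul (by positivity), one_div_mul_cancel hn0'.ne',
      ENNReal.ofReal_one]
  have E2 : ∫⁻ ω, ENNReal.ofReal ρ * (1 + ENNReal.ofReal (1 / n)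
      * ∑ i ∈ Finset.range n, ∑' k, ENNReal.ofReal (a k) * ENNReal.ofReal (ξ i k ω ^ 2)) ∂P
      = ENNReal.ofReal (ρ * (1 + α)) := by
    rw [lintegral_const_mul' _ _ ENNReal.ofReal_ne_top, lintegral_add_left measurable_const,
      lintegral_const_mul' _ _ ENNReal.ofReal_ne_top,
      lintegral_finsetSum' _ fun i _ => AEMeasurable.tsum (m2 i)]
    have : ∀ i, ∫⁻ ω, ∑' k, ENNReal.ofReal (a k) * ENNReal.ofReal (ξ i k ω ^ 2) ∂P
        = ENNReal.ofReal α := fun i => by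
      rw [lintegral_tsum (m2 i), ← hsumα]
      refine tsum_congr fun k => ?_
      rw [lintegral_const_mul' _ _ ENNReal.ofReal_ne_top, lintegral_score_sq hξ, mul_one]
    simp only [this]
    rw [Finset.sum_const, Finset.card_range, nsmul_eq_mul, ← mul_assoc, hν, one_mul,
      ENNReal.ofReal_mul hρ.le, ENNReal.ofReal_add zero_le_one hα0]
    simp
  have E3 : ∫⁻ ω, ENNReal.ofReal (1 / n) * ∑ i ∈ Finset.range n, ENNReal.ofReal (Q i ω) ∂P
      ≤ ENNReal.ofReal (κ * ((p * (J + 1) : ℕ) * M ^ 2)) := by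
    rw [lintegral_const_mul' _ _ ENNReal.ofReal_ne_top, lintegral_finsetSum' _ fun i _ => hQm i]
    have : ∀ i ∈ Finset.range n, ∫⁻ ω, ENNReal.ofReal (Q i ω) ∂P
        ≤ ENNReal.ofReal (κ * ((p * (J + 1) : ℕ) * M ^ 2)) := fun i _ => by
      refine (lintegral_sum_sq_le (hεm i) hκ0
        fun b => lintegral_sq_sum_noise_le hε (hv b) hσ i).trans (ENNReal.ofReal_le_ofReal ?_)
      gcongr
    refine (mul_le_mul_right (Finset.sum_le_sum this) _).trans_eq ?_
    rw [Finset.sum_const, Finset.card_range, nsmul_eq_mul, ← mul_assoc, hν, one_mul]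
  have E4 : ∫⁻ ω, ∑' k, ENNReal.ofReal (a k) *
      (ENNReal.ofReal s + ENNReal.ofReal (1 / s) * ENNReal.ofReal (Q' k ω)) ∂P
      ≤ ENNReal.ofReal (α * (s + κ * ((p * (J + 1) : ℕ) * (M ^ 2 / n)) / s)) := by
    rw [lintegral_tsum m4, ENNReal.ofReal_mul hα0, ← hsumα, ← ENNReal.tsum_mul_right]
    refine ENNReal.tsum_le_tsum fun k => ?_
    rcases eq_or_ne (lam k) 0 with hk | hk
    -- For a vanishing eigenvalue the products of score and noise need not be orthonormal, but the
    -- weight `a k` is zero.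
    · simp [hak k hk]
    · rw [lintegral_const_mul' _ _ ENNReal.ofReal_ne_top, lintegral_add_left measurable_const,
        lintegral_const_mul' _ _ ENNReal.ofReal_ne_top]
      refine mul_le_mul_right ?_ _
      have h1 : ∫⁻ ω, ENNReal.ofReal (Q' k ω) ∂P
          ≤ ENNReal.ofReal (κ * ((p * (J + 1) : ℕ) * (M ^ 2 / n))) := by
        refine (lintegral_sum_sq_le (hcm k) hκ0
          fun b => lintegral_sq_sum_cross_le hη hξ hε hm (hφc k) hk hn (hv b) hσ).trans
          (ENNReal.ofReal_le_ofReal ?_)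
        gcongr
      rw [ENNReal.ofReal_add hs.le (by positivity)]
      refine add_le_add (by simp) ((mul_le_mul_right h1 _).trans_eq ?_)
      rw [← ENNReal.ofReal_mul (by positivity), one_div_mul_eq_div]
  have hBint : ∫⁻ ω, Bnd ω ∂P ≤ ENNReal.ofReal (2 / (1 - h₀) * (K *
      (α / n + ρ * (1 + α) + κ * ((p * (J + 1) : ℕ) * M ^ 2))
        + α * (s + κ * ((p * (J + 1) : ℕ) * (M ^ 2 / n)) / s))) := by
    clear_value K
    simp only [Bnd]
    rw [lintegral_const_mul' _ _ ENNReal.ofReal_ne_top, lintegral_add_right' _ M4,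
      lintegral_const_mul' _ _ ENNReal.ofReal_ne_top, lintegral_add_right' _ M3,
      lintegral_add_right' _ M2, E1, E2,
      ofReal_mul_add_add_add (by positivity) hK0 (by positivity) (by positivity) (by positivity)
        (by positivity)]
    gcongr
  -- Markov's inequality
  have ht0 : ENNReal.ofReal t ≠ 0 := (ENNReal.ofReal_pos.2 ht).ne'
  have hmk := meas_ge_le_lintegral_div hBm ht0 ENNReal.ofReal_ne_top
  refine (measure_mono_ae ?_).trans (hmk.trans (ENNReal.div_le_div_right hBint _))
  filter_upwards [hpt] with ω hω hlt
  exact (le_of_lt hlt).trans hω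

end Probability

/-! ### Rates of growth -/

lemma log_rpow_le_rpow (τ : ℝ) {e : ℝ} (he : 0 < e) :
    (fun N : ℕ => Real.log N ^ τ) =O[atTop] fun N : ℕ => (N : ℝ) ^ e :=
  ((isLittleO_log_rpow_rpow_atTop τ he).comp_tendsto tendsto_natCast_atTop_atTop).isBigO

lemma sqrt_isBigO {θ : ℝ} {n : ℕ → ℕ} (h : AssumptionA3 θ n) :
    (fun N => √(n N : ℝ)) =O[atTop] fun N => (N : ℝ) ^ (θ / 2) := by
  have h1 := h.growth.rpow (r := 1 / 2) (by norm_num)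
    (Eventually.of_forall fun N => by positivity)
  have e1 : (fun N => √(n N : ℝ)) = fun N => (n N : ℝ) ^ (1 / 2 : ℝ) :=
    funext fun N => Real.sqrt_eq_rpow _
  have e2 : (fun N : ℕ => (N : ℝ) ^ (θ / 2)) = fun N : ℕ => ((N : ℝ) ^ θ) ^ (1 / 2 : ℝ) :=
    funext fun N => by rw [← Real.rpow_mul (Nat.cast_nonneg N), mul_one_div]
  rw [e1, e2]
  exact h1

section Knots

variable {J : ℕ → ℕ} {γ τ : ℝ} {d : ℕ → ℝ}

/-- The polylogarithmic factor `d` is absorbed into an arbitrarily small power of `N`. -/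
lemma knots_isBigO (hγ : 0 < γ) (hd : ∀ᶠ N in atTop, 0 < d N)
    (hτ : (fun N => d N + (d N)⁻¹) =O[atTop] fun N => Real.log N ^ τ)
    (hJ : (fun N => (J N : ℝ)) =Θ[atTop] fun N => (N : ℝ) ^ γ * d N) {e : ℝ} (he : 0 < e) :
    (fun N => (J N : ℝ) + 1) =O[atTop] fun N => (N : ℝ) ^ (γ + e) := by
  have h1 : d =O[atTop] fun N : ℕ => (N : ℝ) ^ e := by
    refine IsBigO.trans ?_ (hτ.trans (log_rpow_le_rpow τ he))
    refine IsBigO.of_bound 1 ?_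
    filter_upwards [hd] with N hN
    have := inv_pos.2 hN
    rw [one_mul, Real.norm_of_nonneg hN.le, Real.norm_of_nonneg (by positivity)]
    linarith
  have h2 : (fun N => (J N : ℝ)) =O[atTop] fun N => (N : ℝ) ^ (γ + e) := by
    refine (hJ.1.trans ((isBigO_refl _ _).mul h1)).congr' EventuallyEq.rfl ?_
    filter_upwards [eventually_gt_atTop 0] with N hN
    rw [Real.rpow_add (by exact_mod_cast hN)]
  refine h2.add (IsBigO.of_bound 1 ?_)
  filter_upwards [eventually_gt_atTop 0] with N hN
  have hN1 : (1 : ℝ) ≤ N := by exact_mod_cast hN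
  have := Real.one_le_rpow hN1 (add_pos hγ he).le
  rw [one_mul, norm_one, Real.norm_of_nonneg (by positivity)]
  exact this

lemma inv_knots_isBigO (hd : ∀ᶠ N in atTop, 0 < d N)
    (hτ : (fun N => d N + (d N)⁻¹) =O[atTop] fun N => Real.log N ^ τ)
    (hJ : (fun N => (J N : ℝ)) =Θ[atTop] fun N => (N : ℝ) ^ γ * d N) {e : ℝ} (he : 0 < e) :
    (fun N => (1 : ℝ) / (J N + 1)) =O[atTop] fun N => (N : ℝ) ^ (e - γ) := by
  have h1 : (fun N => (d N)⁻¹) =O[atTop] fun N : ℕ => (N : ℝ) ^ e := by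
    refine IsBigO.trans ?_ (hτ.trans (log_rpow_le_rpow τ he))
    refine IsBigO.of_bound 1 ?_
    filter_upwards [hd] with N hN
    have := inv_pos.2 hN
    rw [one_mul, Real.norm_of_nonneg this.le, Real.norm_of_nonneg (by positivity)]
    linarith
  have h2 : (fun N => (1 : ℝ) / (J N + 1)) =O[atTop] fun N => ((N : ℝ) ^ γ * d N)⁻¹ := by
    obtain ⟨c, hc, hb⟩ := hJ.2.exists_pos
    refine IsBigO.of_bound c ?_
    filter_upwards [hd, hb.bound, eventually_gt_atTop 0] with N hN hb hN0
    have hN' : (0 : ℝ) < N := by exact_mod_cast hN0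
    have hpos : 0 < (N : ℝ) ^ γ * d N := mul_pos (Real.rpow_pos_of_pos hN' _) hN
    rw [Real.norm_of_nonneg hpos.le, Real.norm_of_nonneg (Nat.cast_nonneg _)] at hb
    rw [Real.norm_of_nonneg (by positivity), Real.norm_of_nonneg (inv_nonneg.2 hpos.le),
      div_le_iff₀ (by positivity), ← div_eq_mul_inv, div_mul_eq_mul_div, le_div_iff₀ hpos]
    linarith
  refine (h2.congr_right fun N => mul_inv _ _).trans
    ((((isBigO_refl _ _).mul h1)).congr' EventuallyEq.rfl ?_)
  filter_upwards [eventually_gt_atTop 0] with N hN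
  have hN' : (0 : ℝ) < N := by exact_mod_cast hN
  rw [← Real.rpow_neg hN'.le, ← Real.rpow_add hN', neg_add_eq_sub]

end Knots

lemma tendsto_natCast_rpow_neg {e : ℝ} (he : e < 0) :
    Tendsto (fun N : ℕ => (N : ℝ) ^ e) atTop (𝓝 0) := by
  have := (tendsto_rpow_neg_atTop (neg_pos.2 he)).comp tendsto_natCast_atTop_atTop
  simpa [Function.comp_def] using this

lemma tendsto_rates {p : ℕ} {J n : ℕ → ℕ} {pstar ν θ w β₁ β₂ γ₁ γ : ℝ} (hp : 0 < pstar)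
    (hβ₁ : 0 < β₁) (hβ₂ : 0 < β₂) (h3 : AssumptionA3 θ n)
    (h6 : AssumptionA6 p J pstar ν θ w β₁ β₂ γ₁ γ) :
    Tendsto (fun N => √(n N : ℝ) * (((J N : ℝ) + 1) / N)) atTop (𝓝 0) ∧
      Tendsto (fun N => √(n N : ℝ) * ((1 : ℝ) / (J N + 1)) ^ pstar) atTop (𝓝 0) := by
  obtain ⟨d, hd, ⟨τ, -, hτ⟩, hJ⟩ := h6.knots
  have hθ := h3.θ_pos
  -- This bound makes `γ * pstar` exceed `θ / 2`, which is what `√n` times the approximation error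
  -- requires. The upper bound on `γ` gives `θ / 2 + γ < 1` for `√n (J + 1) / N`.
  have hγ1 : 5 * θ / (4 * pstar) < γ := (max_lt_iff.1 (max_lt_iff.1 h6.γ_gt).1).1
  have hγ : 0 < γ := lt_trans (by positivity) hγ1
  have hγp : 5 * θ / 4 < γ * pstar := by
    rw [div_lt_iff₀ (by positivity)] at hγ1
    linarith
  have hγ2 : θ / 2 + γ < 1 := by
    have := h6.γ_lt
    have h4 : 0 < θ / 2 * β₁ := by positivity
    linarith
  constructor
  · have he : 0 < (1 - (θ / 2 + γ)) / 2 := by linarith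
    have h1 := (sqrt_isBigO h3).mul ((knots_isBigO hγ hd hτ hJ he).mul
      (isBigO_refl (fun N : ℕ => (N : ℝ)⁻¹) atTop))
    refine (h1.trans_tendsto ?_)
    refine Tendsto.congr' ?_
      (tendsto_natCast_rpow_neg (e := -((1 - (θ / 2 + γ)) / 2)) (by linarith))
    filter_upwards [eventually_gt_atTop 0] with N hN
    have hN' : (0 : ℝ) < N := by exact_mod_cast hN
    rw [← Real.rpow_neg_one, ← Real.rpow_add hN', ← Real.rpow_add hN']
    congr 1
    ring
  · have he : 0 < (γ * pstar - θ / 2) / 2 / pstar := by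
      apply div_pos _ hp
      linarith
    have h1 := (inv_knots_isBigO hd hτ hJ he).rpow hp.le
      (Eventually.of_forall fun N => by positivity)
    refine (((sqrt_isBigO h3).mul h1).trans_tendsto ?_)
    refine Tendsto.congr' ?_
      (tendsto_natCast_rpow_neg (e := -((γ * pstar - θ / 2) / 2)) (by linarith))
    filter_upwards [eventually_gt_atTop 0] with N hN
    have hN' : (0 : ℝ) < N := by exact_mod_cast hN
    rw [← Real.rpow_mul hN'.le, ← Real.rpow_add hN']
    congr 1
    field_simp
    ring

/-! ### Conclusion -/

lemma supNorm_zero : supNorm (fun _ => 0) = 0 := by simp [supNorm]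

lemma holderSeminorm_zero (q : ℕ) (mu : ℝ) : holderSeminorm q mu (fun _ => 0) = 0 := by
  simp [holderSeminorm]

end SplineCov

end

theorem theorem2 {Ω : Type*} [MeasurableSpace Ω] (P : Measure Ω) [IsProbabilityMeasure P]
    -- trajectories, mean, covariance, eigenvalues, eigenfunctions, scores, errors
    (η : ℕ → ℝ → Ω → ℝ) (m C σ : ℝ → ℝ) (lam : ℕ → ℝ) (psi : ℕ → ℝ → ℝ)
    (ξ ε : ℕ → ℕ → Ω → ℝ)
    (hη : SplineCov.IsStationarySample P η m C)
    (hG : SplineCov.IsEigenSystem C lam psi)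
    (hξ : SplineCov.IsScores P η m lam psi ξ)
    (hε : SplineCov.IsNoise P η ε)
    -- upper limit of the lags, sample sizes, spline order, knots
    (h₀ : ℝ) (hh₀ : h₀ ∈ Ioo (0 : ℝ) 1) (n kn J : ℕ → ℕ) (p : ℕ)
    (q : ℕ) (mu ν θ w β₁ β₂ γ₁ γ : ℝ)
    (hA1 : SplineCov.AssumptionA1 q mu m)
    (hA2 : SplineCov.AssumptionA2 ν h₀ σ C)
    (hA3 : SplineCov.AssumptionA3 θ n)
    (hA4 : SplineCov.AssumptionA4 q mu w (SplineCov.fpc lam psi) kn)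
    (hA5 : SplineCov.AssumptionA5 P ξ ε n kn (q + mu) ν θ β₁ β₂ γ₁)
    (hA6 : SplineCov.AssumptionA6 p J (q + mu) ν θ w β₁ β₂ γ₁ γ)
    -- the spline estimates of the trajectories
    (etaHat : ℕ → Ω → ℕ → ℝ → ℝ)
    (hfit : ∀ N ω, ∀ i < n N,
      SplineCov.IsSplineFit p (J N) N (SplineCov.obs η σ ε N i ω) (etaHat N ω i)) :
    SplineCov.IsLittleOP P
      (fun N ω => ⨆ h ∈ Icc (0 : ℝ) h₀, ENNReal.ofReal
        |SplineCov.covHat (n N) (etaHat N ω) h - C h - SplineCov.Delta (n N) η m C ω h|)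
      (fun N => (n N : ℝ) ^ (-(1 / 2) : ℝ)) := by
  open SplineCov in
  have hmu := hA1.mu_pos
  have hq1 : (1 : ℝ) ≤ q := by exact_mod_cast hA1.q_pos
  have hp : 2 ≤ p := by
    have h1 := hA6.order
    have : (1 : ℝ) < p := by linarith
    exact_mod_cast this
  have hm : ContinuousOn m (Icc 0 1) := hA1.mean_holder.1.continuousOn
  have hφc : ∀ k, ContinuousOn (fpc lam psi k) (Icc 0 1) := fun k => (hA4.holder k).1.continuousOn
  obtain ⟨M, -, hM⟩ := hA2.σ_bdd
  have hσ : ∀ x ∈ Icc (0 : ℝ) 1, |σ x| ≤ M := fun x hx => by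
    rw [abs_of_nonneg (hA2.σ_nonneg x hx)]
    exact hM x hx
  -- One weight dominates both the size of `φ_k` and its distance to the splines. It vanishes with
  -- the eigenvalue.
  obtain ⟨a, ha⟩ : ∃ a : ℕ → ℝ, a = fun k => (supNorm (fpc lam psi k)).toReal
    + (holderSeminorm q mu (fpc lam psi k)).toReal := ⟨_, rfl⟩
  have ha0 : ∀ k, 0 ≤ a k := fun k => by
    rw [ha]
    exact add_nonneg ENNReal.toReal_nonneg ENNReal.toReal_nonneg
  have hasum : Summable a := by
    rw [ha]
    exact (ENNReal.summable_toReal hA4.sum_sup).add (ENNReal.summable_toReal hA4.sum_holder)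
  have hφ : ∀ k, ∀ x ∈ Icc (0 : ℝ) 1, |fpc lam psi k x| ≤ a k := fun k x hx => by
    have h1 : ENNReal.ofReal |fpc lam psi k x| ≤ supNorm (fpc lam psi k) :=
      le_iSup₂_of_le x hx le_rfl
    have h2 := (ENNReal.ofReal_le_iff_le_toReal
      (ENNReal.ne_top_of_tsum_ne_top hA4.sum_sup k)).1 h1
    rw [ha]
    exact h2.trans (le_add_of_nonneg_right ENNReal.toReal_nonneg)
  have hak : ∀ k, lam k = 0 → a k = 0 := fun k hk => by
    have h1 : fpc lam psi k = fun _ => 0 := by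
      funext x
      simp [fpc, hk]
    simp only [ha, h1, supNorm_zero, holderSeminorm_zero]
    simp
  obtain ⟨A, hA, happ⟩ := exists_isSpline_near hmu hp hA6.order
  have hpstar : (0 : ℝ) < q + mu := by linarith
  obtain ⟨hr1, hr2⟩ := tendsto_rates hpstar hA5.β₁_pos hA5.β₂_pos hA3 hA6
  obtain ⟨α, hα⟩ : ∃ α, α = ∑' k, a k := ⟨_, rfl⟩
  obtain ⟨c, hc⟩ : ∃ c, c = normConst p := ⟨_, rfl⟩
  -- consequences of the rates
  have hnR : Tendsto (fun N => (n N : ℝ)) atTop atTop :=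
    tendsto_natCast_atTop_atTop.comp hA3.tendsto
  have hsq : Tendsto (fun N => √(n N : ℝ)) atTop atTop := Real.tendsto_sqrt_atTop.comp hnR
  have hn0 : ∀ᶠ N in atTop, 0 < n N := hA3.tendsto.eventually_gt_atTop 0
  have hsq1 : ∀ᶠ N in atTop, (1 : ℝ) ≤ √(n N : ℝ) := hsq.eventually_ge_atTop 1
  have hr3 : Tendsto (fun N => ((J N : ℝ) + 1) / N) atTop (𝓝 0) := by
    refine tendsto_of_tendsto_of_tendsto_of_le_of_le' tendsto_const_nhds hr1
      (Eventually.of_forall fun N => by positivity) ?_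
    filter_upwards [hsq1] with N hN
    exact le_mul_of_one_le_left (by positivity) hN
  have hNbig : ∀ᶠ N in atTop, 2 * p * (J N + 1) ≤ N := by
    have h1 : (0 : ℝ) < 1 / (2 * p) := by positivity
    filter_upwards [hr3.eventually (gt_mem_nhds h1), eventually_gt_atTop 0] with N hN hN0
    have hN' : (0 : ℝ) < N := by exact_mod_cast hN0
    rw [div_lt_div_iff₀ hN' (by positivity)] at hN
    have h2 : (2 * p * (J N + 1) : ℝ) ≤ N := by linarith
    exact_mod_cast h2
  have hρ1 : ∀ᶠ N in atTop, A * ((1 : ℝ) / (J N + 1)) ^ (q + mu) ≤ 1 := by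
    have h1 : Tendsto (fun N => A * (√(n N : ℝ) * ((1 : ℝ) / (J N + 1)) ^ (q + mu))) atTop
        (𝓝 (A * 0)) := hr2.const_mul A
    rw [mul_zero] at h1
    filter_upwards [h1.eventually (gt_mem_nhds zero_lt_one), hsq1] with N h2 h3
    refine le_trans ?_ h2.le
    refine mul_le_mul_of_nonneg_left ?_ hA.le
    exact le_mul_of_one_le_left (by positivity) h3
  intro δ hδ
  -- This is the bound of `measure_error_le` divided by `δ n ^ (-1/2)`, written in terms of the
  -- quantities that are known to tend to zero.
  let R : ℕ → ℝ := fun N => 2 / (1 - h₀) / δ * (50 * (c + 1) * (α + 1) *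
      (α * (√(n N : ℝ))⁻¹ + A * (√(n N : ℝ) * ((1 : ℝ) / (J N + 1)) ^ (q + mu)) * (1 + α)
        + c * p * M ^ 2 * (√(n N : ℝ) * (((J N : ℝ) + 1) / N)))
      + α * (1 + c * M ^ 2) * √(p * (((J N : ℝ) + 1) / N)))
  have hR : Tendsto R atTop (𝓝 0) := by
    have t1 := hsq.inv_tendsto_atTop.const_mul α
    have t2 := (hr2.const_mul A).mul_const (1 + α)
    have t3 := hr1.const_mul (c * p * M ^ 2)
    have t4 := ((hr3.const_mul (p : ℝ)).sqrt).const_mul (α * (1 + c * M ^ 2))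
    have t5 := (((((t1.add t2).add t3).const_mul (50 * (c + 1) * (α + 1))).add t4).const_mul
      (2 / (1 - h₀) / δ))
    simp only [mul_zero, zero_mul, add_zero, Real.sqrt_zero] at t5
    exact t5
  have hR' : Tendsto (fun N => ENNReal.ofReal (R N)) atTop (𝓝 0) := by
    simpa using ENNReal.tendsto_ofReal hR
  refine tendsto_of_tendsto_of_tendsto_of_le_of_le' tendsto_const_nhds hR'
    (Eventually.of_forall fun N => zero_le) ?_
  filter_upwards [hn0, hNbig, hρ1, eventually_gt_atTop 0] with N hn hN hρ hN0
  have hN' : (0 : ℝ) < N := by exact_mod_cast hN0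
  have hn' : (0 : ℝ) < n N := by exact_mod_cast hn
  have hsn : 0 < √(n N : ℝ) := Real.sqrt_pos.2 hn'
  have hrp : (n N : ℝ) ^ (-(1 / 2) : ℝ) = (√(n N : ℝ))⁻¹ := by
    rw [Real.rpow_neg hn'.le, Real.sqrt_eq_rpow]
  have hp0 : (0 : ℝ) < p := by positivity
  set D : ℝ := p * ((J N : ℝ) + 1) / N with hD
  have hD0 : 0 < D := by positivity
  have hsD : 0 < √D := Real.sqrt_pos.2 hD0
  have ht : 0 < δ * (n N : ℝ) ^ (-(1 / 2) : ℝ) := by positivity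
  have key := measure_error_le (P := P) hη hG hξ hε hm hφc hasum ha0 hak hφ hσ hp hN hn
    (ρ := A * ((1 : ℝ) / (J N + 1)) ^ (q + mu)) (by positivity) hρ (fun k => by
      obtain ⟨s, hs, hs2⟩ := happ (J N) (fpc lam psi k) (hA4.holder k)
      refine ⟨s, hs, fun x hx => (hs2 x hx).trans (mul_le_mul_of_nonneg_left ?_ (by positivity))⟩
      rw [ha]
      exact le_add_of_nonneg_left ENNReal.toReal_nonneg)
    -- The choice `s = √(D / n)` gives both terms of `s + W ^ 2 / s` expectations of the same order.
    -- After multiplication by `√n` this leaves `√D`, which tends to zero.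
    (hfit N) hh₀.2 (s := √D / √(n N : ℝ)) (by positivity) ht
  refine key.trans (le_of_eq ?_)
  rw [← ENNReal.ofReal_div_of_pos ht, ← hα, ← hc, hrp]
  congr 1
  simp only [R]
  have hJc : ((p * (J N + 1) : ℕ) : ℝ) = D * N := by
    rw [hD]
    push_cast
    field_simp
  have hnn : (n N : ℝ) = √(n N : ℝ) ^ 2 := (Real.sq_sqrt hn'.le).symm
  have hDD : D = √D ^ 2 := (Real.sq_sqrt hD0.le).symm
  have hD2 : (p : ℝ) * (((J N : ℝ) + 1) / N) = D := by rw [hD, mul_div_assoc]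
  have hD3 : c * p * M ^ 2 * (√(n N : ℝ) * (((J N : ℝ) + 1) / N)) = c * M ^ 2 * √(n N : ℝ) * D := by
    rw [← hD2]
    ring
  rw [hJc, hD2, hD3]
  have e1 : c / N * (D * N * M ^ 2) = c * D * M ^ 2 := by field_simp
  have e2 : c / N * (D * N * (M ^ 2 / n N)) / (√D / √(n N : ℝ))
      = c * M ^ 2 * (√D / √(n N : ℝ)) := by
    have : c / N * (D * N * (M ^ 2 / n N)) = c * M ^ 2 * (D / n N) := by field_simp
    rw [this, mul_div_assoc]
    congr 1
    rw [hnn]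
    nth_rewrite 1 [hDD]
    rw [Real.sqrt_sq hsn.le]
    field_simp
  have e3 : α / (n N : ℝ) = α * (√(n N : ℝ))⁻¹ * (√(n N : ℝ))⁻¹ := by
    nth_rewrite 1 [hnn]
    field_simp
  rw [e1, e2, e3]
  have hh : 1 - h₀ ≠ 0 := by linarith [hh₀.2]
  field_simp
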